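/- Let $\mathfrak g$ be the $N=2$ Ramond algebra, i.e. the complex Lie superalgebra with even basis elements $L_m,H_m,C$ and odd basis elements $G_m^{\pm}$ ($m\in\mathbb Z$), where $C$ is central and $$[L_m,L_n]=(n-m)L_{m+n}+\tfrac{1}{12}(m^3-m)\delta_{m+n,0}C,\quad [H_m,H_n]=\tfrac13 m\,\delta_{m+n,0}C,\quad [L_m,H_n]=nH_{m+n},$$ $$[L_m,G_p^\pm]=(p-\tfrac m2)G_{m+p}^\pm,\quad [H_m,G_p^\pm]=\pm G_{m+p}^\pm,\quad [G_p^\pm,G_q^\pm]=0,$$ $$[G_p^+,G_q^-]=-2L_{p+q}+(p-q)H_{p+q}+\tfrac13(p^2-\tfrac14)\delta_{p+q,0}C .$$ Modules are $\mathbb Z_2$-graded, $V=V_{\bar 0}\oplus V_{\bar 1}$; submodules are graded, and isomorphisms preserve the grading. For $\lambda\in\mathbb C$ put $V_\lambda=\{v\in V: L_0v=\lambda v\}$. A $\mathfrak g$-module $V$ is cuspidal if $V=\sum_\lambda V_\lambda$ and there is a positive integer $p$ with $\dim (V_\lambda)_\tau\le p$ for all $\lambda\in\mathbb C$ and $\tau\in\mathbb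 Z_2$; the least such $p$ is the length of $V$. For $a,b,c\in\mathbb C$ let $\mathcal R_{a,b,c}$ be the $\mathfrak g$-module with basis $v_i,v_i^{+-}$ (even) and $v_i^+,v_i^-$ (odd), $i\in\mathbb Z$, on which $C$ acts by $0$ and, for all $m,r,i,k\in\mathbb Z$, $$L_m v_i=(a+i+bm)v_{m+i},\qquad L_m v_k^\pm=(a+k+(b-\tfrac12)m)v_{m+k}^\pm,$$ $$H_m v_i=c\,v_{m+i},\qquad H_m v_k^\pm=(c\pm1)v_{m+k}^\pm,$$ $$G_r^\pm v_i=v_{r+i}^\pm,\qquad G_r^\pm v_i^\pm=0,$$ $$L_m v_i^{+-}=(a+i+(b-1)m)v_{m+i}^{+-}+\tfrac12(2b-c-2)m^2v_{i+m},$$ $$H_m v_i^{+-}=c\,v_{m+i}^{+-}-m(2b-c-2)v_{m+i},$$ $$G_r^+v_k^-=v_{k+r}^{+-}+(c+2-2b)r\,v_{k+r},\qquad G_r^-v_k^+=-v_{r+k}^{+-}-(2a+2k+(2b+c)r)v_{k+r},$$ $$G_r^-v_i^{+-}=-(2a+2i+(2b+c-2)r)v_{r+i}^-,\qquad G_r^+v_i^{+-}=(2b-c-2)r\,v_{r+i}^+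 .$$ Then every simple cuspidal $\mathfrak g$-module of length $2$ is isomorphic, up to parity change (interchanging the two parts of the $\mathbb Z_2$-grading), to $\mathcal R_{a,b,c}$ for some $a,b,c\in\mathbb C$ with $2b+c\ne2$ and $2b-c\ne2$. Moreover, for all $a,b,c\in\mathbb C$, the module $\mathcal R_{a,b,c}$ is simple if and only if $2b+c\neq 2$ and $2b-c\ne2$. -/

import Mathlib

/-- A Lie superalgebra structure over `ℂ` on a vector space `A`: a `ℤ/2`-grading
`A = part 0 ⊕ part 1` and an even bilinear bracket that is super-skew-symmetric and satisfies
the super Jacobi identity on homogeneous elements. -/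
class LieSuperalgebra (A : Type*) [AddCommGroup A] [Module ℂ A] where
  part : ZMod 2 → Submodule ℂ A
  isCompl : IsCompl (part 0) (part 1)
  bracket : A →ₗ[ℂ] A →ₗ[ℂ] A
  bracket_mem : ∀ {σ τ : ZMod 2} {x y : A}, x ∈ part σ → y ∈ part τ →
    bracket x y ∈ part (σ + τ)
  bracket_skew : ∀ {σ τ : ZMod 2} {x y : A}, x ∈ part σ → y ∈ part τ →
    bracket y x = -((-1 : ℂ) ^ (σ.val * τ.val) • bracket x y)
  jacobi : ∀ {σ τ ρ : ZMod 2} {x y z : A}, x ∈ part σ → y ∈ part τ → z ∈ part ρ →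
    bracket x (bracket y z) =
      bracket (bracket x y) z + (-1 : ℂ) ^ (σ.val * τ.val) • bracket y (bracket x z)

/-- A module over a Lie superalgebra `A` with underlying vector space `V`: a `ℤ/2`-grading
`V = part 0 ⊕ part 1` and a bilinear action `A × V → V`, compatible with the gradings, with
`x (y v) - (-1)^{|x||y|} y (x v) = [x, y] v` for homogeneous `x`, `y`. -/
structure SuperModule (A : Type*) [AddCommGroup A] [Module ℂ A] [LieSuperalgebra A]
    (V : Type*) [AddCommGroup V] [Module ℂ V] where
  part : ZMod 2 → Submodule ℂ V
  isCompl : IsCompl (part 0) (part 1)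
  act : A →ₗ[ℂ] V →ₗ[ℂ] V
  act_mem : ∀ {σ τ : ZMod 2} {x : A} {v : V}, x ∈ LieSuperalgebra.part σ → v ∈ part τ →
    act x v ∈ part (σ + τ)
  act_bracket : ∀ {σ τ : ZMod 2} {x y : A} (v : V),
    x ∈ LieSuperalgebra.part σ → y ∈ LieSuperalgebra.part τ →
    act x (act y v) - (-1 : ℂ) ^ (σ.val * τ.val) • act y (act x v) =
      act (LieSuperalgebra.bracket x y) v

namespace SuperModule

variable {A : Type*} [AddCommGroup A] [Module ℂ A] [LieSuperalgebra A]
variable {V : Type*} [AddCommGroup V] [Module ℂ V]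
variable {W : Type*} [AddCommGroup W] [Module ℂ W]

/-- The parity change of a module: the same space and action, with the two parts of the
`ℤ/2`-grading interchanged. -/
def parityChange (M : SuperModule A V) : SuperModule A V where
  part τ := M.part (τ + 1)
  isCompl := M.isCompl.symm
  act := M.act
  act_mem := by
    intro σ τ x v hx hv
    rw [add_assoc]
    exact M.act_mem hx hv
  act_bracket := fun v hx hy => M.act_bracket v hx hy

/-- Isomorphism of modules: a linear bijection that preserves parity and commutes with the
action. -/
def Isomorphic (M : SuperModule A V) (N : SuperModule A W) : Prop :=
  ∃ e : V ≃ₗ[ℂ] W, (∀ (τ : ZMod 2) (v : V), v ∈ M.part τ → e v ∈ N.part τ) ∧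
    ∀ (x : A) (v : V), e (M.act x v) = N.act x (e v)

/-- A submodule (sub-object in the category of `ℤ/2`-graded modules): a linear subspace that is
stable under the action and is the sum of its even and odd parts. -/
def IsSubmodule (M : SuperModule A V) (N : Submodule ℂ V) : Prop :=
  (∀ (x : A), ∀ v ∈ N, M.act x v ∈ N) ∧ N = (N ⊓ M.part 0) ⊔ (N ⊓ M.part 1)

/-- A simple module: nonzero, and the only submodules are `0` and the whole module. -/
def IsSimple (M : SuperModule A V) : Prop :=
  Nontrivial V ∧ ∀ N : Submodule ℂ V, M.IsSubmodule N → N = ⊥ ∨ N = ⊤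

end SuperModule

/-- Index set of the basis `L_m, H_m, G_m^+, G_m^-, C` (`m ∈ ℤ`). -/
inductive RamondIndex : Type
  | L (m : ℤ)
  | H (m : ℤ)
  | Gp (m : ℤ)
  | Gm (m : ℤ)
  | C

/-- The underlying vector space of the `N = 2` Ramond algebra: the complex vector space with
basis `L_m, H_m, G_m^+, G_m^-, C` (`m ∈ ℤ`). -/
abbrev Ramond : Type := RamondIndex →₀ ℂ

namespace Ramond

noncomputable section

/-- The basis element `L_m`. -/
def L (m : ℤ) : Ramond := Finsupp.single (RamondIndex.L m) 1
/-- The basis element `H_m`. -/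
def H (m : ℤ) : Ramond := Finsupp.single (RamondIndex.H m) 1
/-- The basis element `G_m^+`. -/
def Gp (m : ℤ) : Ramond := Finsupp.single (RamondIndex.Gp m) 1
/-- The basis element `G_m^-`. -/
def Gm (m : ℤ) : Ramond := Finsupp.single (RamondIndex.Gm m) 1
/-- The central basis element `C`. -/
def C : Ramond := Finsupp.single RamondIndex.C 1

/-- Parity of the basis elements: `L_m, H_m, C` are even, `G_m^+, G_m^-` are odd. -/
def parity : RamondIndex → ZMod 2
  | .L _ => 0
  | .H _ => 0
  | .Gp _ => 1
  | .Gm _ => 1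
  | .C => 0

/-- The brackets of the basis elements.  The central terms form the `2`-cocycle for which the
super Jacobi identity holds: `[L_m, L_n] = (n - m) L_{m+n} + (m^3 - m)/12 δ_{m+n,0} C`. -/
def bracketBasis : RamondIndex → RamondIndex → Ramond
  | .L m, .L n => ((n : ℂ) - m) • L (m + n) +
      (if m + n = 0 then ((m : ℂ) ^ 3 - m) / 12 else 0) • C
  | .L m, .H n => (n : ℂ) • H (m + n)
  | .H m, .L n => -(m : ℂ) • H (m + n)
  | .H m, .H n => (if m + n = 0 then (m : ℂ) / 3 else 0) • C
  | .L m, .Gp p => ((p : ℂ) - m / 2) • Gp (m + p)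
  | .L m, .Gm p => ((p : ℂ) - m / 2) • Gm (m + p)
  | .Gp p, .L m => -((p : ℂ) - m / 2) • Gp (p + m)
  | .Gm p, .L m => -((p : ℂ) - m / 2) • Gm (p + m)
  | .H m, .Gp p => Gp (m + p)
  | .H m, .Gm p => -Gm (m + p)
  | .Gp p, .H m => -Gp (p + m)
  | .Gm p, .H m => Gm (p + m)
  | .Gp p, .Gm q => (-2 : ℂ) • L (p + q) + ((p : ℂ) - q) • H (p + q) +
      (if p + q = 0 then ((p : ℂ) ^ 2 - 1 / 4) / 3 else 0) • C
  | .Gm q, .Gp p => (-2 : ℂ) • L (q + p) + ((p : ℂ) - q) • H (q + p) +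
      (if q + p = 0 then ((p : ℂ) ^ 2 - 1 / 4) / 3 else 0) • C
  | .Gp _, .Gp _ => 0
  | .Gm _, .Gm _ => 0
  | .C, _ => 0
  | _, .C => 0

/-- The bracket, extended bilinearly from the basis. -/
def bracket : Ramond →ₗ[ℂ] Ramond →ₗ[ℂ] Ramond :=
  Finsupp.linearCombination ℂ fun i => Finsupp.linearCombination ℂ fun j => bracketBasis i j

/-- The even and odd parts: the spans of the even and of the odd basis elements. -/
def part (σ : ZMod 2) : Submodule ℂ Ramond := Finsupp.supported ℂ ℂ {i | parity i = σ}

theorem part_eq_span (σ : ZMod 2) :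
    part σ = Submodule.span ℂ ((fun i => Finsupp.single i (1 : ℂ)) '' {i | parity i = σ}) :=
  Finsupp.supported_eq_span_single ℂ _

theorem single_mem_part (i : RamondIndex) : Finsupp.single i (1 : ℂ) ∈ part (parity i) :=
  Finsupp.single_mem_supported ℂ _ rfl

/-- Induction principle for homogeneous elements. -/
theorem part_induction {σ : ZMod 2} {p : Ramond → Prop}
    (h : ∀ i, parity i = σ → p (Finsupp.single i 1)) (h_zero : p 0)
    (h_add : ∀ x y, p x → p y → p (x + y)) (h_smul : ∀ (t : ℂ) x, p x → p (t • x))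
    {x : Ramond} (hx : x ∈ part σ) : p x := by
  rw [part_eq_span] at hx
  induction hx using Submodule.span_induction with
  | mem x hx =>
    obtain ⟨i, hi, rfl⟩ := hx
    exact h i hi
  | zero => exact h_zero
  | add x y _ _ hx hy => exact h_add x y hx hy
  | smul t x _ hx => exact h_smul t x hx

theorem bracket_single (i j : RamondIndex) :
    bracket (Finsupp.single i 1) (Finsupp.single j 1) = bracketBasis i j := by
  simp [bracket]

theorem part_isCompl : IsCompl (part 0) (part 1) := by
  constructor
  · refine Finsupp.disjoint_supported_supported ?_
    rw [Set.disjoint_left]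
    intro i h0 h1
    replace h0 : parity i = 0 := h0
    replace h1 : parity i = 1 := h1
    rw [h0] at h1
    exact absurd h1 (by decide)
  · refine Finsupp.codisjoint_supported_supported ?_
    refine codisjoint_iff.2 (Set.eq_univ_of_forall fun i => ?_)
    change parity i = 0 ∨ parity i = 1
    cases i <;> simp [parity]

theorem L_mem (m : ℤ) : L m ∈ part 0 := single_mem_part (.L m)
theorem H_mem (m : ℤ) : H m ∈ part 0 := single_mem_part (.H m)
theorem Gp_mem (m : ℤ) : Gp m ∈ part 1 := single_mem_part (.Gp m)
theorem Gm_mem (m : ℤ) : Gm m ∈ part 1 := single_mem_part (.Gm m)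
theorem C_mem : C ∈ part 0 := single_mem_part .C

theorem bracketBasis_mem (i j : RamondIndex) : bracketBasis i j ∈ part (parity i + parity j) := by
  have h2 : (1 + 1 : ZMod 2) = 0 := by decide
  cases i <;> cases j <;> simp only [bracketBasis, parity, add_zero, zero_add, h2] <;>
    (repeat' first
    | with_reducible exact Submodule.zero_mem _
    | with_reducible exact L_mem _
    | with_reducible exact H_mem _
    | with_reducible exact Gp_mem _
    | with_reducible exact Gm_mem _
    | with_reducible exact C_mem
    | with_reducible apply Submodule.add_mem
    | with_reducible apply Submodule.neg_mem
    | with_reducible apply Submodule.smul_mem)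

theorem bracketBasis_skew (i j : RamondIndex) :
    bracketBasis j i =
      -((-1 : ℂ) ^ ((parity i).val * (parity j).val) • bracketBasis i j) := by
  have h1 : (1 : ZMod 2).val = 1 := rfl
  cases i <;> cases j <;>
    simp only [bracketBasis, parity, ZMod.val_zero, h1, mul_zero, mul_one, pow_zero,
      pow_one, one_smul, neg_smul, neg_neg, neg_zero, smul_zero]
  case L.L m n =>
    rw [add_comm n m]
    by_cases h : m + n = 0
    · obtain rfl : n = -m := by omega
      simp only [h, if_true]
      push_cast
      module
    · simp only [h, if_false]
      module
  case H.H m n =>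
    rw [add_comm n m]
    by_cases h : m + n = 0
    · obtain rfl : n = -m := by omega
      simp only [h, if_true]
      push_cast
      module
    · simp only [h, if_false]
      module
  all_goals simp only [Int.add_comm]

section Rules

variable (m n : ℤ)

theorem bracket_L_L : bracket (L m) (L n) = ((n : ℂ) - m) • L (m + n) +
    (if m + n = 0 then ((m : ℂ) ^ 3 - m) / 12 else 0) • C := bracket_single _ _
theorem bracket_L_H : bracket (L m) (H n) = (n : ℂ) • H (m + n) := bracket_single _ _
theorem bracket_H_L : bracket (H m) (L n) = -(m : ℂ) • H (m + n) := bracket_single _ _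
theorem bracket_H_H : bracket (H m) (H n) = (if m + n = 0 then (m : ℂ) / 3 else 0) • C :=
  bracket_single _ _
theorem bracket_L_Gp : bracket (L m) (Gp n) = ((n : ℂ) - m / 2) • Gp (m + n) :=
  bracket_single _ _
theorem bracket_L_Gm : bracket (L m) (Gm n) = ((n : ℂ) - m / 2) • Gm (m + n) :=
  bracket_single _ _
theorem bracket_Gp_L : bracket (Gp m) (L n) = -((m : ℂ) - n / 2) • Gp (m + n) :=
  bracket_single _ _
theorem bracket_Gm_L : bracket (Gm m) (L n) = -((m : ℂ) - n / 2) • Gm (m + n) :=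
  bracket_single _ _
theorem bracket_H_Gp : bracket (H m) (Gp n) = Gp (m + n) := bracket_single _ _
theorem bracket_H_Gm : bracket (H m) (Gm n) = -Gm (m + n) := bracket_single _ _
theorem bracket_Gp_H : bracket (Gp m) (H n) = -Gp (m + n) := bracket_single _ _
theorem bracket_Gm_H : bracket (Gm m) (H n) = Gm (m + n) := bracket_single _ _
theorem bracket_Gp_Gm : bracket (Gp m) (Gm n) =
    (-2 : ℂ) • L (m + n) + ((m : ℂ) - n) • H (m + n) +
      (if m + n = 0 then ((m : ℂ) ^ 2 - 1 / 4) / 3 else 0) • C := bracket_single _ _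
theorem bracket_Gm_Gp : bracket (Gm m) (Gp n) =
    (-2 : ℂ) • L (m + n) + ((n : ℂ) - m) • H (m + n) +
      (if m + n = 0 then ((n : ℂ) ^ 2 - 1 / 4) / 3 else 0) • C := bracket_single _ _
theorem bracket_Gp_Gp : bracket (Gp m) (Gp n) = 0 := bracket_single _ _
theorem bracket_Gm_Gm : bracket (Gm m) (Gm n) = 0 := bracket_single _ _

theorem bracket_C_left (x : Ramond) : bracket C x = 0 := by
  have : bracket C = 0 := by
    refine Finsupp.lhom_ext' fun j => LinearMap.ext_ring ?_
    change bracket (Finsupp.single .C 1) (Finsupp.single j 1) = 0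
    rw [bracket_single]
    cases j <;> rfl
  rw [this, LinearMap.zero_apply]

theorem bracket_C_right (x : Ramond) : bracket x C = 0 := by
  have : bracket.flip C = 0 := by
    refine Finsupp.lhom_ext' fun j => LinearMap.ext_ring ?_
    change bracket (Finsupp.single j 1) (Finsupp.single .C 1) = 0
    rw [bracket_single]
    cases j <;> rfl
  have h := LinearMap.congr_fun this x
  simpa using h

end Rules

set_option maxHeartbeats 4000000 in
theorem jacobi_basis (i j k : RamondIndex) :
    bracket (Finsupp.single i 1) (bracket (Finsupp.single j 1) (Finsupp.single k 1)) =
      bracket (bracket (Finsupp.single i 1) (Finsupp.single j 1)) (Finsupp.single k 1) +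
      (-1 : ℂ) ^ ((parity i).val * (parity j).val) •
        bracket (Finsupp.single j 1) (bracket (Finsupp.single i 1) (Finsupp.single k 1)) := by
  have h1 : (1 : ZMod 2).val = 1 := rfl
  have hL : ∀ m, Finsupp.single (RamondIndex.L m) (1 : ℂ) = L m := fun _ => rfl
  have hH : ∀ m, Finsupp.single (RamondIndex.H m) (1 : ℂ) = H m := fun _ => rfl
  have hGp : ∀ m, Finsupp.single (RamondIndex.Gp m) (1 : ℂ) = Gp m := fun _ => rfl
  have hGm : ∀ m, Finsupp.single (RamondIndex.Gm m) (1 : ℂ) = Gm m := fun _ => rfl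
  have hC : Finsupp.single RamondIndex.C (1 : ℂ) = C := rfl
  rcases i with l | l | l | l | _ <;> rcases j with m | m | m | m | _ <;>
  rcases k with n | n | n | n | _ <;>
  simp only [hL, hH, hGp, hGm, hC, parity, ZMod.val_zero, h1, mul_zero, mul_one,
    pow_zero, pow_one, bracket_L_L, bracket_L_H, bracket_H_L, bracket_H_H, bracket_L_Gp,
    bracket_L_Gm, bracket_Gp_L, bracket_Gm_L, bracket_H_Gp, bracket_H_Gm, bracket_Gp_H,
    bracket_Gm_H, bracket_Gp_Gm, bracket_Gm_Gp, bracket_Gp_Gp, bracket_Gm_Gm, bracket_C_left,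
    bracket_C_right, map_add, map_smul, map_neg, map_zero, LinearMap.add_apply,
    LinearMap.smul_apply, LinearMap.neg_apply, LinearMap.zero_apply, smul_zero, add_zero,
    zero_add, neg_zero, Int.add_left_comm,
    Int.add_comm] <;>
  (by_cases h : l + (m + n) = 0
   · obtain rfl : n = -l - m := by omega
     try simp only [h, if_true]
     push_cast
     module
   · try simp only [h, if_false]
     push_cast
     module)

noncomputable instance : LieSuperalgebra Ramond where
  part := part
  isCompl := part_isCompl
  bracket := bracket
  bracket_mem := by
    intro σ τ x y hx hy
    refine part_induction (p := fun x => bracket x y ∈ part (σ + τ)) ?_ ?_ ?_ ?_ hx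
    · intro i hi
      refine part_induction (p := fun y => bracket _ y ∈ part (σ + τ)) ?_ ?_ ?_ ?_ hy
      · intro j hj
        rw [bracket_single, ← hi, ← hj]
        exact bracketBasis_mem i j
      · rw [map_zero]; exact Submodule.zero_mem _
      · intro y z hy hz; rw [map_add]; exact Submodule.add_mem _ hy hz
      · intro t y hy; rw [map_smul]; exact Submodule.smul_mem _ _ hy
    · rw [map_zero]; exact Submodule.zero_mem _
    · intro y z hy hz; rw [map_add]; exact Submodule.add_mem _ hy hz
    · intro t y hy; rw [map_smul]; exact Submodule.smul_mem _ _ hy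
  bracket_skew := by
    intro σ τ x y hx hy
    refine part_induction (p := fun x => bracket y x = -(_ • bracket x y)) ?_ ?_ ?_ ?_ hx
    · intro i hi
      refine part_induction (p := fun y => bracket y _ = -(_ • bracket _ y)) ?_ ?_ ?_ ?_ hy
      · intro j hj
        rw [bracket_single, bracket_single, ← hi, ← hj]
        exact bracketBasis_skew i j
      · simp
      · intro y z hy hz; simp only [map_add, LinearMap.add_apply, hy, hz]; module
      · intro t y hy; simp only [map_smul, LinearMap.smul_apply, hy]; module
    · simp
    · intro y z hy hz; simp only [map_add, LinearMap.add_apply, hy, hz]; module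
    · intro t y hy; simp only [map_smul, LinearMap.smul_apply, hy]; module
  jacobi := by
    intro σ τ ρ x y z hx hy hz
    refine part_induction (p := fun x => bracket x (bracket y z) =
      bracket (bracket x y) z + _ • bracket y (bracket x z)) ?_ ?_ ?_ ?_ hx
    · intro i hi
      refine part_induction (p := fun y => bracket _ (bracket y z) =
        bracket (bracket _ y) z + _ • bracket y (bracket _ z)) ?_ ?_ ?_ ?_ hy
      · intro j hj
        refine part_induction (p := fun z => bracket _ (bracket _ z) =
          bracket (bracket _ _) z + _ • bracket _ (bracket _ z)) ?_ ?_ ?_ ?_ hz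
        · intro k _
          rw [← hi, ← hj]
          exact jacobi_basis i j k
        · simp
        · intro y z hy hz; simp only [map_add, hy, hz]; module
        · intro t y hy; simp only [map_smul, hy]; module
      · simp
      · intro y z hy hz; simp only [map_add, LinearMap.add_apply, hy, hz]; module
      · intro t y hy; simp only [map_smul, LinearMap.smul_apply, hy]; module
    · simp
    · intro y z hy hz; simp only [map_add, LinearMap.add_apply, hy, hz]; module
    · intro t y hy; simp only [map_smul, LinearMap.smul_apply, hy]; module

end

end Ramond

namespace SuperModule

section Cuspidal

variable {V : Type*} [AddCommGroup V] [Module ℂ V]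

/-- The weight space `V_μ = {v | L_0 v = μ v}`. -/
noncomputable def weightSpace (M : SuperModule Ramond V) (μ : ℂ) : Submodule ℂ V :=
  Module.End.eigenspace (M.act (Ramond.L 0)) μ

/-- A weight module: the sum of its weight spaces. -/
def IsWeight (M : SuperModule Ramond V) : Prop := ⨆ μ : ℂ, M.weightSpace μ = ⊤

/-- `p` is a positive integer with `dim (V_μ)_τ ≤ p` for all weights `μ` and parities `τ`. -/
def IsDimBound (M : SuperModule Ramond V) (p : ℕ) : Prop :=
  0 < p ∧ ∀ (μ : ℂ) (τ : ZMod 2),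
    Module.rank ℂ (M.weightSpace μ ⊓ M.part τ : Submodule ℂ V) ≤ p

/-- A cuspidal module: a weight module with uniformly bounded homogeneous weight spaces. -/
def IsCuspidal (M : SuperModule Ramond V) : Prop := M.IsWeight ∧ ∃ p : ℕ, M.IsDimBound p

/-- The cuspidal module `M` has length `n`: `n` is the least uniform bound. -/
def HasLength (M : SuperModule Ramond V) (n : ℕ) : Prop := IsLeast {p : ℕ | M.IsDimBound p} n

end Cuspidal

end SuperModule

/-- Index set of the basis `v_i, v_i^+, v_i^-, v_i^{+-}` (`i ∈ ℤ`). -/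
inductive RModIndex : Type
  | v (i : ℤ)
  | vp (i : ℤ)
  | vm (i : ℤ)
  | vpm (i : ℤ)

/-- The complex vector space with basis `v_i, v_i^+, v_i^-, v_i^{+-}` (`i ∈ ℤ`). -/
abbrev RSpace : Type := RModIndex →₀ ℂ

namespace RSpace

noncomputable section

/-- The basis vector `v_i`. -/
def v (i : ℤ) : RSpace := Finsupp.single (RModIndex.v i) 1
/-- The basis vector `v_i^+`. -/
def vp (i : ℤ) : RSpace := Finsupp.single (RModIndex.vp i) 1
/-- The basis vector `v_i^-`. -/
def vm (i : ℤ) : RSpace := Finsupp.single (RModIndex.vm i) 1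
/-- The basis vector `v_i^{+-}`. -/
def vpm (i : ℤ) : RSpace := Finsupp.single (RModIndex.vpm i) 1

/-- Parity of the basis vectors: `v_i, v_i^{+-}` are even, `v_i^+, v_i^-` are odd. -/
def parity : RModIndex → ZMod 2
  | .v _ => 0
  | .vp _ => 1
  | .vm _ => 1
  | .vpm _ => 0

/-- The even and odd parts: the spans of the even and of the odd basis vectors. -/
def part (τ : ZMod 2) : Submodule ℂ RSpace := Finsupp.supported ℂ ℂ {k | parity k = τ}

/-- The action of the basis elements of the Ramond algebra on the basis vectors. -/
def actBasis (a b c : ℂ) : RamondIndex → RModIndex → RSpace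
  | .L m, .v i => (a + i + b * m) • v (m + i)
  | .L m, .vp k => (a + k + (b - 1 / 2) * m) • vp (m + k)
  | .L m, .vm k => (a + k + (b - 1 / 2) * m) • vm (m + k)
  | .L m, .vpm i => (a + i + (b - 1) * m) • vpm (m + i) +
      (1 / 2 * (2 * b - c - 2) * (m : ℂ) ^ 2) • v (m + i)
  | .H m, .v i => c • v (m + i)
  | .H m, .vp k => (c + 1) • vp (m + k)
  | .H m, .vm k => (c - 1) • vm (m + k)
  | .H m, .vpm i => c • vpm (m + i) - ((m : ℂ) * (2 * b - c - 2)) • v (m + i)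
  | .Gp r, .v i => vp (r + i)
  | .Gp _, .vp _ => 0
  | .Gp r, .vm k => vpm (r + k) + ((c + 2 - 2 * b) * r) • v (r + k)
  | .Gp r, .vpm i => ((2 * b - c - 2) * r) • vp (r + i)
  | .Gm r, .v i => vm (r + i)
  | .Gm r, .vp k => -vpm (r + k) - (2 * a + 2 * k + (2 * b + c) * r) • v (r + k)
  | .Gm _, .vm _ => 0
  | .Gm r, .vpm i => -(2 * a + 2 * i + (2 * b + c - 2) * r) • vm (r + i)
  | .C, _ => 0

/-- The action, extended bilinearly from the bases. -/
def act (a b c : ℂ) : Ramond →ₗ[ℂ] RSpace →ₗ[ℂ] RSpace :=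
  Finsupp.linearCombination ℂ fun x => Finsupp.linearCombination ℂ fun k => actBasis a b c x k

theorem act_single (a b c : ℂ) (x : RamondIndex) (k : RModIndex) :
    act a b c (Finsupp.single x 1) (Finsupp.single k 1) = actBasis a b c x k := by
  simp [act]

theorem single_mem_part (k : RModIndex) : Finsupp.single k (1 : ℂ) ∈ part (parity k) :=
  Finsupp.single_mem_supported ℂ _ rfl

theorem part_induction {τ : ZMod 2} {p : RSpace → Prop}
    (h : ∀ k, parity k = τ → p (Finsupp.single k 1)) (h_zero : p 0)
    (h_add : ∀ x y, p x → p y → p (x + y)) (h_smul : ∀ (t : ℂ) x, p x → p (t • x))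
    {x : RSpace} (hx : x ∈ part τ) : p x := by
  rw [part, Finsupp.supported_eq_span_single] at hx
  induction hx using Submodule.span_induction with
  | mem x hx =>
    obtain ⟨i, hi, rfl⟩ := hx
    exact h i hi
  | zero => exact h_zero
  | add x y _ _ hx hy => exact h_add x y hx hy
  | smul t x _ hx => exact h_smul t x hx

theorem part_isCompl : IsCompl (part 0) (part 1) := by
  constructor
  · refine Finsupp.disjoint_supported_supported ?_
    rw [Set.disjoint_left]
    intro i h0 h1
    replace h0 : parity i = 0 := h0
    replace h1 : parity i = 1 := h1
    rw [h0] at h1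
    exact absurd h1 (by decide)
  · refine Finsupp.codisjoint_supported_supported ?_
    refine codisjoint_iff.2 (Set.eq_univ_of_forall fun i => ?_)
    change parity i = 0 ∨ parity i = 1
    cases i <;> simp [parity]

theorem v_mem (i : ℤ) : v i ∈ part 0 := single_mem_part (.v i)
theorem vp_mem (i : ℤ) : vp i ∈ part 1 := single_mem_part (.vp i)
theorem vm_mem (i : ℤ) : vm i ∈ part 1 := single_mem_part (.vm i)
theorem vpm_mem (i : ℤ) : vpm i ∈ part 0 := single_mem_part (.vpm i)

theorem actBasis_mem (a b c : ℂ) (x : RamondIndex) (k : RModIndex) :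
    actBasis a b c x k ∈ part (Ramond.parity x + parity k) := by
  have h2 : (1 + 1 : ZMod 2) = 0 := by decide
  cases x <;> cases k <;>
    simp only [actBasis, Ramond.parity, parity, add_zero, zero_add, h2] <;>
    (repeat' first
    | with_reducible exact Submodule.zero_mem _
    | with_reducible exact v_mem _
    | with_reducible exact vp_mem _
    | with_reducible exact vm_mem _
    | with_reducible exact vpm_mem _
    | with_reducible apply Submodule.add_mem
    | with_reducible apply Submodule.sub_mem
    | with_reducible apply Submodule.neg_mem
    | with_reducible apply Submodule.smul_mem)

section Rules

variable (a b c : ℂ) (m i : ℤ)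

theorem act_L_v : act a b c (Ramond.L m) (v i) = (a + i + b * m) • v (m + i) := act_single ..
theorem act_L_vp : act a b c (Ramond.L m) (vp i) = (a + i + (b - 1 / 2) * m) • vp (m + i) :=
  act_single ..
theorem act_L_vm : act a b c (Ramond.L m) (vm i) = (a + i + (b - 1 / 2) * m) • vm (m + i) :=
  act_single ..
theorem act_L_vpm : act a b c (Ramond.L m) (vpm i) = (a + i + (b - 1) * m) • vpm (m + i) +
    (1 / 2 * (2 * b - c - 2) * (m : ℂ) ^ 2) • v (m + i) := act_single ..
theorem act_H_v : act a b c (Ramond.H m) (v i) = c • v (m + i) := act_single ..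
theorem act_H_vp : act a b c (Ramond.H m) (vp i) = (c + 1) • vp (m + i) := act_single ..
theorem act_H_vm : act a b c (Ramond.H m) (vm i) = (c - 1) • vm (m + i) := act_single ..
theorem act_H_vpm : act a b c (Ramond.H m) (vpm i) =
    c • vpm (m + i) - ((m : ℂ) * (2 * b - c - 2)) • v (m + i) := act_single ..
theorem act_Gp_v : act a b c (Ramond.Gp m) (v i) = vp (m + i) := act_single ..
theorem act_Gp_vp : act a b c (Ramond.Gp m) (vp i) = 0 := act_single ..
theorem act_Gp_vm : act a b c (Ramond.Gp m) (vm i) =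
    vpm (m + i) + ((c + 2 - 2 * b) * m) • v (m + i) := act_single ..
theorem act_Gp_vpm : act a b c (Ramond.Gp m) (vpm i) =
    ((2 * b - c - 2) * m) • vp (m + i) := act_single ..
theorem act_Gm_v : act a b c (Ramond.Gm m) (v i) = vm (m + i) := act_single ..
theorem act_Gm_vp : act a b c (Ramond.Gm m) (vp i) =
    -vpm (m + i) - (2 * a + 2 * i + (2 * b + c) * m) • v (m + i) := act_single ..
theorem act_Gm_vm : act a b c (Ramond.Gm m) (vm i) = 0 := act_single ..
theorem act_Gm_vpm : act a b c (Ramond.Gm m) (vpm i) =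
    -(2 * a + 2 * i + (2 * b + c - 2) * m) • vm (m + i) := act_single ..

theorem act_C (x : RSpace) : act a b c Ramond.C x = 0 := by
  have : act a b c Ramond.C = 0 := by
    refine Finsupp.lhom_ext' fun j => LinearMap.ext_ring ?_
    change act a b c (Finsupp.single .C 1) (Finsupp.single j 1) = 0
    rw [act_single]
    cases j <;> rfl
  rw [this, LinearMap.zero_apply]

end Rules

set_option maxHeartbeats 4000000 in
theorem act_bracket_basis (a b c : ℂ) (x y : RamondIndex) (k : RModIndex) :
    act a b c (Finsupp.single x 1) (act a b c (Finsupp.single y 1) (Finsupp.single k 1)) -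
      (-1 : ℂ) ^ ((Ramond.parity x).val * (Ramond.parity y).val) •
        act a b c (Finsupp.single y 1) (act a b c (Finsupp.single x 1) (Finsupp.single k 1)) =
      act a b c (Ramond.bracketBasis x y) (Finsupp.single k 1) := by
  have h1 : (1 : ZMod 2).val = 1 := rfl
  have hL : ∀ m, Finsupp.single (RamondIndex.L m) (1 : ℂ) = Ramond.L m := fun _ => rfl
  have hH : ∀ m, Finsupp.single (RamondIndex.H m) (1 : ℂ) = Ramond.H m := fun _ => rfl
  have hGp : ∀ m, Finsupp.single (RamondIndex.Gp m) (1 : ℂ) = Ramond.Gp m := fun _ => rfl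
  have hGm : ∀ m, Finsupp.single (RamondIndex.Gm m) (1 : ℂ) = Ramond.Gm m := fun _ => rfl
  have hC : Finsupp.single RamondIndex.C (1 : ℂ) = Ramond.C := rfl
  have h_v : ∀ m, Finsupp.single (RModIndex.v m) (1 : ℂ) = v m := fun _ => rfl
  have h_vp : ∀ m, Finsupp.single (RModIndex.vp m) (1 : ℂ) = vp m := fun _ => rfl
  have h_vm : ∀ m, Finsupp.single (RModIndex.vm m) (1 : ℂ) = vm m := fun _ => rfl
  have h_vpm : ∀ m, Finsupp.single (RModIndex.vpm m) (1 : ℂ) = vpm m := fun _ => rfl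
  rcases x with l | l | l | l | _ <;> rcases y with m | m | m | m | _ <;>
  rcases k with n | n | n | n <;>
  simp only [hL, hH, hGp, hGm, hC, h_v, h_vp, h_vm, h_vpm, Ramond.bracketBasis, Ramond.parity,
    ZMod.val_zero, h1, mul_zero, mul_one, pow_zero, pow_one, act_L_v, act_L_vp,
    act_L_vm, act_L_vpm, act_H_v, act_H_vp, act_H_vm, act_H_vpm, act_Gp_v, act_Gp_vp, act_Gp_vm,
    act_Gp_vpm, act_Gm_v, act_Gm_vp, act_Gm_vm, act_Gm_vpm, act_C, map_add, map_sub, map_smul,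
    map_neg, map_zero, LinearMap.add_apply, LinearMap.smul_apply, LinearMap.neg_apply,
    LinearMap.zero_apply, smul_zero, add_zero, sub_zero, Int.add_left_comm,
    Int.add_comm] <;>
  push_cast <;> module

end

end RSpace

/-- The module `R_{a,b,c}` over the `N = 2` Ramond algebra. -/
noncomputable def RModule (a b c : ℂ) : SuperModule Ramond RSpace where
  part := RSpace.part
  isCompl := RSpace.part_isCompl
  act := RSpace.act a b c
  act_mem := by
    intro σ τ x v hx hv
    refine Ramond.part_induction (p := fun x => RSpace.act a b c x v ∈ RSpace.part (σ + τ))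
      ?_ ?_ ?_ ?_ hx
    · intro i hi
      refine RSpace.part_induction (p := fun v => RSpace.act a b c _ v ∈ RSpace.part (σ + τ))
        ?_ ?_ ?_ ?_ hv
      · intro j hj
        rw [RSpace.act_single, ← hi, ← hj]
        exact RSpace.actBasis_mem a b c i j
      · rw [map_zero]; exact Submodule.zero_mem _
      · intro y z hy hz; rw [map_add]; exact Submodule.add_mem _ hy hz
      · intro t y hy; rw [map_smul]; exact Submodule.smul_mem _ _ hy
    · rw [map_zero]; exact Submodule.zero_mem _
    · intro y z hy hz; rw [map_add]; exact Submodule.add_mem _ hy hz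
    · intro t y hy; rw [map_smul]; exact Submodule.smul_mem _ _ hy
  act_bracket := by
    intro σ τ x y v hx hy
    change _ = RSpace.act a b c (Ramond.bracket x y) v
    refine Ramond.part_induction (p := fun x => RSpace.act a b c x (RSpace.act a b c y v) -
      _ • RSpace.act a b c y (RSpace.act a b c x v) = RSpace.act a b c (Ramond.bracket x y) v)
      ?_ ?_ ?_ ?_ hx
    · intro i hi
      refine Ramond.part_induction (p := fun y => RSpace.act a b c _ (RSpace.act a b c y v) -
        _ • RSpace.act a b c y (RSpace.act a b c _ v) = RSpace.act a b c (Ramond.bracket _ y) v)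
        ?_ ?_ ?_ ?_ hy
      · intro j hj
        rw [Ramond.bracket_single, ← hi, ← hj]
        induction v using Finsupp.induction_linear with
        | zero => simp
        | add f g hf hg => simp only [map_add, ← hf, ← hg]; module
        | single k t =>
          have hk : Finsupp.single k t = t • Finsupp.single k (1 : ℂ) := by simp
          rw [hk]
          simp only [map_smul, ← RSpace.act_bracket_basis a b c i j k]
          module
      · simp
      · intro y z hy hz; simp only [map_add, LinearMap.add_apply, ← hy, ← hz]; module
      · intro t y hy; simp only [map_smul, LinearMap.smul_apply, ← hy]; module
    · simp
    · intro y z hy hz; simp only [map_add, LinearMap.add_apply, ← hy, ← hz]; module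
    · intro t y hy; simp only [map_smul, LinearMap.smul_apply, ← hy]; module

/-! Let `M` be simple, cuspidal and of length two. On `M` the central element is a scalar, and the
`H_m` then form a Heisenberg algebra whose level is a multiple of that scalar. A trace computation
excludes bounded weight spaces at nonzero level, so `C` acts by zero
(`SuperModule.IsCuspidal.act_C_eq_zero`).

Call an eigenvalue of `H_0` a charge. The operators `G^+` and `G^-` raise and lower it by one, and
only finitely many charges occur in a class `c + ℤ`. If zero were both the highest and the lowest of
them, all odd operators would vanish and the weight spaces would be too small. So some extreme
charge is nonzero, and exchanging `G^+` with `G^-` if necessary makes it the highest one.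

On that charge space of fixed parity the Heisenberg–Virasoro algebra acts with `H_0` a nonzero
scalar and weight spaces of dimension at most two. There every `H_n` is bijective, some weight
vector satisfies `H_a H_b = c H_{a+b}`, and a suitable choice of it spans an intermediate series
`w_i` (`HeisenbergVirasoroRep.exists_intermediate_series`). It is killed by all `G^+`.

The vectors `G^-_r w_{n-r}` are sent by each `G^+_s` to multiples of `w_{n+s}` that are affine in
`r`. Their deviation from an affine function of `r` is thus killed by all `G^+` and has charge one
below that of `w`; in a simple module it must be zero. Either the affine function is constant, and
`w` itself transforms like the `v_i`, or its slope does
(`RamondRep.Simple.exists_flat_of_singular`).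

Such a flat family forces all relations of `R_{a,b,c}` and so defines a surjection from `R_{a,b,c}`
onto `M`. If `2b + c = 2` or `2b - c = 2`, an explicit proper submodule shows that `M` is spanned by
one family of each parity, hence has length one. Otherwise `R_{a,b,c}` is simple and the surjection
is an isomorphism, up to the parity of the family. The two explicit submodules also give the
converse in the simplicity criterion (`RModule.isSimple_iff`). -/

/-! ### Eigenvectors, commuting operators and Weyl pairs. -/

section LinearAlgebra

variable {V : Type*} [AddCommGroup V] [Module ℂ V]

/-- If a subspace is stable under `f` and contains a sum of eigenvectors of `f` with distinct
eigenvalues, then it contains each of them. -/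
theorem Submodule.mem_of_sum_eigenvector_mem (f : Module.End ℂ V) (p : Submodule ℂ V)
    (hp : ∀ x ∈ p, f x ∈ p) (s : Finset ℂ) :
    ∀ g : ℂ → V, (∀ μ, f (g μ) = μ • g μ) → ∑ μ ∈ s, g μ ∈ p → ∀ μ ∈ s, g μ ∈ p := by
  classical
  induction s using Finset.induction_on with
  | empty => intro g _ _ μ hμ; simp at hμ
  | insert ν s hν ih =>
    intro g hg h
    have h1 : ∑ μ ∈ s, (μ - ν) • g μ ∈ p := by
      have h2 := p.sub_mem (hp _ h) (p.smul_mem ν h)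
      rw [Finset.sum_insert hν, map_add, smul_add, hg, map_sum, Finset.smul_sum] at h2
      have : ν • g ν + ∑ x ∈ s, f (g x) - (ν • g ν + ∑ x ∈ s, ν • g x) =
          ∑ μ ∈ s, (μ - ν) • g μ := by
        rw [add_sub_add_left_eq_sub, ← Finset.sum_sub_distrib]
        exact Finset.sum_congr rfl fun x _ => by rw [hg, sub_smul]
      rwa [this] at h2
    have h3 : ∀ μ ∈ s, g μ ∈ p := by
      intro μ hμ
      have h4 := ih (fun μ => (μ - ν) • g μ) (fun μ => by rw [map_smul, hg, smul_comm]) h1 μ hμ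
      have h5 : μ - ν ≠ 0 := sub_ne_zero.2 fun h => hν (h ▸ hμ)
      simpa [smul_smul, inv_mul_cancel₀ h5] using p.smul_mem (μ - ν)⁻¹ h4
    intro μ hμ
    rcases Finset.mem_insert.1 hμ with rfl | hμ
    · rw [Finset.sum_insert hν] at h
      exact (p.add_mem_iff_left (p.sum_mem h3)).1 h
    · exact h3 μ hμ

theorem Submodule.le_iSup_inf_eigenspace {f : Module.End ℂ V} (hf : ⨆ μ, f.eigenspace μ = ⊤)
    {p : Submodule ℂ V} (hp : ∀ x ∈ p, f x ∈ p) : p ≤ ⨆ μ, p ⊓ f.eigenspace μ := by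
  intro x hx
  have h1 : x ∈ ⨆ μ, f.eigenspace μ := hf ▸ Submodule.mem_top
  obtain ⟨g, hg, rfl⟩ := (Submodule.mem_iSup_iff_exists_finsupp _ _).1 h1
  have h2 := p.mem_of_sum_eigenvector_mem f hp g.support g
    (fun μ => Module.End.mem_eigenspace_iff.1 (hg μ)) hx
  exact Submodule.sum_mem _ fun μ hμ => Submodule.mem_iSup_of_mem μ ⟨h2 μ hμ, hg μ⟩

theorem Submodule.exists_eigenvector_mem {f : Module.End ℂ V} (hf : ⨆ μ, f.eigenspace μ = ⊤)
    {p : Submodule ℂ V} (hp : ∀ x ∈ p, f x ∈ p) (h : p ≠ ⊥) :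
    ∃ μ : ℂ, ∃ v ∈ p, v ≠ 0 ∧ f v = μ • v := by
  by_contra! h1
  refine h (eq_bot_iff.2 ((Submodule.le_iSup_inf_eigenspace hf hp).trans ?_))
  refine iSup_le fun μ x hx => ?_
  by_contra h2
  exact h1 μ x hx.1 h2 (Module.End.mem_eigenspace_iff.1 hx.2)

theorem Module.End.iSup_eigenspace_restrict_eq_top {f : Module.End ℂ V}
    (hf : ⨆ μ, f.eigenspace μ = ⊤) {p : Submodule ℂ V} (hp : ∀ x ∈ p, f x ∈ p) :
    ⨆ μ, Module.End.eigenspace (LinearMap.restrict f hp) μ = ⊤ := by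
  refine Submodule.map_injective_of_injective p.injective_subtype ?_
  rw [Submodule.map_iSup, Submodule.map_top, Submodule.range_subtype]
  refine le_antisymm (iSup_le fun μ => ?_) ((Submodule.le_iSup_inf_eigenspace hf hp).trans
    (iSup_mono fun μ x hx => ?_))
  · rintro _ ⟨x, -, rfl⟩
    exact x.2
  · refine ⟨⟨x, hx.1⟩, ?_, rfl⟩
    rw [SetLike.mem_coe, Module.End.mem_eigenspace_iff]
    exact Subtype.ext (Module.End.mem_eigenspace_iff.1 hx.2)

/-- Commuting operators
that preserve a nonzero finite-dimensional subspace have a common eigenvector in it. -/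
theorem Module.End.exists_common_eigenvector {ι : Type*} (f : ι → Module.End ℂ V)
    (hf : ∀ i j, Commute (f i) (f j)) (U : Submodule ℂ V) [FiniteDimensional ℂ U] (hU : U ≠ ⊥)
    (hfU : ∀ i, ∀ v ∈ U, f i v ∈ U) : ∃ v ∈ U, v ≠ 0 ∧ ∀ i, ∃ t : ℂ, f i v = t • v := by
  obtain ⟨d, hd⟩ : ∃ d, Module.finrank ℂ U = d := ⟨_, rfl⟩
  induction d using Nat.strong_induction_on generalizing U with
  | _ d ih =>
    -- If all operators are scalar on `U`, any nonzero vector works. Otherwise an eigenspace of a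
    -- non-scalar one is a smaller subspace, stable under the others by commutation.
    by_cases h : ∀ i, ∃ t : ℂ, ∀ v ∈ U, f i v = t • v
    · obtain ⟨v, hv, hv0⟩ := (Submodule.ne_bot_iff _).1 hU
      exact ⟨v, hv, hv0, fun i => (h i).imp fun t ht => ht v hv⟩
    · push Not at h
      obtain ⟨i, hi⟩ := h
      have : Nontrivial U := Submodule.nontrivial_iff_ne_bot.2 hU
      obtain ⟨t, ht⟩ := Module.End.exists_eigenvalue (LinearMap.restrict (f i) (hfU i))
      obtain ⟨u, hu⟩ := ht.exists_hasEigenvector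
      have hu1 : f i u = t • (u : V) := congrArg Subtype.val hu.apply_eq_smul
      have hu0 : (u : V) ≠ 0 := fun h0 => hu.2 (Subtype.ext h0)
      have hle : U ⊓ (f i).eigenspace t ≤ U := inf_le_left
      have hlt : U ⊓ (f i).eigenspace t < U := by
        refine lt_of_le_of_ne hle fun h0 => ?_
        obtain ⟨v, hv, hv1⟩ := hi t
        exact hv1 (Module.End.mem_eigenspace_iff.1 (h0.ge hv).2)
      have : FiniteDimensional ℂ (U ⊓ (f i).eigenspace t : Submodule ℂ V) :=
        Submodule.finiteDimensional_of_le hle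
      obtain ⟨v, hv, h1⟩ := ih _ (hd ▸ Submodule.finrank_lt_finrank_of_lt hlt)
        (U ⊓ (f i).eigenspace t)
        ((Submodule.ne_bot_iff _).2 ⟨u, ⟨u.2, Module.End.mem_eigenspace_iff.2 hu1⟩, hu0⟩)
        (fun j v hv => ⟨hfU j v hv.1, by
          rw [SetLike.mem_coe, Module.End.mem_eigenspace_iff, ← Module.End.mul_apply, (hf i j).eq,
            Module.End.mul_apply, Module.End.mem_eigenspace_iff.1 hv.2, map_smul]⟩) rfl
      exact ⟨v, hle hv, h1⟩

/-- A vector of a plane is a combination of two independent ones. -/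
theorem Submodule.exists_eq_add_of_finrank_le_two {U : Submodule ℂ V} [FiniteDimensional ℂ U]
    (hU : Module.finrank ℂ U ≤ 2) {u v w : V} (hu : u ∈ U) (hv : v ∈ U) (hw : w ∈ U)
    (huv : LinearIndependent ℂ ![u, v]) : ∃ s t : ℂ, w = s • u + t • v := by
  have h1 : span ℂ (Set.range ![u, v]) ≤ U := by
    rw [Submodule.span_le]
    rintro _ ⟨i, rfl⟩
    fin_cases i
    · exact hu
    · exact hv
  have h2 : span ℂ (Set.range ![u, v]) = U := by
    refine Submodule.eq_of_le_of_finrank_le h1 ?_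
    rw [finrank_span_eq_card huv]
    simpa using hU
  rw [← h2] at hw
  simp only [Matrix.range_cons, Matrix.range_empty, Set.union_empty, Set.singleton_union] at hw
  obtain ⟨s, t, h⟩ := Submodule.mem_span_pair.1 hw
  exact ⟨s, t, h.symm⟩

/-- Jacobson's lemma on a space of dimension at most two: if `D = [A, Y]` commutes with `Y`, then
`D` kills every common eigenvector of `Y` and `D`. -/
theorem Module.End.eigenvalue_commutator_eq_zero {U : Submodule ℂ V} [FiniteDimensional ℂ U]
    (hU : Module.finrank ℂ U ≤ 2) {A Y D : Module.End ℂ V} (hD : A * Y - Y * A = D)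
    (hYD : Commute Y D) (hA : ∀ v ∈ U, A v ∈ U) (hY : ∀ v ∈ U, Y v ∈ U)
    {φ : V} (hφ : φ ∈ U) (hφ0 : φ ≠ 0) {y s : ℂ} (hy : Y φ = y • φ) (hs : D φ = s • φ) :
    s = 0 := by
  have hD' : ∀ v, A (Y v) - Y (A v) = D v := fun v => by
    rw [← hD, LinearMap.sub_apply, Module.End.mul_apply, Module.End.mul_apply]
  have hYD' : ∀ v, Y (D v) = D (Y v) := fun v => LinearMap.congr_fun hYD.eq v
  have hDU : ∀ v ∈ U, D v ∈ U := fun v hv => by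
    rw [← hD']
    exact U.sub_mem (hA _ (hY _ hv)) (hY _ (hA _ hv))
  by_cases hli : LinearIndependent ℂ ![φ, A φ]
  · obtain ⟨γ, δ, h2⟩ := Submodule.exists_eq_add_of_finrank_le_two hU hφ (hA _ hφ)
      (hA _ (hA _ hφ)) hli
    obtain ⟨α, β, h3⟩ := Submodule.exists_eq_add_of_finrank_le_two hU hφ (hA _ hφ)
      (hDU _ (hA _ hφ)) hli
    have h4 : Y (A φ) = y • A φ - s • φ := by
      have := hD' φ
      rw [hy, hs, map_smul] at this
      rw [← this]; abel
    have h5 := hYD' (A φ)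
    rw [h3, h4, map_add, map_smul, map_smul, map_sub, map_smul, map_smul, hy, hs, h3, h4] at h5
    have h6 := hD' (A φ)
    rw [h3, h4, h2, map_sub, map_add, map_smul, map_smul, map_smul, map_smul, hy, h4, h2] at h6
    -- Write `D (A φ) = α φ + β A φ`. Commutation of `Y` and `D` on `A φ` gives `s² = s β`; the
    -- identity `[A, Y] = D` on `A φ` gives `β = -s`. Hence `2 s² = 0`.
    have key := fun a b (h : a • φ + b • A φ = 0) => LinearIndependent.pair_iff.1 hli a b h
    have k5 := key (s * s - s * β) 0 (by
      rw [← sub_eq_zero] at h5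
      rw [← h5]; module)
    have k6 := key (α - δ * s) (β + s) (by
      rw [← sub_eq_zero] at h6
      rw [← neg_eq_zero, ← h6]; module)
    have e1 := k5.1
    have e2 := k6.2
    have : s * s = 0 := by linear_combination (e1 + s * e2) / 2
    simpa using this
  · rw [LinearIndependent.pair_iff' hφ0] at hli
    push Not at hli
    obtain ⟨a, ha⟩ := hli
    have := hD' φ
    rw [hy, map_smul, ← ha, map_smul, hy, hs, smul_comm, sub_self] at this
    exact (smul_eq_zero.1 this.symm).resolve_right hφ0

/-- Powers of a Weyl pair on a vector killed by `X`. -/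
theorem Module.End.weyl_pow_apply {X Y : Module.End ℂ V} {γ : ℂ} (hγ : γ ≠ 0)
    (hXY : ∀ v, X (Y v) - Y (X v) = γ • v) {v : V} (hv0 : v ≠ 0) (hv : X v = 0) (k : ℕ) :
    (X ^ k) ((Y ^ k) v) ≠ 0 ∧ (X ^ (k + 1)) ((Y ^ k) v) = 0 := by
  have h1 : ∀ k : ℕ, X ((Y ^ (k + 1)) v) = ((k + 1 : ℂ) * γ) • (Y ^ k) v := by
    intro k
    induction k with
    | zero =>
      have := hXY v
      rw [hv, map_zero, sub_zero] at this
      simpa using this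
    | succ k ih =>
      have := hXY ((Y ^ (k + 1)) v)
      rw [ih, map_smul, sub_eq_iff_eq_add] at this
      rw [pow_succ' Y (k + 1), Module.End.mul_apply, this, pow_succ' Y k, Module.End.mul_apply]
      push_cast
      module
  induction k with
  | zero => simpa using ⟨hv0, hv⟩
  | succ k ih =>
    have hk : ((k + 1 : ℂ) * γ) ≠ 0 := mul_ne_zero (by exact_mod_cast k.succ_ne_zero) hγ
    constructor
    · rw [pow_succ X k, Module.End.mul_apply, h1, map_smul]
      exact smul_ne_zero hk ih.1
    · rw [pow_succ X (k + 1), Module.End.mul_apply, h1, map_smul, ih.2, smul_zero]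

/-- Counting kernel vectors of one operator of a Weyl pair: if `[X, Y]` is a nonzero scalar and
`Y` lowers degrees by `n`, then the degrees `μ + k n` in which `X` has a kernel number at most
`dim W μ`. -/
theorem card_le_finrank_of_weyl {X Y : Module.End ℂ V} {γ : ℂ} (hγ : γ ≠ 0)
    (hXY : ∀ v, X (Y v) - Y (X v) = γ • v) (W : ℂ → Submodule ℂ V) {n : ℂ}
    (hY : ∀ μ, ∀ v ∈ W μ, Y v ∈ W (μ - n)) (μ : ℂ) [FiniteDimensional ℂ (W μ)] (F : Finset ℕ)
    (hF : ∀ k ∈ F, ∃ v ∈ W (μ + k * n), v ≠ 0 ∧ X v = 0) :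
    F.card ≤ Module.finrank ℂ (W μ) := by
  have hYk : ∀ (k : ℕ) (ν : ℂ), ∀ v ∈ W ν, (Y ^ k) v ∈ W (ν - k * n) := by
    intro k
    induction k with
    | zero => intro ν v hv; simpa using hv
    | succ k ih =>
      intro ν v hv
      rw [pow_succ', Module.End.mul_apply]
      have := hY _ _ (ih ν v hv)
      convert this using 2
      push_cast; ring
  have h2 := fun v => Module.End.weyl_pow_apply (v := v) hγ hXY
  -- If `X v = 0` in degree `μ + k n`, then `Y^k v` lies in `W μ` and is killed by `X^(k+1)` but not
  -- by `X^k`. So the chain `W μ ∩ ker X^K` grows strictly at each `k ∈ F`; the induction adds the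
  -- largest element of `F`.
  have key : ∀ K : ℕ, (∀ k ∈ F, k < K) →
      F.card ≤ Module.finrank ℂ (W μ ⊓ LinearMap.ker (X ^ K) : Submodule ℂ V) := by
    induction F using Finset.induction_on_max with
    | empty => intro K _; simp
    | insert a F ha ih =>
      intro K hK
      have ihF := ih (fun k hk => hF k (Finset.mem_insert_of_mem hk)) a ha
      rw [Finset.card_insert_of_notMem fun h => lt_irrefl _ (ha a h)]
      refine Nat.succ_le_of_lt (lt_of_le_of_lt ihF ?_)
      have : FiniteDimensional ℂ (W μ ⊓ LinearMap.ker (X ^ K) : Submodule ℂ V) :=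
        Submodule.finiteDimensional_of_le inf_le_left
      have haK : a < K := hK a (Finset.mem_insert_self _ _)
      refine Submodule.finrank_lt_finrank_of_lt (lt_of_le_of_ne ?_ fun h => ?_)
      · refine inf_le_inf_left _ fun x hx => ?_
        rw [LinearMap.mem_ker] at hx ⊢
        obtain ⟨j, rfl⟩ := Nat.exists_eq_add_of_le haK.le
        rw [add_comm, pow_add, Module.End.mul_apply, hx, map_zero]
      · obtain ⟨v, hvW, hv0, hv⟩ := hF a (Finset.mem_insert_self _ _)
        obtain ⟨h3, h4⟩ := h2 v hv0 hv a
        refine h3 ?_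
        have : (Y ^ a) v ∈ W μ ⊓ LinearMap.ker (X ^ K) := by
          refine ⟨by simpa using hYk a _ v hvW, ?_⟩
          rw [SetLike.mem_coe, LinearMap.mem_ker]
          obtain ⟨j, rfl⟩ := Nat.exists_eq_add_of_le (Nat.succ_le_of_lt haK)
          rw [add_comm, pow_add, Module.End.mul_apply, Nat.succ_eq_add_one, h4, map_zero]
        exact (h.ge this).2
  have : FiniteDimensional ℂ (W μ ⊓ LinearMap.ker (X ^ (F.sup id + 1)) : Submodule ℂ V) :=
    Submodule.finiteDimensional_of_le inf_le_left
  exact (key (F.sup id + 1) fun k hk => Nat.lt_succ_of_le (Finset.le_sup (f := id) hk)).trans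
    (Submodule.finrank_mono inf_le_left)

end LinearAlgebra

/-! ### Heisenberg–Virasoro representations: `H_n` is bijective when `H_0` is a nonzero scalar. -/

/-- A representation of the centreless Heisenberg–Virasoro algebra. -/
structure HeisenbergVirasoroRep (V : Type*) [AddCommGroup V] [Module ℂ V] where
  L : ℤ → Module.End ℂ V
  H : ℤ → Module.End ℂ V
  lie_L_L : ∀ m n v, L m (L n v) - L n (L m v) = ((n : ℂ) - m) • L (m + n) v
  lie_L_H : ∀ m n v, L m (H n v) - H n (L m v) = (n : ℂ) • H (m + n) v
  comm_H : ∀ m n v, H m (H n v) = H n (H m v)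

namespace HeisenbergVirasoroRep

variable {V : Type*} [AddCommGroup V] [Module ℂ V] (A : HeisenbergVirasoroRep V)

theorem H_mem (m : ℤ) {μ : ℂ} {v : V} (hv : v ∈ (A.L 0).eigenspace μ) :
    A.H m v ∈ (A.L 0).eigenspace (μ + m) := by
  rw [Module.End.mem_eigenspace_iff] at hv ⊢
  have := A.lie_L_H 0 m v
  rw [hv, map_smul, zero_add, sub_eq_iff_eq_add] at this
  rw [this, add_comm, add_smul]

theorem L_mem (m : ℤ) {μ : ℂ} {v : V} (hv : v ∈ (A.L 0).eigenspace μ) :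
    A.L m v ∈ (A.L 0).eigenspace (μ + m) := by
  rw [Module.End.mem_eigenspace_iff] at hv ⊢
  have := A.lie_L_L 0 m v
  rw [hv, map_smul, zero_add, sub_eq_iff_eq_add] at this
  rw [this, add_comm, add_smul, Int.cast_zero, sub_zero]

theorem H_L (m r : ℤ) (v : V) : A.H m (A.L r v) = A.L r (A.H m v) - (m : ℂ) • A.H (r + m) v := by
  rw [← A.lie_L_H]; abel

theorem H_pow_mem (m : ℤ) {μ : ℂ} {v : V} (hv : v ∈ (A.L 0).eigenspace μ) (k : ℕ) :
    (A.H m ^ k) v ∈ (A.L 0).eigenspace (μ + k * m) := by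
  induction k with
  | zero => simpa using hv
  | succ k ih =>
    rw [pow_succ', Module.End.mul_apply]
    convert A.H_mem m ih using 2
    push_cast; ring

theorem L_pow_mem (m : ℤ) {μ : ℂ} {v : V} (hv : v ∈ (A.L 0).eigenspace μ) (k : ℕ) :
    (A.L m ^ k) v ∈ (A.L 0).eigenspace (μ + k * m) := by
  induction k with
  | zero => simpa using hv
  | succ k ih =>
    rw [pow_succ', Module.End.mul_apply]
    convert A.L_mem m ih using 2
    push_cast; ring

/-- The commutator `[H_m, L_m] = -m H_{2m}` commutes with `H_m`, so carrying powers of `H_m` past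
`L_m` costs only one power. Local nilpotency of `H_m` thus propagates along `L_m`. -/
theorem H_pow_L (m : ℤ) {v : V} {k : ℕ} (hv : (A.H m ^ k) v = 0) :
    (A.H m ^ (k + 1)) (A.L m v) = 0 := by
  have : ∀ j : ℕ, (A.H m ^ (j + 1)) (A.L m v) =
      A.L m ((A.H m ^ (j + 1)) v) - ((j + 1 : ℂ) * m) • A.H (m + m) ((A.H m ^ j) v) := by
    intro j
    induction j with
    | zero => simp [A.H_L]
    | succ j ih =>
      rw [pow_succ' _ (j + 1), Module.End.mul_apply, ih, map_sub, map_smul, A.H_L,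
        A.comm_H m (m + m), ← Module.End.mul_apply (A.H m), ← pow_succ',
        ← Module.End.mul_apply (A.H m), ← pow_succ']
      push_cast
      module
  rw [this, hv, pow_succ', Module.End.mul_apply, hv]
  simp

section Level

variable {A} {c : ℂ} (hc0 : c ≠ 0) (hc : ∀ v, A.H 0 v = c • v) {d : ℕ}
  (hfin : ∀ μ, FiniteDimensional ℂ ((A.L 0).eigenspace μ))
  (hd : ∀ μ, Module.finrank ℂ ((A.L 0).eigenspace μ) ≤ d)

-- For `n` and `c` nonzero this makes `H_n` and `L_{-n}` a Weyl pair, which bounds the degrees in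
-- which `H_n` has a kernel.
include hc in
theorem weyl_H_L (n : ℤ) (v : V) :
    A.H n (A.L (-n) v) - A.L (-n) (A.H n v) = (-(n * c)) • v := by
  rw [A.H_L, neg_add_cancel, hc]
  module

include hc0 hc hd hfin

theorem card_ker_H_le {n : ℤ} (hn : n ≠ 0) (μ : ℂ) (F : Finset ℕ)
    (hF : ∀ k ∈ F, ∃ v ∈ (A.L 0).eigenspace (μ + k * n), v ≠ 0 ∧ A.H n v = 0) : F.card ≤ d := by
  have := hfin μ
  refine (card_le_finrank_of_weyl (X := A.H n) (Y := A.L (-n)) (γ := -(n * c)) ?_ ?_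
    (A.L 0).eigenspace (n := n) ?_ μ F hF).trans (hd μ)
  · exact neg_ne_zero.2 (mul_ne_zero (by exact_mod_cast hn) hc0)
  · exact weyl_H_L hc n
  · intro ν v hv
    convert A.L_mem (-n) hv using 2
    push_cast; ring

theorem ker_H_eventually_zero {n : ℤ} (hn : n ≠ 0) (μ : ℂ) :
    ∃ K : ℕ, ∀ k ≥ K, ∀ v ∈ (A.L 0).eigenspace (μ + k * n), A.H n v = 0 → v = 0 := by
  by_contra! h
  have hinf : {k : ℕ | ∃ v ∈ (A.L 0).eigenspace (μ + k * n), v ≠ 0 ∧ A.H n v = 0}.Infinite := by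
    refine Set.infinite_of_not_bddAbove fun ⟨K, hK⟩ => ?_
    obtain ⟨k, hk, v, hv, hv1, hv0⟩ := h (K + 1)
    exact absurd (hK ⟨v, hv, hv0, hv1⟩) (by omega)
  obtain ⟨F, hF, hcard⟩ := hinf.exists_subset_card_eq (d + 1)
  have := card_ker_H_le hc0 hc hfin hd hn μ F fun k hk => hF hk
  omega

/-- A nonzero `v` killed by `H_n` is nilpotent under `H_{-n}`, since otherwise its images would give
too many kernel degrees of `H_n`. Nilpotency passes to all `L_{-n}^k v`, which are nonzero by the
Weyl relation. Far enough along this gives kernel vectors of `H_{-n}` in degrees where there are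
none. -/
theorem H_injOn {n : ℤ} (hn : n ≠ 0) {ν : ℂ} {v : V} (hv : v ∈ (A.L 0).eigenspace ν)
    (h : A.H n v = 0) : v = 0 := by
  by_contra hv0
  have hcomm : ∀ k : ℕ, A.H n ((A.H (-n) ^ k) v) = 0 := by
    intro k
    induction k with
    | zero => simpa using h
    | succ k ih => rw [pow_succ', Module.End.mul_apply, A.comm_H, ih, map_zero]
  -- Counting starts at the degree `ν - d n`: the vectors `H_{-n}^j v` with `0 ≤ j ≤ d` sit `k = d -
  -- j` steps of `n` above it, giving `d + 1` kernel degrees.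
  have h1 : (A.H (-n) ^ d) v = 0 := by
    by_contra h1
    have := card_ker_H_le hc0 hc hfin hd hn (ν - d * n) (Finset.range (d + 1)) fun k hk => by
      have hk : k ≤ d := Nat.lt_succ_iff.1 (Finset.mem_range.1 hk)
      obtain ⟨j, rfl⟩ := Nat.exists_eq_add_of_le hk
      refine ⟨(A.H (-n) ^ j) v, ?_, fun h2 => h1 ?_, hcomm j⟩
      · convert A.H_pow_mem (-n) hv j using 2
        push_cast; ring
      · rw [pow_add, Module.End.mul_apply, h2, map_zero]
    simp at this
  have h2 : ∀ k : ℕ, ∃ K, (A.H (-n) ^ K) ((A.L (-n) ^ k) v) = 0 := by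
    intro k
    induction k with
    | zero => exact ⟨d, by simpa using h1⟩
    | succ k ih =>
      obtain ⟨K, hK⟩ := ih
      exact ⟨K + 1, by rw [pow_succ' _ k, Module.End.mul_apply]; exact A.H_pow_L (-n) hK⟩
  obtain ⟨K0, hK0⟩ := ker_H_eventually_zero hc0 hc hfin hd (neg_ne_zero.2 hn) ν
  have h3 : (A.L (-n) ^ K0) v ≠ 0 := fun h3 => by
    have := (Module.End.weyl_pow_apply (neg_ne_zero.2 (mul_ne_zero (by exact_mod_cast hn) hc0))
      (weyl_H_L hc n) hv0 h K0).1
    rw [h3, map_zero] at this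
    exact this rfl
  classical
  have hK := Nat.find_spec (h2 K0)
  have hmin := fun m hm => Nat.find_min (h2 K0) (m := m) hm
  set K := Nat.find (h2 K0)
  rcases hK' : K with _ | j
  · rw [hK'] at hK
    exact h3 (by simpa using hK)
  · rw [hK', pow_succ', Module.End.mul_apply] at hK
    refine hmin j (by omega) (hK0 (K0 + j) (by omega) _ ?_ hK)
    convert A.H_pow_mem (-n) (A.L_pow_mem (-n) hv K0) j using 2
    push_cast; ring

/-- The kernel is stable under `L_0`, so it suffices to test weight vectors. The injections by `H_n`
and `H_{-n}` then force equal finite dimensions of the weight spaces, whence surjectivity. -/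
theorem H_bijective (hw : ⨆ μ, (A.L 0).eigenspace μ = ⊤) (n : ℤ) :
    Function.Bijective (A.H n) := by
  by_cases hn : n = 0
  · subst hn
    exact ⟨fun v w h => by rw [hc, hc] at h; exact smul_right_injective V hc0 h,
      fun v => ⟨c⁻¹ • v, by rw [map_smul, hc, smul_smul, inv_mul_cancel₀ hc0, one_smul]⟩⟩
  constructor
  · rw [← LinearMap.ker_eq_bot]
    by_contra h
    obtain ⟨μ, v, hv, hv0, hv1⟩ := Submodule.exists_eigenvector_mem hw
      (p := LinearMap.ker (A.H n)) (fun x hx => by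
        rw [LinearMap.mem_ker] at hx ⊢
        rw [A.H_L, hx, zero_add, hx]; simp) h
    exact hv0 (H_injOn hc0 hc hfin hd hn (Module.End.mem_eigenspace_iff.2 hv1) hv)
  · rw [← LinearMap.range_eq_top, eq_top_iff, ← hw]
    refine iSup_le fun μ => ?_
    have hmap : ∀ (k : ℤ), k ≠ 0 → ∀ ν : ℂ,
        Module.finrank ℂ ((A.L 0).eigenspace ν) ≤
          Module.finrank ℂ ((A.L 0).eigenspace (ν + k)) := fun k hk ν => by
      have := hfin (ν + k)
      refine LinearMap.finrank_le_finrank_of_injective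
        (f := (A.H k).restrict fun v (hv : v ∈ (A.L 0).eigenspace ν) => A.H_mem k hv) ?_
      rw [← LinearMap.ker_eq_bot, eq_bot_iff]
      intro v hv
      exact Subtype.ext (H_injOn hc0 hc hfin hd hk v.2 (congrArg Subtype.val hv))
    have h1 : ∀ v ∈ (A.L 0).eigenspace (μ - n), A.H n v ∈ (A.L 0).eigenspace μ := fun v hv => by
      convert A.H_mem n hv using 2; ring
    have := hfin μ
    have := hfin (μ - n)
    have hinj : Function.Injective ((A.H n).restrict h1) := by
      rw [← LinearMap.ker_eq_bot, eq_bot_iff]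
      intro v hv
      exact Subtype.ext (H_injOn hc0 hc hfin hd hn v.2 (congrArg Subtype.val hv))
    have hdim : Module.finrank ℂ ((A.L 0).eigenspace (μ - n)) =
        Module.finrank ℂ ((A.L 0).eigenspace μ) := by
      refine le_antisymm (LinearMap.finrank_le_finrank_of_injective hinj) ?_
      have := hmap (-n) (neg_ne_zero.2 hn) μ
      rwa [Int.cast_neg, ← sub_eq_add_neg] at this
    intro v hv
    obtain ⟨w, hw⟩ := (LinearMap.injective_iff_surjective_of_finrank_eq_finrank hdim).1 hinj ⟨v, hv⟩
    exact ⟨w, congrArg Subtype.val hw⟩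

end Level

end HeisenbergVirasoroRep

/-! ### Vectors on which the `H_n` multiply like powers. -/

namespace HeisenbergVirasoroRep

variable {V : Type*} [AddCommGroup V] [Module ℂ V] (A : HeisenbergVirasoroRep V)

/-- If the products `H_a H_b` act on `φ` as the multiples `e a b` of `H_{a+b}`, and the
`L`-derivatives of these ratios vanish on `φ`, then all ratios are equal. -/
theorem ratio_eq_const {c : ℂ} (hc0 : c ≠ 0) (e : ℤ → ℤ → ℂ) (h0 : ∀ b, e 0 b = c)
    (hsymm : ∀ a b, e a b = e b a)
    (hassoc : ∀ a b d, e a b * e (a + b) d = e b d * e a (b + d))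
    (hder : ∀ a b r : ℤ, (a : ℂ) * e (a + r) b + b * e a (b + r) = (a + b) * e a b) (a b : ℤ) :
    e a b = c := by
  -- The derivative relation with `a = 1`, `r = -1`. Its coefficient `b + 1` vanishes at `b = -1`,
  -- where the relation yields `e 1 (-2)` and says nothing about `e 1 (-1)`.
  have hone : ∀ b : ℤ, ((b : ℂ) + 1) * e 1 b = c + b * e 1 (b - 1) := fun b => by
    have := hder 1 b (-1)
    simp only [Int.cast_one, add_neg_cancel, h0, ← sub_eq_add_neg] at this
    linear_combination -this
  have hpos : ∀ n : ℕ, e 1 n = c := by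
    intro n
    induction n with
    | zero => rw [Nat.cast_zero, hsymm, h0]
    | succ n ih =>
      have := hone (n + 1)
      rw [add_sub_cancel_right, ih] at this
      have hn : (n : ℂ) + 1 + 1 ≠ 0 := by exact_mod_cast (n + 1).succ_ne_zero
      push_cast at this ⊢
      refine mul_left_cancel₀ hn ?_
      linear_combination this
  have hneg2 : e 1 (-2) = c := by
    have := hone (-1)
    norm_num at this
    linear_combination this
  -- The gap is closed by associativity, which gives `e 2 (-2) = e 1 (-1)`; the derivative relation
  -- for `1, -2` with `r = 1` then gives the value.
  have hneg1 : e 1 (-1) = c := by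
    have h1 := hassoc 1 1 (-2)
    have h2 := hder 1 (-2) 1
    norm_num at h1 h2
    rw [hneg2] at h1 h2
    rw [show e 1 1 = c by exact_mod_cast hpos 1] at h1
    have h3 := mul_left_cancel₀ hc0 h1
    linear_combination h3 - h2
  have hneg : ∀ n : ℕ, e 1 (-(n + 2 : ℕ)) = c := by
    intro n
    induction n with
    | zero => simpa using hneg2
    | succ n ih =>
      have := hone (-(n + 2 : ℕ))
      rw [ih] at this
      have hn : (n : ℂ) + 2 ≠ 0 := by exact_mod_cast (n + 1).succ_ne_zero
      rw [show (-((n + 1 + 2 : ℕ) : ℤ)) = -((n + 2 : ℕ) : ℤ) - 1 by push_cast; ring]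
      refine mul_left_cancel₀ hn ?_
      push_cast at this ⊢
      linear_combination this
  have h1 : ∀ b, e 1 b = c := by
    intro b
    obtain ⟨n, rfl | rfl⟩ := b.eq_nat_or_neg
    · exact hpos n
    · match n with
      | 0 => simpa using hpos 0
      | 1 => simpa using hneg1
      | n + 2 => exact hneg n
  have hstep : ∀ b d, e (b + 1) d = e b d := fun b d => by
    have := hassoc 1 b d
    rw [h1, h1, mul_comm (e b d), add_comm 1 b] at this
    exact mul_left_cancel₀ hc0 this
  induction a using Int.induction_on with
  | zero => exact h0 b
  | succ n ih => rw [hstep, ih]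
  | pred n ih => rw [← hstep, sub_add_cancel, ih]

section

variable {A} {c : ℂ} (hc0 : c ≠ 0) (hc : ∀ v, A.H 0 v = c • v)
  (hbij : ∀ n, Function.Bijective (A.H n))

include hc0 hc hbij

/-- A weight vector on which the `H_n / c` compose like powers of one operator. -/
theorem exists_H_mul_eq {μ : ℂ} [FiniteDimensional ℂ ((A.L 0).eigenspace μ)]
    (hd : Module.finrank ℂ ((A.L 0).eigenspace μ) ≤ 2) (hμ : (A.L 0).eigenspace μ ≠ ⊥) :
    ∃ φ ∈ (A.L 0).eigenspace μ, φ ≠ 0 ∧ ∀ a b, A.H a (A.H b φ) = c • A.H (a + b) φ := by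
  choose h hh using fun n => (Module.End.isUnit_iff (A.H n)).2 (hbij n)
  let I : ℤ → Module.End ℂ V := fun n => ((h n)⁻¹ : (Module.End ℂ V)ˣ)
  have hHH : ∀ a b, Commute (A.H a) (A.H b) := fun a b => LinearMap.ext fun v => A.comm_H a b v
  have hHI : ∀ a b, Commute (A.H a) (I b) := fun a b => by
    have := hHH a b
    rw [← hh b] at this
    exact this.units_inv_right
  have hII : ∀ a b, Commute (I a) (I b) := fun a b => by
    have := hHI a b
    rw [← hh a] at this
    exact this.units_inv_left
  have hI : ∀ a v, I a (A.H a v) = v := fun a v => by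
    have : I a * A.H a = 1 := by rw [← hh a]; exact Units.inv_mul _
    exact LinearMap.congr_fun this v
  have hI' : ∀ a v, A.H a (I a v) = v := fun a v => by
    have : A.H a * I a = 1 := by rw [← hh a]; exact Units.mul_inv _
    exact LinearMap.congr_fun this v
  have hI_mem : ∀ (a : ℤ) (ν : ℂ) (v : V), v ∈ (A.L 0).eigenspace (ν + a) →
      I a v ∈ (A.L 0).eigenspace ν := fun a ν v hv => by
    rw [Module.End.mem_eigenspace_iff] at hv ⊢
    refine (hbij a).1 ?_
    rw [A.H_L, hI', hv, zero_add, hI', map_smul, hI', add_smul, add_sub_cancel_right]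
  -- The ratio operators `H_{a+b}⁻¹ H_a H_b` have degree zero and commute, so they have a common
  -- eigenvector in the weight space. Their eigenvalues `e a b` inherit symmetry and associativity
  -- from the `H_n`.
  let k : ℤ × ℤ → Module.End ℂ V := fun p => I (p.1 + p.2) * A.H p.1 * A.H p.2
  have hkH : ∀ p n, Commute (k p) (A.H n) := fun p n =>
    (((hHI n _).symm.mul_left (hHH _ _)).mul_left (hHH _ _))
  have hkI : ∀ p n, Commute (k p) (I n) := fun p n =>
    (((hII _ _).mul_left (hHI _ _)).mul_left (hHI _ _))
  have hkk : ∀ p q, Commute (k p) (k q) := fun p q =>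
    ((hkI p _).mul_right (hkH p _)).mul_right (hkH p _)
  have hk_mem : ∀ p, ∀ v ∈ (A.L 0).eigenspace μ, k p v ∈ (A.L 0).eigenspace μ := fun p v hv => by
    refine hI_mem _ _ _ ?_
    convert A.H_mem p.1 (A.H_mem p.2 hv) using 2
    push_cast; ring
  obtain ⟨φ, hφ, hφ0, hφk⟩ := Module.End.exists_common_eigenvector k hkk _ hμ hk_mem
  choose e' he' using hφk
  let e : ℤ → ℤ → ℂ := fun a b => e' (a, b)
  have hk : ∀ a b, k (a, b) φ = e a b • φ := fun a b => he' (a, b)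
  have he : ∀ a b, A.H a (A.H b φ) = e a b • A.H (a + b) φ := fun a b => by
    rw [← map_smul, ← hk]
    exact (hI' (a + b) _).symm
  have hH0 : ∀ a, A.H a φ ≠ 0 := fun a h0 => hφ0 ((hbij a).1 (by rw [h0, map_zero]))
  have hcancel : ∀ {s t : ℂ} {a : ℤ}, s • A.H a φ = t • A.H a φ → s = t := fun {s t a} h =>
    smul_left_injective ℂ (hH0 a) h
  have hne : ∀ a b, e a b ≠ 0 := fun a b h0 => by
    have := he a b
    rw [h0, zero_smul] at this
    exact hH0 b ((hbij a).1 (by rw [this, map_zero]))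
  refine ⟨φ, hφ, hφ0, fun a b => ?_⟩
  rw [he]
  congr 1
  refine ratio_eq_const hc0 e (fun b => ?_) (fun a b => ?_) (fun a b d => ?_)
    (fun a b r => ?_) a b
  · refine hcancel (a := 0 + b) ?_
    rw [← he, hc, zero_add]
  · refine hcancel (a := a + b) ?_
    rw [← he, A.comm_H, he, add_comm]
  · refine hcancel (a := a + b + d) ?_
    have h1 : A.H d (A.H a (A.H b φ)) = (e a b * e (a + b) d) • A.H (a + b + d) φ := by
      rw [he, map_smul, A.comm_H, he, smul_smul]
    have h2 : A.H d (A.H a (A.H b φ)) = (e b d * e a (b + d)) • A.H (a + b + d) φ := by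
      rw [A.comm_H d a, A.comm_H d b, he, map_smul, he, smul_smul, add_assoc]
    rw [← h1, h2]
  -- `D` is the commutator of the degree-zero operator `H_r⁻¹ L_r` with the ratio `k (a, b)`. It is
  -- built from the `H_n` and their inverses, so it commutes with the ratio. By Jacobson's lemma in
  -- dimension two it kills `φ`, which is the derivative relation.
  · let D : Module.End ℂ V := I (a + b) * I r * ((a : ℂ) • (A.H (a + r) * A.H b) +
      (b : ℂ) • (A.H a * A.H (b + r)) - (a + b : ℂ) • (A.H (a + b + r) * k (a, b)))
    have hkD : Commute (k (a, b)) D := ((hkI _ _).mul_right (hkI _ _)).mul_right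
      (((((hkH _ _).mul_right (hkH _ _)).smul_right _).add_right
        (((hkH _ _).mul_right (hkH _ _)).smul_right _)).sub_right
        (((hkH _ _).mul_right (Commute.refl _)).smul_right _))
    have hLk : I r * A.L r * k (a, b) - k (a, b) * (I r * A.L r) = D := by
      refine LinearMap.ext fun v => (hbij (a + b)).1 ((hbij r).1 ?_)
      have hkab : ∀ w, A.H (a + b) (k (a, b) w) = A.H a (A.H b w) := fun w => hI' (a + b) _
      have hD : A.H r (A.H (a + b) (D v)) = (a : ℂ) • A.H (a + r) (A.H b v) +
          (b : ℂ) • A.H a (A.H (b + r) v) - (a + b : ℂ) • A.H (a + b + r) (k (a, b) v) := by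
        change A.H r (A.H (a + b) (I (a + b) (I r _))) = _
        rw [hI', hI']
        rfl
      rw [hD]
      change A.H r (A.H (a + b) (I r (A.L r (k (a, b) v)) - k (a, b) (I r (A.L r v)))) = _
      rw [map_sub, map_sub, A.comm_H r (a + b), hI', hkab, A.comm_H r a, A.comm_H r b, hI',
        A.H_L, hkab, A.H_L, map_sub, map_smul, A.H_L]
      simp only [add_comm r]
      push_cast
      module
    have hDφ : D φ = ((e (a + b) r)⁻¹ * (a * e (a + r) b + b * e a (b + r) - (a + b) * e a b)) •
        φ := by
      have h1 : I (a + b) (I r (A.H (a + b + r) φ)) = (e (a + b) r)⁻¹ • φ := by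
        have h2 : A.H (a + b + r) φ = (e (a + b) r)⁻¹ • A.H r (A.H (a + b) φ) := by
          rw [A.comm_H, he, smul_smul, inv_mul_cancel₀ (hne _ _), one_smul]
        rw [h2, map_smul, map_smul, hI, hI]
      change I (a + b) (I r ((a : ℂ) • A.H (a + r) (A.H b φ) +
          (b : ℂ) • A.H a (A.H (b + r) φ) - (a + b : ℂ) • A.H (a + b + r) (k (a, b) φ))) = _
      rw [hk, he, he, add_right_comm a r b, ← add_assoc a b r, map_smul]
      simp only [map_add, map_sub, map_smul, h1]
      module
    have h0 := Module.End.eigenvalue_commutator_eq_zero hd hLk hkD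
      (fun v hv => hI_mem r _ _ (A.L_mem r hv)) (hk_mem (a, b)) hφ hφ0 (hk a b) hDφ
    rw [mul_eq_zero, sub_eq_zero] at h0
    exact h0.resolve_left (inv_ne_zero (hne _ _))

end

end HeisenbergVirasoroRep

/-! ### Common eigenvectors of vector fields vanishing at a point. -/

section LinearAlgebra

variable {V : Type*} [AddCommGroup V] [Module ℂ V]

/-- Ordering eigenvalues by real part gives an extremal eigenvector: any construction that would
raise its eigenvalue by a positive integer must produce zero. -/
theorem Module.End.exists_eigenvalue_max_re (f : Module.End ℂ V) (U : Submodule ℂ V)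
    [FiniteDimensional ℂ U] (hU : U ≠ ⊥) (hf : ∀ v ∈ U, f v ∈ U) :
    ∃ ξ : ℂ, (∃ v ∈ U, v ≠ 0 ∧ f v = ξ • v) ∧
      ∀ (η : ℂ), ∀ w ∈ U, w ≠ 0 → f w = η • w → η.re ≤ ξ.re := by
  have : Nontrivial U := Submodule.nontrivial_iff_ne_bot.2 hU
  obtain ⟨t, ht⟩ := Module.End.exists_eigenvalue (LinearMap.restrict f hf)
  have : Nonempty (Module.End.Eigenvalues (LinearMap.restrict f hf)) := ⟨⟨t, ht⟩⟩
  obtain ⟨⟨ξ, hξ⟩, hmax⟩ := Finite.exists_max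
    fun η : Module.End.Eigenvalues (LinearMap.restrict f hf) => (η.1 : ℂ).re
  obtain ⟨v, hv⟩ := Module.End.HasEigenvalue.exists_hasEigenvector hξ
  refine ⟨ξ, ⟨v, v.2, fun h => hv.2 (Subtype.ext h), congrArg Subtype.val hv.apply_eq_smul⟩,
    fun η w hw hw0 h => ?_⟩
  exact hmax ⟨η, Module.End.hasEigenvalue_of_hasEigenvector (x := ⟨w, hw⟩)
    ⟨Module.End.mem_eigenspace_iff.2 (Subtype.ext h), fun h0 => hw0 (congrArg Subtype.val h0)⟩⟩

/-- Finite-dimensional representations of the vector fields on the circle vanishing at a point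
have a common eigenvector, on which the field `(t^r - 1) t d/dt` acts linearly in `r`. -/
theorem exists_eigenvector_of_vanishing_fields (l : ℤ → Module.End ℂ V) (U : Submodule ℂ V)
    [FiniteDimensional ℂ U] (hU : U ≠ ⊥) (hl : ∀ r, ∀ v ∈ U, l r v ∈ U) {μ : ℂ}
    (hl0 : ∀ v ∈ U, l 0 v = μ • v)
    (hbr : ∀ r s, ∀ v ∈ U, l r (l s v) - l s (l r v) =
      ((s : ℂ) - r) • l (r + s) v - (s : ℂ) • l s v + (r : ℂ) • l r v) :
    ∃ b : ℂ, ∃ φ ∈ U, φ ≠ 0 ∧ ∀ r, l r φ = (μ + b * r) • φ := by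
  obtain ⟨ξ, ⟨φ, hφ, hφ0, h1⟩, hmax⟩ := (l 1).exists_eigenvalue_max_re U hU (hl 1)
  obtain ⟨η, ⟨ψ, hψ, hψ0, h2⟩, hmin⟩ := (-l (-1)).exists_eigenvalue_max_re U hU
    fun v hv => U.neg_mem (hl (-1) v hv)
  have hmin' : ∀ (ζ : ℂ), ∀ w ∈ U, w ≠ 0 → l (-1) w = ζ • w → -η.re ≤ ζ.re := fun ζ w hw hw0 h => by
    have := hmin (-ζ) w hw hw0 (by rw [LinearMap.neg_apply, h, neg_smul])
    rw [Complex.neg_re] at this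
    linarith
  replace h2 : l (-1) ψ = (-η) • ψ := by
    rw [neg_smul, ← h2, LinearMap.neg_apply, neg_neg]
  -- Put `z = l 1 + l (-1) - 2μ`, so `[l 1, l (-1)] = z`. Hence `[l 1, z] = z` and `[l (-1), z] =
  -- -z`: extremality of `φ` for `l 1` and of `ψ` for `l (-1)` gives `z φ = 0` and `z ψ = 0`.
  have hz : ∀ v ∈ U, l 1 (l (-1) v) - l (-1) (l 1 v) = l 1 v + l (-1) v - (2 * μ) • v := by
    intro v hv
    rw [hbr _ _ v hv, add_neg_cancel, hl0 v hv]
    push_cast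
    module
  have hφ' : l (-1) φ = (2 * μ - ξ) • φ := by
    have h3 := hz φ hφ
    have h4 := hz (l 1 φ + l (-1) φ - (2 * μ) • φ)
      (U.sub_mem (U.add_mem (hl _ _ hφ) (hl _ _ hφ)) (U.smul_mem _ hφ))
    have hzU : l 1 φ + l (-1) φ - (2 * μ) • φ ∈ U :=
      U.sub_mem (U.add_mem (hl _ _ hφ) (hl _ _ hφ)) (U.smul_mem _ hφ)
    by_contra h5
    have hz0 : l 1 φ + l (-1) φ - (2 * μ) • φ ≠ 0 := fun h0 => h5 (by
      rw [h1] at h0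
      rw [← sub_eq_zero, ← h0]; module)
    have := hmax (ξ + 1) _ hzU hz0 (by
      have h6 : l 1 (l (-1) φ) = ξ • l (-1) φ + (l 1 φ + l (-1) φ - (2 * μ) • φ) := by
        rw [← h3, h1, map_smul]; abel
      rw [map_sub, map_add, map_smul, h6, h1, map_smul, h1]
      module)
    rw [Complex.add_re, Complex.one_re] at this
    linarith
  have hψ' : l 1 ψ = (2 * μ + η) • ψ := by
    have h3 := hz ψ hψ
    have hzU : l 1 ψ + l (-1) ψ - (2 * μ) • ψ ∈ U :=
      U.sub_mem (U.add_mem (hl _ _ hψ) (hl _ _ hψ)) (U.smul_mem _ hψ)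
    by_contra h5
    have hz0 : l 1 ψ + l (-1) ψ - (2 * μ) • ψ ≠ 0 := fun h0 => h5 (by
      rw [h2] at h0
      rw [← sub_eq_zero, ← h0]; module)
    have := hmin' (-η - 1) _ hzU hz0 (by
      have h6 : l (-1) (l 1 ψ) = (-η) • l 1 ψ - (l 1 ψ + l (-1) ψ - (2 * μ) • ψ) := by
        rw [← h3, h2, map_smul]; abel
      rw [map_sub, map_add, map_smul, h6, h2, map_smul, h2]
      module)
    rw [Complex.sub_re, Complex.one_re, Complex.neg_re] at this
    linarith
  -- Comparing `φ` with `ψ` shows that `φ` is also extremal for `l (-1)`: its eigenvalue `2μ - ξ`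
  -- has the smallest real part.
  have hle : 2 * μ.re - ξ.re ≤ -η.re := by
    have := hmax _ ψ hψ hψ0 hψ'
    simp only [Complex.add_re, Complex.mul_re, Complex.re_ofNat, Complex.im_ofNat] at this
    linarith
  -- The defect of `l 2` on `φ` would be an eigenvector of `l (-1)` with eigenvalue `2μ - ξ - 2`,
  -- against minimality. The defect of `l (-2)` similarly would raise the `l 1`-eigenvalue by two.
  have hp2 : l 2 φ = (μ + (ξ - μ) * 2) • φ := by
    by_contra h5
    have h6 := hbr (-1) 2 φ hφ
    rw [hφ', map_smul] at h6
    norm_num at h6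
    rw [h1] at h6
    have := hmin' (2 * μ - ξ - 2) (l 2 φ - (μ + (ξ - μ) * 2) • φ)
      (U.sub_mem (hl _ _ hφ) (U.smul_mem _ hφ)) (sub_ne_zero.2 h5) (by
        rw [map_sub, map_smul, hφ', sub_eq_iff_eq_add.1 h6]
        module)
    simp only [Complex.sub_re, Complex.mul_re, Complex.re_ofNat, Complex.im_ofNat] at this
    linarith
  have hm2 : l (-2) φ = (μ - (ξ - μ) * 2) • φ := by
    by_contra h5
    have h6 := hbr 1 (-2) φ hφ
    rw [h1, map_smul] at h6
    norm_num at h6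
    rw [hφ'] at h6
    have := hmax (ξ + 2) (l (-2) φ - (μ - (ξ - μ) * 2) • φ)
      (U.sub_mem (hl _ _ hφ) (U.smul_mem _ hφ)) (sub_ne_zero.2 h5) (by
        rw [map_sub, map_smul, h1, sub_eq_iff_eq_add.1 h6]
        module)
    simp only [Complex.add_re, Complex.re_ofNat] at this
    linarith
  refine ⟨ξ - μ, φ, hφ, hφ0, ?_⟩
  -- Bracketing with `l 1` passes from `n + 2` to `n + 3` with coefficient `n + 1`. The bracket `[l
  -- 1, l 1]` gives nothing, which is why `l 2` was treated separately.
  have hpos : ∀ n : ℕ, l (n + 2 : ℕ) φ = (μ + (ξ - μ) * (n + 2 : ℕ)) • φ := by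
    intro n
    induction n with
    | zero => simpa using hp2
    | succ n ih =>
      have h6 := hbr 1 (n + 2 : ℕ) φ hφ
      rw [ih, h1, map_smul, map_smul, h1, ih] at h6
      have hn : (n : ℂ) + 1 ≠ 0 := by exact_mod_cast n.succ_ne_zero
      rw [show ((n + 1 + 2 : ℕ) : ℤ) = 1 + (n + 2 : ℕ) by push_cast; ring]
      refine smul_right_injective V hn ?_
      simp only
      push_cast at h6 ⊢
      rw [← sub_eq_zero] at h6 ⊢
      rw [← neg_eq_zero, ← h6]
      module
  have hneg : ∀ n : ℕ, l (-(n + 2 : ℕ)) φ = (μ - (ξ - μ) * (n + 2 : ℕ)) • φ := by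
    intro n
    induction n with
    | zero => simpa using hm2
    | succ n ih =>
      have h6 := hbr (-1) (-(n + 2 : ℕ)) φ hφ
      rw [ih, hφ', map_smul, map_smul, hφ', ih] at h6
      have hn : (n : ℂ) + 1 ≠ 0 := by exact_mod_cast n.succ_ne_zero
      rw [show -((n + 1 + 2 : ℕ) : ℤ) = -1 + -(n + 2 : ℕ) by push_cast; ring]
      refine smul_right_injective V hn ?_
      simp only
      push_cast at h6 ⊢
      rw [← sub_eq_zero] at h6 ⊢
      rw [← h6]
      module
  intro r
  obtain ⟨n, rfl | rfl⟩ := r.eq_nat_or_neg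
  · match n with
    | 0 => simpa using hl0 φ hφ
    | 1 => simpa using h1
    | n + 2 => exact_mod_cast hpos n
  · match n with
    | 0 => simpa using hl0 φ hφ
    | 1 =>
      rw [Nat.cast_one, hφ']
      push_cast
      congr 1
      ring
    | n + 2 =>
      rw [hneg n]
      push_cast
      congr 1
      ring

end LinearAlgebra

/-! ### Intermediate series inside Heisenberg–Virasoro modules. -/

namespace HeisenbergVirasoroRep

variable {V : Type*} [AddCommGroup V] [Module ℂ V] (A : HeisenbergVirasoroRep V)

/-- The vectors on which the `H_n / c` compose like powers of one operator. -/
def multiplicativePart (c : ℂ) : Submodule ℂ V where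
  carrier := {v | ∀ a b, A.H a (A.H b v) = c • A.H (a + b) v}
  zero_mem' := by simp
  add_mem' := fun hv hw a b => by rw [map_add, map_add, hv, hw, map_add, smul_add]
  smul_mem' := fun t v hv a b => by rw [map_smul, map_smul, hv, map_smul, smul_comm]

variable {A} {c : ℂ}

theorem H_mem_multiplicativePart (n : ℤ) {v : V} (hv : v ∈ A.multiplicativePart c) :
    A.H n v ∈ A.multiplicativePart c := fun a b => by
  rw [A.comm_H b, A.comm_H a, hv, map_smul, A.comm_H n]

/-- `L_n` acts on the `H_a` as a derivation: the two terms from `H_a H_b` carry coefficients `a` and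
`b`, and on a multiplicative vector they add up to the coefficient `a + b` from `H_{a+b}`. -/
theorem L_mem_multiplicativePart (n : ℤ) {v : V} (hv : v ∈ A.multiplicativePart c) :
    A.L n v ∈ A.multiplicativePart c := fun a b => by
  rw [A.H_L, map_sub, map_smul, A.H_L, A.H_L, hv, hv, hv, map_smul, add_assoc n a b,
    add_left_comm a n b]
  push_cast
  module

/-- A weight module over the centreless Heisenberg–Virasoro algebra with small weight spaces and
nonzero `H_0` contains a copy of an intermediate series module. -/
theorem exists_intermediate_series (hc0 : c ≠ 0) (hc : ∀ v, A.H 0 v = c • v)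
    (hfin : ∀ μ, FiniteDimensional ℂ ((A.L 0).eigenspace μ))
    (hd : ∀ μ, Module.finrank ℂ ((A.L 0).eigenspace μ) ≤ 2)
    (hw : ⨆ μ, (A.L 0).eigenspace μ = ⊤) {μ : ℂ} (hμ : (A.L 0).eigenspace μ ≠ ⊥) :
    ∃ (b : ℂ) (φ : ℤ → V), φ 0 ≠ 0 ∧ (∀ m i, A.H m (φ i) = c • φ (m + i)) ∧
      ∀ m i : ℤ, A.L m (φ i) = (μ + i + b * m) • φ (m + i) := by
  obtain ⟨φ₀, hφ₀, hφ₀0, hφ₀H⟩ :=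
    exists_H_mul_eq hc0 hc (H_bijective hc0 hc hfin hd hw) (hd μ) hμ
  let U : Submodule ℂ V := A.multiplicativePart c ⊓ (A.L 0).eigenspace μ
  have hU : U ≠ ⊥ := (Submodule.ne_bot_iff _).2 ⟨φ₀, ⟨hφ₀H, hφ₀⟩, hφ₀0⟩
  have : FiniteDimensional ℂ U := Submodule.finiteDimensional_of_le inf_le_right
  -- On multiplicative vectors `c⁻¹ H_{-r}` acts as `t^{-r}`. Undoing the degree of `L_r` in this
  -- way gives operators on `U` with the brackets of vector fields vanishing at a point.
  let l : ℤ → Module.End ℂ V := fun r => c⁻¹ • (A.H (-r) * A.L r)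
  have hlv : ∀ r v, l r v = c⁻¹ • A.H (-r) (A.L r v) := fun r v => rfl
  have hlU : ∀ r, ∀ v ∈ U, l r v ∈ U := fun r v hv => by
    refine U.smul_mem _ ⟨H_mem_multiplicativePart _ (L_mem_multiplicativePart _ hv.1), ?_⟩
    have := A.H_mem (-r) (A.L_mem r hv.2)
    rwa [Int.cast_neg, add_neg_cancel_right] at this
  have hll : ∀ r s, ∀ v ∈ U, l r (l s v) =
      c⁻¹ • A.H (-(r + s)) (A.L r (A.L s v)) - (s : ℂ) • l s v := fun r s v hv => by
    have h1 := L_mem_multiplicativePart s hv.1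
    have h2 := L_mem_multiplicativePart r h1
    have h3 : A.L r (A.H (-s) (A.L s v)) =
        A.H (-s) (A.L r (A.L s v)) - (s : ℂ) • A.H (r + -s) (A.L s v) := by
      rw [A.H_L (-s) r]; push_cast; module
    rw [hlv, hlv, map_smul, map_smul, h3, map_sub, map_smul, h1, h2, neg_add_cancel_left,
      neg_add, smul_comm (s : ℂ) c, ← smul_sub c, inv_smul_smul₀ hc0, smul_sub,
      smul_comm c⁻¹ (s : ℂ)]
  obtain ⟨b, φ, hφ, hφ0, hφl⟩ := exists_eigenvector_of_vanishing_fields l U hU hlU (μ := μ)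
    (fun v hv => by
      rw [hlv, neg_zero, hc, smul_smul, inv_mul_cancel₀ hc0, one_smul]
      exact Module.End.mem_eigenspace_iff.1 hv.2)
    (fun r s v hv => by
      have h1 : c⁻¹ • A.H (-(r + s)) (A.L r (A.L s v)) -
          c⁻¹ • A.H (-(r + s)) (A.L s (A.L r v)) = ((s : ℂ) - r) • l (r + s) v := by
        rw [← smul_sub, ← map_sub, A.lie_L_L, map_smul, hlv, smul_comm]
      rw [hll r s v hv, hll s r v hv, ← h1, add_comm s r]
      module)
  have hL : ∀ r : ℤ, A.L r φ = ((μ + b * r) * c⁻¹) • A.H r φ := fun r => by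
    have h1 := congrArg (fun v => A.H r v) (hφl r)
    simp only [hlv, map_smul] at h1
    rw [L_mem_multiplicativePart r hφ.1, add_neg_cancel, hc, smul_smul, smul_smul,
      inv_mul_cancel₀ hc0, one_mul] at h1
    rw [mul_smul, smul_comm, ← h1, inv_smul_smul₀ hc0]
  -- The factor `c⁻¹` normalises the family so that its member of index zero is `φ`.
  refine ⟨b, fun i => c⁻¹ • A.H i φ, ?_, fun m i => ?_, fun m i => ?_⟩
  · change c⁻¹ • A.H 0 φ ≠ 0
    rwa [hc, inv_smul_smul₀ hc0]
  · rw [map_smul, hφ.1, smul_comm]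
  · have h1 := A.lie_L_H m i φ
    rw [sub_eq_iff_eq_add, hL, map_smul, hφ.1, add_comm i m, smul_smul, mul_assoc,
      inv_mul_cancel₀ hc0] at h1
    rw [map_smul, h1]
    module

end HeisenbergVirasoroRep

/-! ### Ramond representations, flat families and singular vectors. -/

/-- A `ℤ/2`-graded representation of the `N = 2` Ramond algebra on which `C` acts by zero, given
by the operators `L_m`, `H_m`, `P_m = G_m^+` and `Q_m = G_m^-`. -/
structure RamondRep (V : Type*) [AddCommGroup V] [Module ℂ V] extends
    HeisenbergVirasoroRep V where
  P : ℤ → Module.End ℂ V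
  Q : ℤ → Module.End ℂ V
  part : ZMod 2 → Submodule ℂ V
  isCompl : IsCompl (part 0) (part 1)
  L_part : ∀ {τ} m {v}, v ∈ part τ → L m v ∈ part τ
  H_part : ∀ {τ} m {v}, v ∈ part τ → H m v ∈ part τ
  P_part : ∀ {τ} m {v}, v ∈ part τ → P m v ∈ part (τ + 1)
  Q_part : ∀ {τ} m {v}, v ∈ part τ → Q m v ∈ part (τ + 1)
  lie_L_P : ∀ m n v, L m (P n v) - P n (L m v) = ((n : ℂ) - m / 2) • P (m + n) v
  lie_L_Q : ∀ m n v, L m (Q n v) - Q n (L m v) = ((n : ℂ) - m / 2) • Q (m + n) v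
  lie_H_P : ∀ m n v, H m (P n v) - P n (H m v) = P (m + n) v
  lie_H_Q : ∀ m n v, H m (Q n v) - Q n (H m v) = -Q (m + n) v
  anti_P : ∀ m n v, P m (P n v) + P n (P m v) = 0
  anti_Q : ∀ m n v, Q m (Q n v) + Q n (Q m v) = 0
  anti_P_Q : ∀ m n v, P m (Q n v) + Q n (P m v) =
    (-2 : ℂ) • L (m + n) v + ((m : ℂ) - n) • H (m + n) v

namespace RamondRep

variable {V : Type*} [AddCommGroup V] [Module ℂ V] (A : RamondRep V)

/-- The twist by the automorphism exchanging `G^+` and `G^-` and changing the sign of `H`. -/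
def swap : RamondRep V where
  L := A.L
  H m := -A.H m
  P := A.Q
  Q := A.P
  part := A.part
  isCompl := A.isCompl
  L_part := A.L_part
  H_part m _ hv := Submodule.neg_mem _ (A.H_part m hv)
  P_part := A.Q_part
  Q_part := A.P_part
  lie_L_L := A.lie_L_L
  lie_L_H m n v := by
    rw [LinearMap.neg_apply, LinearMap.neg_apply, LinearMap.neg_apply, map_neg, smul_neg,
      ← A.lie_L_H]
    abel
  comm_H m n v := by simp [A.comm_H m n]
  lie_L_P := A.lie_L_Q
  lie_L_Q := A.lie_L_P
  lie_H_P m n v := by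
    rw [LinearMap.neg_apply, LinearMap.neg_apply, map_neg, ← neg_neg (A.Q (m + n) v),
      ← A.lie_H_Q]
    abel
  lie_H_Q m n v := by
    rw [LinearMap.neg_apply, LinearMap.neg_apply, map_neg, ← A.lie_H_P]
    abel
  anti_P := A.anti_Q
  anti_Q := A.anti_P
  anti_P_Q m n v := by
    rw [add_comm, A.anti_P_Q, add_comm n m, LinearMap.neg_apply]
    module

/-- Stability under all operators. -/
def Stable (N : Submodule ℂ V) : Prop :=
  ∀ m, ∀ v ∈ N, A.L m v ∈ N ∧ A.H m v ∈ N ∧ A.P m v ∈ N ∧ A.Q m v ∈ N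

/-- The only stable graded subspaces are the trivial ones. -/
def Simple : Prop :=
  ∀ N : Submodule ℂ V, A.Stable N → N = (N ⊓ A.part 0) ⊔ (N ⊓ A.part 1) → N = ⊥ ∨ N = ⊤

variable {A}

theorem Simple.swap (h : A.Simple) : A.swap.Simple := fun N hN hgr =>
  h N (fun m v hv => ⟨(hN m v hv).1, by simpa [RamondRep.swap] using N.neg_mem (hN m v hv).2.1,
    (hN m v hv).2.2.2, (hN m v hv).2.2.1⟩) hgr

variable (A)

/-- A family `x_i` of homogeneous vectors which transforms like the vectors `v_i` of
`R_{a,b,c}`. -/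
structure Flat (τ : ZMod 2) (a b c : ℂ) (x : ℤ → V) : Prop where
  mem : ∀ i, x i ∈ A.part τ
  L_apply : ∀ m i : ℤ, A.L m (x i) = (a + i + b * m) • x (m + i)
  H_apply : ∀ m i, A.H m (x i) = c • x (m + i)
  P_apply : ∀ m i, A.P m (x i) = A.P 0 (x (m + i))
  Q_apply : ∀ m i, A.Q m (x i) = A.Q 0 (x (m + i))

variable {A}

theorem Flat.of_swap {τ : ZMod 2} {a b c : ℂ} {x : ℤ → V} (h : A.swap.Flat τ a b c x) :
    A.Flat τ a b (-c) x where
  mem := h.mem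
  L_apply := h.L_apply
  H_apply m i := by
    rw [neg_smul, ← h.H_apply, RamondRep.swap, LinearMap.neg_apply, neg_neg]
  P_apply := h.Q_apply
  Q_apply := h.P_apply

theorem L_H_zero (m : ℤ) {c : ℂ} {v : V} (hv : A.H 0 v = c • v) : A.H 0 (A.L m v) = c • A.L m v := by
  rw [A.H_L, hv]; simp

theorem H_H_zero (m : ℤ) {c : ℂ} {v : V} (hv : A.H 0 v = c • v) : A.H 0 (A.H m v) = c • A.H m v := by
  rw [A.comm_H, hv, map_smul]

theorem P_H_zero (m : ℤ) {c : ℂ} {v : V} (hv : A.H 0 v = c • v) :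
    A.H 0 (A.P m v) = (c + 1) • A.P m v := by
  have := A.lie_H_P 0 m v
  rw [hv, map_smul, zero_add, sub_eq_iff_eq_add] at this
  rw [this]; module

theorem Q_H_zero (m : ℤ) {c : ℂ} {v : V} (hv : A.H 0 v = c • v) :
    A.H 0 (A.Q m v) = (c - 1) • A.Q m v := by
  have := A.lie_H_Q 0 m v
  rw [hv, map_smul, zero_add, sub_eq_iff_eq_add] at this
  rw [this]; module

theorem P_L_zero (m : ℤ) {μ : ℂ} {v : V} (hv : A.L 0 v = μ • v) :
    A.L 0 (A.P m v) = (μ + m) • A.P m v := by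
  have := A.lie_L_P 0 m v
  rw [hv, map_smul, zero_add, sub_eq_iff_eq_add] at this
  rw [this]; push_cast; module

theorem Q_L_zero (m : ℤ) {μ : ℂ} {v : V} (hv : A.L 0 v = μ • v) :
    A.L 0 (A.Q m v) = (μ + m) • A.Q m v := by
  have := A.lie_L_Q 0 m v
  rw [hv, map_smul, zero_add, sub_eq_iff_eq_add] at this
  rw [this]; push_cast; module

theorem H_L_zero (m : ℤ) {μ : ℂ} {v : V} (hv : A.L 0 v = μ • v) :
    A.L 0 (A.H m v) = (μ + m) • A.H m v := by
  have := A.H_mem m (Module.End.mem_eigenspace_iff.2 hv)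
  exact Module.End.mem_eigenspace_iff.1 this

theorem L_L_zero (m : ℤ) {μ : ℂ} {v : V} (hv : A.L 0 v = μ • v) :
    A.L 0 (A.L m v) = (μ + m) • A.L m v := by
  have := A.L_mem m (Module.End.mem_eigenspace_iff.2 hv)
  exact Module.End.mem_eigenspace_iff.1 this

theorem part_cases (σ : ZMod 2) : σ = 0 ∨ σ = 1 := by
  fin_cases σ
  · exact Or.inl rfl
  · exact Or.inr rfl

/-- The span of a set of homogeneous vectors is graded. -/
theorem span_graded {s : Set V} (hs : ∀ v ∈ s, ∃ σ, v ∈ A.part σ) :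
    Submodule.span ℂ s =
      (Submodule.span ℂ s ⊓ A.part 0) ⊔ (Submodule.span ℂ s ⊓ A.part 1) := by
  refine le_antisymm (Submodule.span_le.2 fun v hv => ?_) (sup_le inf_le_left inf_le_left)
  obtain ⟨σ, hσ⟩ := hs v hv
  rcases part_cases σ with rfl | rfl
  · exact Submodule.mem_sup_left ⟨Submodule.subset_span hv, hσ⟩
  · exact Submodule.mem_sup_right ⟨Submodule.subset_span hv, hσ⟩

/-- The vectors obtained from a set by applying products of the `Q_r`. -/
inductive QGenerated (A : RamondRep V) (S : Set V) : V → Prop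
  | base {v : V} : v ∈ S → QGenerated A S v
  | step (r : ℤ) {v : V} : QGenerated A S v → QGenerated A S (A.Q r v)

/-- In a simple module, a vector killed by all `G^+` cannot lie one step below another
`H_0`-weight. -/
theorem Simple.eq_zero_of_forall_P_eq_zero (hA : A.Simple) {c : ℂ} {w : V} (hw0 : w ≠ 0)
    (hw : A.H 0 w = c • w) {τ : ZMod 2} {v : V} (hv : A.H 0 v = (c - 1) • v)
    (hvτ : v ∈ A.part τ) (hP : ∀ s, A.P s v = 0) : v = 0 := by
  -- `S` is preserved by all `L_m` and `H_m` and killed by the `P_m`. Since `P_m` moves past `Q_r`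
  -- at the cost of an `L` and an `H`, products of the `Q_r` applied to `S` already span a stable
  -- subspace.
  let S : Set V := {u | A.H 0 u = (c - 1) • u ∧ u ∈ A.part τ ∧ ∀ s, A.P s u = 0}
  let N := Submodule.span ℂ {u | QGenerated A S u}
  have hSN : ∀ u ∈ S, u ∈ N := fun u hu => Submodule.subset_span (QGenerated.base hu)
  have hQN : ∀ r, ∀ u ∈ N, A.Q r u ∈ N := fun r u hu => by
    induction hu using Submodule.span_induction with
    | mem u hu => exact Submodule.subset_span (QGenerated.step r hu)
    | zero => rw [map_zero]; exact N.zero_mem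
    | add x y _ _ hx hy => rw [map_add]; exact N.add_mem hx hy
    | smul t x _ hx => rw [map_smul]; exact N.smul_mem _ hx
  have hgen : ∀ u, QGenerated A S u → ∀ m, A.L m u ∈ N ∧ A.H m u ∈ N ∧ A.P m u ∈ N := by
    intro u hu
    induction hu with
    | @base u hu =>
      obtain ⟨h1, h2, h3⟩ := hu
      refine fun m => ⟨hSN _ ⟨L_H_zero m h1, A.L_part m h2, fun s => ?_⟩,
        hSN _ ⟨H_H_zero m h1, A.H_part m h2, fun s => ?_⟩, ?_⟩
      · have := A.lie_L_P m s u
        rw [h3, h3, map_zero, smul_zero, zero_sub, neg_eq_zero] at this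
        exact this
      · have := A.lie_H_P m s u
        rw [h3, h3, map_zero, zero_sub, neg_eq_zero] at this
        exact this
      · rw [h3]; exact N.zero_mem
    | @step r u hu ih =>
      have hu' : u ∈ N := Submodule.subset_span hu
      refine fun m => ⟨?_, ?_, ?_⟩
      · rw [sub_eq_iff_eq_add.1 (A.lie_L_Q m r u)]
        exact N.add_mem (N.smul_mem _ (hQN _ _ hu')) (hQN _ _ (ih m).1)
      · rw [sub_eq_iff_eq_add.1 (A.lie_H_Q m r u)]
        exact N.add_mem (N.neg_mem (hQN _ _ hu')) (hQN _ _ (ih m).2.1)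
      · rw [eq_sub_of_add_eq (A.anti_P_Q m r u)]
        exact N.sub_mem (N.add_mem (N.smul_mem _ (ih _).1) (N.smul_mem _ (ih _).2.1))
          (hQN _ _ (ih m).2.2)
  have hstab : A.Stable N := fun m u hu => by
    refine ⟨?_, ?_, ?_, hQN m u hu⟩
    all_goals
      induction hu using Submodule.span_induction with
      | mem u hu => first | exact (hgen u hu m).1 | exact (hgen u hu m).2.1 | exact (hgen u hu m).2.2
      | zero => rw [map_zero]; exact N.zero_mem
      | add x y _ _ hx hy => rw [map_add]; exact N.add_mem hx hy
      | smul t x _ hx => rw [map_smul]; exact N.smul_mem _ hx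
  have hpart : ∀ u, QGenerated A S u → ∃ σ, u ∈ A.part σ := fun u hu => by
    induction hu with
    | base hu => exact ⟨τ, hu.2.1⟩
    | step r _ ih => exact ⟨_, A.Q_part r ih.choose_spec⟩
  have hdeg : ∀ u, QGenerated A S u → ∃ k : ℕ, A.H 0 u = (c - (k + 1)) • u := fun u hu => by
    induction hu with
    | base hu => exact ⟨0, by simpa using hu.1⟩
    | step r _ ih =>
      obtain ⟨k, hk⟩ := ih
      exact ⟨k + 1, by rw [Q_H_zero r hk]; push_cast; congr 1; ring⟩
  rcases hA N hstab (span_graded hpart) with h | h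
  · exact (Submodule.mem_bot ℂ).1 (h.le (hSN v ⟨hv, hvτ, hP⟩))
  · exfalso
    -- Every generator has charge `c - (k + 1)` with `k ≥ 0`, so `w`, of charge `c`, cannot lie in
    -- `N`. This excludes `N = ⊤`.
    have hle : N ≤ ⨆ μ, ⨆ (_ : μ ≠ c), (A.H 0).eigenspace μ := by
      refine Submodule.span_le.2 fun u hu => ?_
      obtain ⟨k, hk⟩ := hdeg u hu
      refine Submodule.mem_iSup_of_mem (c - (k + 1)) (Submodule.mem_iSup_of_mem (fun h => ?_)
        (Module.End.mem_eigenspace_iff.2 hk))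
      have : (k : ℂ) + 1 ≠ 0 := by exact_mod_cast k.succ_ne_zero
      exact this (by linear_combination -h)
    exact hw0 (Submodule.disjoint_def.1 ((A.H 0).eigenspaces_iSupIndep c) w
      (Module.End.mem_eigenspace_iff.2 hw) (hle (h ▸ Submodule.mem_top)))

end RamondRep

/-! ### From an intermediate series killed by `G^+` to a flat family. -/

namespace RamondRep

variable {V : Type*} [AddCommGroup V] [Module ℂ V] {A : RamondRep V}

/-- An intermediate series family killed by all `G^+` gives rise to a flat family. -/
theorem Simple.exists_flat_of_singular (hA : A.Simple) {τ : ZMod 2} {a b c : ℂ} {w : ℤ → V}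
    (hw0 : w 0 ≠ 0) (hwτ : ∀ i, w i ∈ A.part τ)
    (hwL : ∀ m i : ℤ, A.L m (w i) = (a + i + b * m) • w (m + i))
    (hwH : ∀ m i, A.H m (w i) = c • w (m + i)) (hwP : ∀ m i, A.P m (w i) = 0) :
    ∃ (τ : ZMod 2) (a b c : ℂ) (x : ℤ → V), A.Flat τ a b c x ∧ ∃ n, x n ≠ 0 := by
  -- Indexing by the total degree `n` collects in one weight the vectors that flatness of `w` would
  -- require to coincide.
  let G : ℤ → ℤ → V := fun n r => A.Q r (w (n - r))
  have hGτ : ∀ n r, G n r ∈ A.part (τ + 1) := fun n r => A.Q_part r (hwτ _)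
  have hQw : ∀ r k, A.Q r (w k) = G (r + k) r := fun r k => by
    change _ = A.Q r (w (r + k - r))
    rw [add_sub_cancel_left]
  have hGH : ∀ m n r, A.H m (G n r) = c • G (n + m) r - G (n + m) (r + m) := fun m n r => by
    change A.H m (A.Q r (w (n - r))) = _
    rw [sub_eq_iff_eq_add.1 (A.lie_H_Q m r _), hwH, map_smul, hQw, hQw,
      show m + r + (n - r) = n + m by ring, show r + (m + (n - r)) = n + m by ring, add_comm m r]
    abel
  have hGL : ∀ m n r : ℤ, A.L m (G n r) = ((r : ℂ) - m / 2) • G (n + m) (r + m) +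
      (a + n - r + b * m) • G (n + m) r := fun m n r => by
    change A.L m (A.Q r (w (n - r))) = _
    rw [sub_eq_iff_eq_add.1 (A.lie_L_Q m r _), hwL, map_smul, hQw, hQw,
      show m + r + (n - r) = n + m by ring, show r + (m + (n - r)) = n + m by ring, add_comm m r]
    push_cast
    module
  have hGP : ∀ s n r : ℤ, A.P s (G n r) = (-2 * a - 2 * n + (c - 2 * b) * s +
      (2 - 2 * b - c) * r) • w (n + s) := fun s n r => by
    change A.P s (A.Q r (w (n - r))) = _
    rw [eq_sub_of_add_eq (A.anti_P_Q s r _), hwP, map_zero, hwL, hwH,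
      show s + r + (n - r) = n + s by ring]
    push_cast
    module
  have hw0' : A.H 0 (w 0) = c • w 0 := by simpa using hwH 0 0
  -- By `hGP` the images under `P_s` are affine in `r`, so the difference of the two sides is killed
  -- by all `P_s`; it has charge `c - 1`.
  have haff : ∀ n r : ℤ, G n r = G n 0 + (r : ℂ) • (G n 1 - G n 0) := fun n r => by
    rw [← sub_eq_zero]
    refine hA.eq_zero_of_forall_P_eq_zero hw0 hw0' (τ := τ + 1) ?_ ?_ fun s => ?_
    · simp only [map_sub, map_add, map_smul, hGH, add_zero]
      module
    · exact Submodule.sub_mem _ (hGτ _ _) (Submodule.add_mem _ (hGτ _ _)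
        (Submodule.smul_mem _ _ (Submodule.sub_mem _ (hGτ _ _) (hGτ _ _))))
    · simp only [map_sub, map_add, map_smul, hGP]
      push_cast
      module
  by_cases hx : ∀ n, G n 1 - G n 0 = 0
  · refine ⟨τ, a, b, c, w, ⟨hwτ, hwL, hwH, fun m i => by rw [hwP, hwP], fun m i => ?_⟩, 0, hw0⟩
    rw [hQw, hQw, zero_add, haff, hx, smul_zero, add_zero]
  · push Not at hx
    refine ⟨τ + 1, a, b + 1 / 2, c - 1, fun n => G n 1 - G n 0, ⟨fun n => ?_, fun m n => ?_,
      fun m n => ?_, fun m n => ?_, fun m n => ?_⟩, hx⟩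
    · exact Submodule.sub_mem _ (hGτ _ _) (hGτ _ _)
    · rw [map_sub, hGL, hGL, haff (n + m) (1 + m), haff (n + m) (0 + m), add_comm m n]
      push_cast
      module
    · rw [map_sub, hGH, hGH, haff (n + m) (1 + m), haff (n + m) (0 + m), add_comm m n]
      push_cast
      module
    · rw [map_sub, map_sub, hGP, hGP, hGP, hGP, add_zero, add_comm m n]
      push_cast
      module
    -- `Q_s Q_r w_{m+n-s-r} = Y s + r X s` is antisymmetric in `r` and `s`. The pair `(0, 0)` gives
    -- `Y 0 = 0`, then `(0, m)` gives `Y m = -m X 0`, and `(m, m)` gives `m (X m - X 0) = 0`.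
    · let X : ℤ → V := fun s => A.Q s (G (m + n - s) 1 - G (m + n - s) 0)
      let Y : ℤ → V := fun s => A.Q s (G (m + n - s) 0)
      have hanti : ∀ r s : ℤ, Y s + (r : ℂ) • X s = -(Y r + (s : ℂ) • X r) := fun r s => by
        have h1 : ∀ r s : ℤ, Y s + (r : ℂ) • X s = A.Q s (A.Q r (w (m + n - s - r))) :=
          fun r s => by
            change A.Q s _ + (r : ℂ) • A.Q s _ = A.Q s (G (m + n - s) r)
            rw [← map_smul, ← map_add, ← haff]
        rw [h1, h1, eq_neg_iff_add_eq_zero, sub_right_comm (m + n) r s]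
        exact A.anti_Q s r _
      have hY0 : Y 0 = 0 := by
        have h1 := hanti 0 0
        rw [Int.cast_zero, zero_smul, add_zero, eq_neg_iff_add_eq_zero, ← two_smul ℂ] at h1
        exact (smul_eq_zero.1 h1).resolve_left two_ne_zero
      have hXm : X m = X 0 := by
        by_cases hm : m = 0
        · rw [hm]
        have h1 := hanti 0 m
        have h2 := hanti m m
        rw [hY0, Int.cast_zero, zero_smul, add_zero, zero_add] at h1
        rw [h1, eq_neg_iff_add_eq_zero] at h2
        have h3 : (2 * m : ℂ) • (X m - X 0) = 0 := by rw [← h2]; module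
        have h4 : (2 * m : ℂ) ≠ 0 := mul_ne_zero two_ne_zero (by exact_mod_cast hm)
        exact sub_eq_zero.1 ((smul_eq_zero.1 h3).resolve_left h4)
      have h1 : X m = A.Q m (G n 1 - G n 0) := by
        change A.Q m (G (m + n - m) 1 - G (m + n - m) 0) = _
        rw [add_sub_cancel_left]
      have h2 : X 0 = A.Q 0 (G (m + n) 1 - G (m + n) 0) := by
        change A.Q 0 (G (m + n - 0) 1 - G (m + n - 0) 0) = _
        rw [sub_zero]
      rw [← h1, ← h2, hXm]

end RamondRep

/-! ### Charge spaces and the existence of a flat family. -/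

namespace HeisenbergVirasoroRep

variable {V : Type*} [AddCommGroup V] [Module ℂ V]

/-- The restriction to a stable subspace. -/
def restrict (A : HeisenbergVirasoroRep V) (S : Submodule ℂ V) (hL : ∀ m, ∀ v ∈ S, A.L m v ∈ S)
    (hH : ∀ m, ∀ v ∈ S, A.H m v ∈ S) : HeisenbergVirasoroRep S where
  L m := (A.L m).restrict (hL m)
  H m := (A.H m).restrict (hH m)
  lie_L_L m n v := Subtype.ext (A.lie_L_L m n v)
  lie_L_H m n v := Subtype.ext (A.lie_L_H m n v)
  comm_H m n v := Subtype.ext (A.comm_H m n v)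

end HeisenbergVirasoroRep

namespace RamondRep

variable {V : Type*} [AddCommGroup V] [Module ℂ V] {A : RamondRep V}

variable (A) in
/-- The Heisenberg–Virasoro representation on a homogeneous `H_0`-eigenspace. -/
def charge (c : ℂ) (τ : ZMod 2) :
    HeisenbergVirasoroRep ((A.H 0).eigenspace c ⊓ A.part τ : Submodule ℂ V) :=
  A.toHeisenbergVirasoroRep.restrict _
    (fun m _ hv => ⟨Module.End.mem_eigenspace_iff.2
      (L_H_zero m (Module.End.mem_eigenspace_iff.1 hv.1)), A.L_part m hv.2⟩)
    (fun m _ hv => ⟨Module.End.mem_eigenspace_iff.2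
      (H_H_zero m (Module.End.mem_eigenspace_iff.1 hv.1)), A.H_part m hv.2⟩)

theorem charge_H_zero (c : ℂ) (τ : ZMod 2)
    (v : ((A.H 0).eigenspace c ⊓ A.part τ : Submodule ℂ V)) : (A.charge c τ).H 0 v = c • v :=
  Subtype.ext (Module.End.mem_eigenspace_iff.1 v.2.1)

theorem charge_L_apply (c : ℂ) (τ : ZMod 2) (m : ℤ)
    (v : ((A.H 0).eigenspace c ⊓ A.part τ : Submodule ℂ V)) :
    ((A.charge c τ).L m v : V) = A.L m v := rfl

theorem charge_iSup_eigenspace (hw : ⨆ μ, (A.L 0).eigenspace μ = ⊤) (c : ℂ) (τ : ZMod 2) :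
    ⨆ μ, ((A.charge c τ).L 0).eigenspace μ = ⊤ :=
  Module.End.iSup_eigenspace_restrict_eq_top hw (p := (A.H 0).eigenspace c ⊓ A.part τ)
    fun _ hv => ⟨Module.End.mem_eigenspace_iff.2
      (L_H_zero 0 (Module.End.mem_eigenspace_iff.1 hv.1)), A.L_part 0 hv.2⟩

variable (A) in
/-- The homogeneous weight spaces have dimension at most `d`. -/
def Bounded (d : ℕ) : Prop := ∀ μ τ,
  FiniteDimensional ℂ ((A.L 0).eigenspace μ ⊓ A.part τ : Submodule ℂ V) ∧
    Module.finrank ℂ ((A.L 0).eigenspace μ ⊓ A.part τ : Submodule ℂ V) ≤ d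

theorem Bounded.charge {d : ℕ} (hd : A.Bounded d) (c : ℂ) (τ : ZMod 2) (μ : ℂ) :
    FiniteDimensional ℂ (((A.charge c τ).L 0).eigenspace μ) ∧
      Module.finrank ℂ (((A.charge c τ).L 0).eigenspace μ) ≤ d := by
  have hle : (((A.charge c τ).L 0).eigenspace μ).map (Submodule.subtype _) ≤
      (A.L 0).eigenspace μ ⊓ A.part τ := by
    rintro _ ⟨v, hv, rfl⟩
    have h1 := congrArg Subtype.val (Module.End.mem_eigenspace_iff.1 hv)
    rw [charge_L_apply] at h1
    exact ⟨Module.End.mem_eigenspace_iff.2 h1, v.2.2⟩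
  have := (hd μ τ).1
  have hfin := Submodule.finiteDimensional_of_le hle
  refine ⟨Module.Finite.equiv (Submodule.equivMapOfInjective _ (Submodule.injective_subtype _)
    (((A.charge c τ).L 0).eigenspace μ)).symm, ?_⟩
  rw [← Submodule.finrank_map_subtype_eq]
  exact (Submodule.finrank_mono hle).trans (hd μ τ).2

/-- The charge space is a Heisenberg–Virasoro module with nonzero `H_0`, so it contains an
intermediate series. Its members have weights in `μ + ℤ`, which is why `htop` is needed only there.
-/
theorem Simple.exists_flat_of_top (hA : A.Simple) (hw : ⨆ μ, (A.L 0).eigenspace μ = ⊤)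
    (hd : A.Bounded 2) {c : ℂ} (hc0 : c ≠ 0) {τ : ZMod 2} {μ : ℂ} {v : V} (hv0 : v ≠ 0)
    (hvL : A.L 0 v = μ • v) (hvH : A.H 0 v = c • v) (hvτ : v ∈ A.part τ)
    (htop : ∀ (i : ℤ) (u : V), A.L 0 u = (μ + i) • u → A.H 0 u = c • u → u ∈ A.part τ →
      ∀ m, A.P m u = 0) :
    ∃ (τ : ZMod 2) (a b c : ℂ) (x : ℤ → V), A.Flat τ a b c x ∧ ∃ n, x n ≠ 0 := by
  obtain ⟨b, φ, hφ0, hφH, hφL⟩ := HeisenbergVirasoroRep.exists_intermediate_series hc0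
    (charge_H_zero c τ) (fun μ => (hd.charge c τ μ).1) (fun μ => (hd.charge c τ μ).2)
    (charge_iSup_eigenspace hw c τ) (μ := μ)
    ((Submodule.ne_bot_iff _).2 ⟨⟨v, Module.End.mem_eigenspace_iff.2 hvH, hvτ⟩,
      Module.End.mem_eigenspace_iff.2 (Subtype.ext hvL), fun h => hv0 (congrArg Subtype.val h)⟩)
  have hL : ∀ m i : ℤ, A.L m (φ i) = (μ + i + b * m) • (φ (m + i) : V) := fun m i =>
    congrArg Subtype.val (hφL m i)
  refine hA.exists_flat_of_singular (w := fun i => (φ i : V)) (fun h => hφ0 (Subtype.ext h))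
    (fun i => (φ i).2.2) hL (fun m i => congrArg Subtype.val (hφH m i)) fun m i =>
      htop i _ ?_ (Module.End.mem_eigenspace_iff.1 (φ i).2.1) (φ i).2.2 m
  simpa using hL 0 i

end RamondRep

namespace RamondRep

variable {V : Type*} [AddCommGroup V] [Module ℂ V] {A : RamondRep V}

theorem charge_H_injective (hw : ⨆ μ, (A.L 0).eigenspace μ = ⊤) {d : ℕ} (hd : A.Bounded d) {c : ℂ}
    (hc0 : c ≠ 0) {τ : ZMod 2} {v : V} (hvH : A.H 0 v = c • v) (hvτ : v ∈ A.part τ) {n : ℤ}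
    (h : A.H n v = 0) : v = 0 := by
  have h1 := (HeisenbergVirasoroRep.H_bijective hc0 (charge_H_zero (A := A) c τ)
    (fun μ => (hd.charge c τ μ).1) (fun μ => (hd.charge c τ μ).2)
    (charge_iSup_eigenspace hw c τ) n).1
  have h2 : (⟨v, Module.End.mem_eigenspace_iff.2 hvH, hvτ⟩ :
      ((A.H 0).eigenspace c ⊓ A.part τ : Submodule ℂ V)) = 0 :=
    h1 (by rw [map_zero]; exact Subtype.ext h)
  exact congrArg Subtype.val h2

/-- If all odd operators vanish on a simple module, then it has dimension at most one. -/
theorem Simple.finrank_le_one (hA : A.Simple) (hP : ∀ m v, A.P m v = 0) (hQ : ∀ m v, A.Q m v = 0)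
    {τ : ZMod 2} {u : V} (hu : u ∈ A.part τ) (hu0 : u ≠ 0) (U : Submodule ℂ V) :
    Module.finrank ℂ U ≤ 1 := by
  have h1 : ∀ m n v, (-2 : ℂ) • A.L (m + n) v + ((m : ℂ) - n) • A.H (m + n) v = 0 :=
    fun m n v => by rw [← A.anti_P_Q, hP, hQ, add_zero]
  -- Splitting `n` as `(n + 1) + (-1)` and as `n + 0` gives the same multiple of `L_n` but multiples
  -- of `H_n` that differ by two.
  have hH : ∀ n v, A.H n v = 0 := fun n v => by
    have e1 := h1 (n + 1) (-1) v
    have e2 := h1 n 0 v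
    rw [add_neg_cancel_right] at e1
    rw [add_zero] at e2
    have h2 : (2 : ℂ) • A.H n v = 0 := by
      rw [← sub_self (0 : V)]
      nth_rewrite 1 [← e1]
      rw [← e2]
      push_cast
      module
    exact (smul_eq_zero.1 h2).resolve_left two_ne_zero
  have hL : ∀ n v, A.L n v = 0 := fun n v => by
    have e2 := h1 n 0 v
    rw [add_zero, hH, smul_zero, add_zero] at e2
    exact (smul_eq_zero.1 e2).resolve_left (by norm_num)
  have htop : Submodule.span ℂ {u} = ⊤ := by
    refine (hA _ (fun m v hv => ?_) (span_graded fun v hv => ⟨τ, by rwa [hv]⟩)).resolve_left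
      fun h => hu0 (Submodule.span_singleton_eq_bot.1 h)
    rw [hL, hH, hP, hQ]
    simp
  have := finrank_span_le_card (R := ℂ) ({u} : Set V)
  rw [htop, finrank_top] at this
  have hfd : Module.Finite ℂ V := Module.finite_def.2 (htop ▸ Submodule.fg_span_singleton u)
  exact (Submodule.finrank_le U).trans (by simpa using this)

/-- Only finitely many charges occur near a given one, so there are a highest and a lowest. A
nonzero extreme charge yields a flat family, after exchanging `G^+` and `G^-` if it is the lowest;
the assumption on dimension excludes that both are zero. -/
theorem Simple.exists_flat (hA : A.Simple) (hw : ⨆ μ, (A.L 0).eigenspace μ = ⊤)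
    (hd : A.Bounded 2) {μ : ℂ} {τ : ZMod 2}
    (hdim : 2 ≤ Module.finrank ℂ ((A.L 0).eigenspace μ ⊓ A.part τ : Submodule ℂ V)) :
    ∃ (τ : ZMod 2) (a b c : ℂ) (x : ℤ → V), A.Flat τ a b c x ∧ ∃ n, x n ≠ 0 := by
  have hres : ∀ σ, ∀ v ∈ (A.L 0).eigenspace μ ⊓ A.part σ,
      A.H 0 v ∈ (A.L 0).eigenspace μ ⊓ A.part σ := fun σ v hv =>
    ⟨by simpa using A.H_mem 0 hv.1, A.H_part 0 hv.2⟩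
  obtain ⟨c, u₀, hu₀0, hu₀L, hu₀H, hu₀τ⟩ :
      ∃ (c : ℂ) (u : V), u ≠ 0 ∧ A.L 0 u = μ • u ∧ A.H 0 u = c • u ∧ u ∈ A.part τ := by
    have := (hd μ τ).1
    have : Nontrivial ((A.L 0).eigenspace μ ⊓ A.part τ : Submodule ℂ V) :=
      Module.nontrivial_of_finrank_pos (R := ℂ) (by omega)
    obtain ⟨c, hc⟩ := Module.End.exists_eigenvalue ((A.H 0).restrict (hres τ))
    obtain ⟨u, hu⟩ := hc.exists_hasEigenvector
    exact ⟨c, u, fun h => hu.2 (Subtype.ext h), Module.End.mem_eigenspace_iff.1 u.2.1,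
      congrArg Subtype.val hu.apply_eq_smul, u.2.2⟩
  -- Odd operators change charge by one and flip parity, so the parity can be tied to the charge as
  -- `τ + j`.
  let W : ℤ → ℤ → V → Prop := fun j i u =>
    A.L 0 u = (μ + i) • u ∧ A.H 0 u = (c + j) • u ∧ u ∈ A.part (τ + j)
  have hWL : ∀ {j i u} m, W j i u → W j (i + m) (A.L m u) := fun {j i u} m h =>
    ⟨by rw [L_L_zero m h.1]; push_cast; congr 1; ring, L_H_zero m h.2.1, A.L_part m h.2.2⟩
  have hWH : ∀ {j i u} m, W j i u → W j (i + m) (A.H m u) := fun {j i u} m h =>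
    ⟨by rw [H_L_zero m h.1]; push_cast; congr 1; ring, H_H_zero m h.2.1, A.H_part m h.2.2⟩
  have hWP : ∀ {j i u} m, W j i u → W (j + 1) (i + m) (A.P m u) := fun {j i u} m h =>
    ⟨by rw [P_L_zero m h.1]; push_cast; congr 1; ring,
      by rw [P_H_zero m h.2.1]; push_cast; congr 1; ring, by
      have := A.P_part m h.2.2
      rw [add_assoc] at this
      push_cast
      exact this⟩
  have hWQ : ∀ {j i u} m, W j i u → W (j - 1) (i + m) (A.Q m u) := fun {j i u} m h =>
    ⟨by rw [Q_L_zero m h.1]; push_cast; congr 1; ring,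
      by rw [Q_H_zero m h.2.1]; push_cast; congr 1; ring, by
      have := A.Q_part m h.2.2
      rw [add_assoc] at this
      push_cast
      rwa [sub_eq_add_neg, show (-1 : ZMod 2) = 1 from rfl]⟩
  let J : Set ℤ := {j | ∃ i u, u ≠ 0 ∧ W j i u}
  have hJ0 : (0 : ℤ) ∈ J := ⟨0, u₀, hu₀0, by simpa using hu₀L, by simpa using hu₀H, by
    simpa using hu₀τ⟩
  -- At nonzero charge `H_{-i}` is injective and carries weight `μ + i` to weight `μ`, where `H_0`
  -- has finitely many eigenvalues. At most one `j` has `c + j = 0`.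
  have hJfin : J.Finite := by
    have hfin : ∀ σ, {j : ℤ | ∃ u ∈ (A.L 0).eigenspace μ ⊓ A.part σ, u ≠ 0 ∧
        A.H 0 u = (c + j) • u}.Finite := fun σ => by
      have := (hd μ σ).1
      have h1 := Module.End.finite_hasEigenvalue ((A.H 0).restrict (hres σ))
      refine (h1.preimage (f := fun j : ℤ => c + j) fun j _ k _ h => ?_).subset ?_
      · exact_mod_cast add_left_cancel h
      · rintro j ⟨u, hu, hu0, h⟩
        exact Module.End.hasEigenvalue_of_hasEigenvector (x := ⟨u, hu⟩)
          ⟨Module.End.mem_eigenspace_iff.2 (Subtype.ext h), fun h0 => hu0 (congrArg Subtype.val h0)⟩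
    have hsub : {j : ℤ | c + j = 0}.Subsingleton := fun j hj k hk => by
      have : (j : ℂ) = k := add_left_cancel (Eq.trans hj (Eq.symm hk))
      exact_mod_cast this
    refine (((hfin 0).union (hfin 1)).union hsub.finite).subset ?_
    rintro j ⟨i, u, hu0, hu⟩
    by_cases hj : c + j = 0
    · exact Or.inr hj
    · refine Or.inl ?_
      have h1 := hWH (-i) hu
      rw [add_neg_cancel] at h1
      have h2 : ∃ u ∈ (A.L 0).eigenspace μ ⊓ A.part (τ + j), u ≠ 0 ∧ A.H 0 u = (c + j) • u :=
        ⟨_, ⟨Module.End.mem_eigenspace_iff.2 (by simpa using h1.1), h1.2.2⟩,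
          fun h0 => hu0 (charge_H_injective hw hd hj hu.2.1 hu.2.2 h0), h1.2.1⟩
      rcases part_cases (τ + j) with h | h
      · rw [h] at h2; exact Or.inl h2
      · rw [h] at h2; exact Or.inr h2
  obtain ⟨j₁, hj₁, hmax⟩ := J.exists_max_image id hJfin ⟨0, hJ0⟩
  obtain ⟨j₀, hj₀, hmin⟩ := J.exists_min_image id hJfin ⟨0, hJ0⟩
  have hP0 : ∀ {i u} m, W j₁ i u → A.P m u = 0 := fun {i u} m h => by
    by_contra h0
    have := hmax _ ⟨_, _, h0, hWP m h⟩
    simp at this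
  have hQ0 : ∀ {i u} m, W j₀ i u → A.Q m u = 0 := fun {i u} m h => by
    by_contra h0
    have := hmin _ ⟨_, _, h0, hWQ m h⟩
    simp at this
  by_cases h1 : c + j₁ = 0
  -- If both extreme charges vanish they coincide, so vectors of that charge are killed by all odd
  -- operators. They span `V`, so the odd operators vanish and every subspace has dimension at most
  -- one.
  · by_cases h2 : c + j₀ = 0
    · exfalso
      obtain rfl : j₁ = j₀ := by
        have : (j₁ : ℂ) = j₀ := add_left_cancel (h1.trans h2.symm)
        exact_mod_cast this
      obtain ⟨i, u, hu0, hu⟩ := hj₁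
      have htop : Submodule.span ℂ {u | ∃ i, W j₁ i u} = ⊤ := by
        refine (hA _ (fun m v hv => ?_) (span_graded fun v hv => ⟨_, hv.choose_spec.2.2⟩)).resolve_left
          fun h => hu0 ((Submodule.mem_bot ℂ).1 (h.le (Submodule.subset_span ⟨i, hu⟩)))
        induction hv using Submodule.span_induction with
        | mem v hv =>
          obtain ⟨i, hv⟩ := hv
          rw [hP0 m hv, hQ0 m hv]
          exact ⟨Submodule.subset_span ⟨_, hWL m hv⟩, Submodule.subset_span ⟨_, hWH m hv⟩,
            Submodule.zero_mem _, Submodule.zero_mem _⟩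
        | zero => simp
        | add x y _ _ hx hy =>
          simp only [map_add]
          exact ⟨Submodule.add_mem _ hx.1 hy.1, Submodule.add_mem _ hx.2.1 hy.2.1,
            Submodule.add_mem _ hx.2.2.1 hy.2.2.1, Submodule.add_mem _ hx.2.2.2 hy.2.2.2⟩
        | smul t x _ hx =>
          simp only [map_smul]
          exact ⟨Submodule.smul_mem _ _ hx.1, Submodule.smul_mem _ _ hx.2.1,
            Submodule.smul_mem _ _ hx.2.2.1, Submodule.smul_mem _ _ hx.2.2.2⟩
      have hP : ∀ m, A.P m = 0 := fun m => LinearMap.ext_on htop (by rintro v ⟨i, hv⟩; exact hP0 m hv)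
      have hQ : ∀ m, A.Q m = 0 := fun m => LinearMap.ext_on htop (by rintro v ⟨i, hv⟩; exact hQ0 m hv)
      have := hA.finrank_le_one (fun m v => by rw [hP]; rfl) (fun m v => by rw [hQ]; rfl)
        hu.2.2 hu0 ((A.L 0).eigenspace μ ⊓ A.part τ)
      omega
    · obtain ⟨i, u, hu0, hu⟩ := hj₀
      obtain ⟨σ, a, b, c', x, hx, hn⟩ := hA.swap.exists_flat_of_top hw hd (neg_ne_zero.2 h2) hu0
        hu.1 (by rw [neg_smul, ← hu.2.1]; rfl) hu.2.2 fun k v hv hv' hvτ m => by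
          refine hQ0 (i := i + k) m ⟨?_, ?_, hvτ⟩
          · rw [Int.cast_add, ← add_assoc]; exact hv
          · rw [neg_smul] at hv'; exact neg_injective hv'
      exact ⟨σ, a, b, -c', x, hx.of_swap, hn⟩
  · obtain ⟨i, u, hu0, hu⟩ := hj₁
    refine hA.exists_flat_of_top hw hd h1 hu0 hu.1 hu.2.1 hu.2.2 fun k v hv hv' hvτ m =>
      hP0 (i := i + k) m ⟨?_, hv', hvτ⟩
    rw [Int.cast_add, ← add_assoc]; exact hv

end RamondRep

/-! ### Heisenberg algebras of nonzero level have no bounded weight modules. -/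

section Heisenberg

variable {V : Type*} [AddCommGroup V] [Module ℂ V] {H : ℤ → Module.End ℂ V} {γ : ℂ}
  {E : ℂ → Submodule ℂ V} (hE : ∀ (m : ℤ) (μ : ℂ), ∀ v ∈ E μ, H m v ∈ E (μ + m))
  (hcomm : ∀ m n, m + n ≠ 0 → ∀ v, H m (H n v) = H n (H m v))
  (hlevel : ∀ (m : ℤ) v, H m (H (-m) v) - H (-m) (H m v) = (m * γ) • v)
  (hfin : ∀ μ, FiniteDimensional ℂ (E μ)) {d : ℕ} (hd : ∀ μ, Module.finrank ℂ (E μ) ≤ d)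

include hE hcomm hlevel hfin hd

/-- `H_n, H_{-n}` is a Weyl pair, so kernel vectors of `H_n` occur in few degrees. Since `H_{±2n}`
preserve `ker H_n`, a kernel vector may be pushed up by `H_{2n}` until its next image vanishes, and
the last nonzero vector then pushed down by `H_{-2n}` without ever vanishing: too many kernel
degrees. -/
theorem heisenberg_injOn (hγ : γ ≠ 0) {n : ℤ} (hn : n ≠ 0) {ν : ℂ} {v : V} (hv : v ∈ E ν)
    (h : H n v = 0) : v = 0 := by
  by_contra hv0
  have hpow_mem : ∀ (m : ℤ) (k : ℕ) (μ : ℂ), ∀ u ∈ E μ, (H m ^ k) u ∈ E (μ + k * m) := by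
    intro m k
    induction k with
    | zero => intro μ u hu; simpa using hu
    | succ k ih =>
      intro μ u hu
      rw [pow_succ', Module.End.mul_apply]
      convert hE m _ _ (ih μ u hu) using 2
      push_cast; ring
  have hpow_ker : ∀ (m : ℤ), n + m ≠ 0 → ∀ (k : ℕ) (u : V), H n u = 0 → H n ((H m ^ k) u) = 0 := by
    intro m hm k u hu
    induction k with
    | zero => simpa using hu
    | succ k ih => rw [pow_succ', Module.End.mul_apply, hcomm _ _ hm, ih, map_zero]
  have hcard : ∀ (μ : ℂ) (F : Finset ℕ), (∀ k ∈ F, ∃ v ∈ E (μ + k * n), v ≠ 0 ∧ H n v = 0) →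
      F.card ≤ d := fun μ F hF => by
    have := hfin μ
    refine (card_le_finrank_of_weyl (X := H n) (Y := H (-n)) (γ := n * γ)
      (mul_ne_zero (by exact_mod_cast hn) hγ) (hlevel n) E (n := n) ?_ μ F hF).trans (hd μ)
    intro ν v hv
    convert hE (-n) ν v hv using 2
    push_cast; ring
  have hdouble : ((Finset.range (d + 1)).image (2 * ·)).card = d + 1 := by
    rw [Finset.card_image_of_injective _ fun a b h => by simpa using h, Finset.card_range]
  have hex : ∃ K, (H (2 * n) ^ K) v = 0 := by
    by_contra! hex
    have := hcard ν ((Finset.range (d + 1)).image (2 * ·)) fun k hk => by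
      obtain ⟨j, -, rfl⟩ := Finset.mem_image.1 hk
      refine ⟨(H (2 * n) ^ j) v, ?_, hex j, hpow_ker _ (by omega) j v h⟩
      convert hpow_mem (2 * n) j ν v hv using 2
      push_cast; ring
    omega
  classical
  have hK := Nat.find_spec hex
  have hmin := fun m hm => Nat.find_min hex (m := m) hm
  set K := Nat.find hex
  rcases hK' : K with _ | j
  · rw [hK'] at hK
    exact hv0 (by simpa using hK)
  rw [hK', pow_succ', Module.End.mul_apply] at hK
  have hu0 := hmin j (by omega)
  have hu := hpow_mem (2 * n) j ν v hv
  have hun := hpow_ker (2 * n) (by omega) j v h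
  set u := (H (2 * n) ^ j) v
  -- The base lies `d` steps of `2n` below `u`, so that the `d + 1` vectors `H_{-2n}^l u`, `0 ≤ l ≤
  -- d`, have nonnegative even offsets.
  have := hcard (ν + j * (2 * n : ℤ) - 2 * d * n) ((Finset.range (d + 1)).image (2 * ·))
    fun k hk => by
      obtain ⟨i, hi, rfl⟩ := Finset.mem_image.1 hk
      have hi : i ≤ d := Nat.lt_succ_iff.1 (Finset.mem_range.1 hi)
      obtain ⟨l, rfl⟩ := Nat.exists_eq_add_of_le hi
      refine ⟨(H (-(2 * n)) ^ l) u, ?_, fun h0 => ?_, hpow_ker _ (by omega) l u hun⟩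
      · convert hpow_mem (-(2 * n)) l _ u hu using 2
        push_cast; ring
      · have := (Module.End.weyl_pow_apply (X := H (2 * n)) (Y := H (-(2 * n)))
          (mul_ne_zero (by exact_mod_cast (mul_ne_zero two_ne_zero hn)) hγ) (hlevel (2 * n))
          hu0 hK l).1
        rw [h0, map_zero] at this
        exact this rfl
  omega

/-- A Heisenberg algebra of nonzero level has no weight module with bounded weight spaces. -/
theorem heisenberg_level_eq_zero {μ : ℂ} (hμ : E μ ≠ ⊥) : γ = 0 := by
  by_contra hγ
  have hinj := fun {n : ℤ} hn {ν : ℂ} {v : V} => heisenberg_injOn hE hcomm hlevel hfin hd hγ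
    (n := n) hn (ν := ν) (v := v)
  have := hfin μ
  have := hfin (μ + 2)
  have hup : ∀ v ∈ E μ, (H 1 * H 1) v ∈ E (μ + 2) := fun v hv => by
    rw [Module.End.mul_apply]
    convert hE 1 _ _ (hE 1 _ v hv) using 2
    push_cast; ring
  have hdown : ∀ v ∈ E (μ + 2), (H (-1) * H (-1)) v ∈ E μ := fun v hv => by
    rw [Module.End.mul_apply]
    convert hE (-1) _ _ (hE (-1) _ v hv) using 2
    push_cast; ring
  have hup2 : ∀ v ∈ E μ, H 2 v ∈ E (μ + 2) := fun v hv => by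
    convert hE 2 _ v hv using 2
    norm_num
  have hdown2 : ∀ v ∈ E (μ + 2), H (-2) v ∈ E μ := fun v hv => by
    convert hE (-2) _ v hv using 2
    push_cast; ring
  have h1 : Function.Injective ((H 1 * H 1).restrict hup) := by
    rw [← LinearMap.ker_eq_bot, eq_bot_iff]
    intro v hv
    exact Subtype.ext (hinj one_ne_zero v.2
      (hinj one_ne_zero (hE 1 _ _ v.2) (congrArg Subtype.val hv)))
  have h2 : Function.Injective ((H (-1) * H (-1)).restrict hdown) := by
    rw [← LinearMap.ker_eq_bot, eq_bot_iff]
    intro v hv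
    exact Subtype.ext (hinj (by norm_num) v.2
      (hinj (by norm_num) (hE (-1) _ _ v.2) (congrArg Subtype.val hv)))
  have hdim := le_antisymm (LinearMap.finrank_le_finrank_of_injective h1)
    (LinearMap.finrank_le_finrank_of_injective h2)
  -- `H_1²` commutes with `H_{±2}`. Identifying `E μ` with `E (μ + 2)` through it turns `H_2` and
  -- `H_{-2}` into endomorphisms of `E μ` with commutator the scalar `2γ`, which must have trace
  -- zero.
  let p : E μ ≃ₗ[ℂ] E (μ + 2) := LinearEquiv.ofBijective _
    ⟨h1, (LinearMap.injective_iff_surjective_of_finrank_eq_finrank hdim).1 h1⟩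
  let X : Module.End ℂ (E μ) := p.symm.toLinearMap ∘ₗ (H 2).restrict hup2
  let Y : Module.End ℂ (E μ) := (H (-2)).restrict hdown2 ∘ₗ p.toLinearMap
  have hXY : X * Y - Y * X = (2 * γ) • 1 := by
    refine LinearMap.ext fun v => ?_
    have e1 : (X * Y) v = ⟨H 2 (H (-2) v), by
        convert hE 2 _ _ (hE (-2) _ _ v.2) using 2
        push_cast; ring⟩ := by
      refine p.symm_apply_eq.2 (Subtype.ext ?_)
      change H 2 (H (-2) (H 1 (H 1 v))) = H 1 (H 1 (H 2 (H (-2) v)))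
      rw [hcomm (-2) 1 (by norm_num), hcomm (-2) 1 (by norm_num), hcomm 2 1 (by norm_num),
        hcomm 2 1 (by norm_num)]
    have e2 : ((Y * X) v : V) = H (-2) (H 2 v) := by
      change H (-2) (p (p.symm _) : E (μ + 2)) = _
      rw [LinearEquiv.apply_symm_apply]
      rfl
    refine Subtype.ext ?_
    change ((X * Y) v : V) - ((Y * X) v : V) = (2 * γ) • (v : V)
    rw [e1, e2]
    exact_mod_cast hlevel 2 v
  have htr := congrArg (LinearMap.trace ℂ (E μ)) hXY
  rw [map_sub, LinearMap.trace_mul_comm, sub_self, map_smul, LinearMap.trace_one, smul_eq_mul] at htr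
  have : Nontrivial (E μ) := Submodule.nontrivial_iff_ne_bot.2 hμ
  have hpos : (Module.finrank ℂ (E μ) : ℂ) ≠ 0 := by
    exact_mod_cast (Module.finrank_pos (R := ℂ) (M := E μ)).ne'
  exact mul_ne_zero (mul_ne_zero two_ne_zero hγ) hpos htr.symm

end Heisenberg

/-! ### From supermodules to operators; the central element acts by zero. -/

namespace SuperModule

variable {V : Type*} [AddCommGroup V] [Module ℂ V] (M : SuperModule Ramond V)

theorem act_even {x y : Ramond} {σ : ZMod 2} (hx : x ∈ Ramond.part 0) (hy : y ∈ Ramond.part σ)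
    (v : V) : M.act x (M.act y v) - M.act y (M.act x v) = M.act (Ramond.bracket x y) v := by
  have := M.act_bracket v hx hy
  rw [ZMod.val_zero, zero_mul, pow_zero, one_smul] at this
  exact this

theorem act_odd {x y : Ramond} (hx : x ∈ Ramond.part 1) (hy : y ∈ Ramond.part 1)
    (v : V) : M.act x (M.act y v) + M.act y (M.act x v) = M.act (Ramond.bracket x y) v := by
  have := M.act_bracket v hx hy
  rw [show (1 : ZMod 2).val = 1 from rfl, mul_one, pow_one, neg_one_smul, sub_neg_eq_add] at this
  exact this

/-- A module on which `C` acts by zero, as a family of operators. -/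
noncomputable def toRamondRep (hC : ∀ v, M.act Ramond.C v = 0) : RamondRep V where
  L m := M.act (Ramond.L m)
  H m := M.act (Ramond.H m)
  P m := M.act (Ramond.Gp m)
  Q m := M.act (Ramond.Gm m)
  part := M.part
  isCompl := M.isCompl
  L_part {τ} m v hv := by simpa using M.act_mem (Ramond.L_mem m) hv
  H_part {τ} m v hv := by simpa using M.act_mem (Ramond.H_mem m) hv
  P_part {τ} m v hv := by simpa [add_comm] using M.act_mem (Ramond.Gp_mem m) hv
  Q_part {τ} m v hv := by simpa [add_comm] using M.act_mem (Ramond.Gm_mem m) hv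
  lie_L_L m n v := by
    rw [M.act_even (Ramond.L_mem m) (Ramond.L_mem n), Ramond.bracket_L_L]
    simp only [map_add, map_smul, LinearMap.add_apply, LinearMap.smul_apply, hC, smul_zero,
      add_zero]
  lie_L_H m n v := by
    rw [M.act_even (Ramond.L_mem m) (Ramond.H_mem n), Ramond.bracket_L_H]
    simp
  comm_H m n v := by
    rw [← sub_eq_zero, M.act_even (Ramond.H_mem m) (Ramond.H_mem n), Ramond.bracket_H_H,
      map_smul, LinearMap.smul_apply, hC, smul_zero]
  lie_L_P m n v := by
    rw [M.act_even (Ramond.L_mem m) (Ramond.Gp_mem n), Ramond.bracket_L_Gp]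
    simp
  lie_L_Q m n v := by
    rw [M.act_even (Ramond.L_mem m) (Ramond.Gm_mem n), Ramond.bracket_L_Gm]
    simp
  lie_H_P m n v := by
    rw [M.act_even (Ramond.H_mem m) (Ramond.Gp_mem n), Ramond.bracket_H_Gp]
  lie_H_Q m n v := by
    rw [M.act_even (Ramond.H_mem m) (Ramond.Gm_mem n), Ramond.bracket_H_Gm]
    simp
  anti_P m n v := by
    rw [M.act_odd (Ramond.Gp_mem m) (Ramond.Gp_mem n), Ramond.bracket_Gp_Gp]
    simp
  anti_Q m n v := by
    rw [M.act_odd (Ramond.Gm_mem m) (Ramond.Gm_mem n), Ramond.bracket_Gm_Gm]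
    simp
  anti_P_Q m n v := by
    rw [M.act_odd (Ramond.Gp_mem m) (Ramond.Gm_mem n), Ramond.bracket_Gp_Gm]
    simp only [map_add, map_smul, LinearMap.add_apply, LinearMap.smul_apply, hC, smul_zero,
      add_zero]

variable {M}

/-- Stability needs to be checked on the basis only. -/
theorem act_mem_of_basis {N : Submodule ℂ V}
    (h : ∀ i, ∀ v ∈ N, M.act (Finsupp.single i 1) v ∈ N) (x : Ramond) {v : V} (hv : v ∈ N) :
    M.act x v ∈ N := by
  induction x using Finsupp.induction_linear with
  | zero => rw [map_zero]; exact N.zero_mem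
  | add x y hx hy => rw [map_add]; exact N.add_mem hx hy
  | single i t =>
    have : Finsupp.single i t = t • Finsupp.single i (1 : ℂ) := by simp
    rw [this, map_smul]
    exact N.smul_mem _ (h i v hv)

theorem toRamondRep_simple (hM : M.IsSimple) (hC : ∀ v, M.act Ramond.C v = 0) :
    (M.toRamondRep hC).Simple := fun N hN hgr => by
  refine hM.2 N ⟨fun x v hv => act_mem_of_basis (fun i v hv => ?_) x hv, hgr⟩
  rcases i with m | m | m | m | _
  · exact (hN m v hv).1
  · exact (hN m v hv).2.1
  · exact (hN m v hv).2.2.1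
  · exact (hN m v hv).2.2.2
  · change M.act Ramond.C v ∈ N
    rw [hC]
    exact N.zero_mem

variable (M) in
theorem exists_homogeneous_add (v : V) : ∃ v₀ ∈ M.part 0, ∃ v₁ ∈ M.part 1, v₀ + v₁ = v :=
  Submodule.mem_sup.1 (M.isCompl.sup_eq_top.ge Submodule.mem_top)

theorem eq_zero_of_add_eq_zero {v₀ v₁ : V} (h₀ : v₀ ∈ M.part 0) (h₁ : v₁ ∈ M.part 1)
    (h : v₀ + v₁ = 0) : v₀ = 0 ∧ v₁ = 0 := by
  have h2 : v₀ = 0 := Submodule.disjoint_def.1 M.isCompl.disjoint v₀ h₀ (by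
    rw [eq_neg_of_add_eq_zero_left h]
    exact Submodule.neg_mem _ h₁)
  exact ⟨h2, by simpa [h2] using h⟩

/-- Eigenspaces of even operators are graded. -/
theorem eigenspace_graded {f : Module.End ℂ V} (hf : ∀ τ, ∀ v ∈ M.part τ, f v ∈ M.part τ) (κ : ℂ) :
    f.eigenspace κ = (f.eigenspace κ ⊓ M.part 0) ⊔ (f.eigenspace κ ⊓ M.part 1) := by
  refine le_antisymm (fun v hv => ?_) (sup_le inf_le_left inf_le_left)
  obtain ⟨v₀, h₀, v₁, h₁, rfl⟩ := M.exists_homogeneous_add v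
  rw [Module.End.mem_eigenspace_iff, map_add, smul_add, ← sub_eq_zero, add_sub_add_comm] at hv
  have h := eq_zero_of_add_eq_zero
    (Submodule.sub_mem _ (hf 0 _ h₀) (Submodule.smul_mem _ κ h₀))
    (Submodule.sub_mem _ (hf 1 _ h₁) (Submodule.smul_mem _ κ h₁)) hv
  exact Submodule.add_mem_sup ⟨Module.End.mem_eigenspace_iff.2 (sub_eq_zero.1 h.1), h₀⟩
    ⟨Module.End.mem_eigenspace_iff.2 (sub_eq_zero.1 h.2), h₁⟩

theorem act_even_mem {x : Ramond} (hx : x ∈ Ramond.part 0) (τ : ZMod 2) (v : V)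
    (hv : v ∈ M.part τ) : M.act x v ∈ M.part τ := by
  have := M.act_mem hx hv
  rwa [zero_add] at this

theorem IsWeight.exists_weightSpace_ne_bot [Nontrivial V] (hM : M.IsWeight) :
    ∃ μ τ, M.weightSpace μ ⊓ M.part τ ≠ ⊥ := by
  by_contra! h
  have h1 : ∀ μ, M.weightSpace μ = ⊥ := fun μ => by
    have := eigenspace_graded (M := M) (act_even_mem (Ramond.L_mem 0)) μ
    rw [weightSpace, this]
    exact (congrArg₂ (· ⊔ ·) (h μ 0) (h μ 1)).trans (sup_bot_eq _)
  have h2 : (⊤ : Submodule ℂ V) = ⊥ := by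
    rw [← hM]
    simp [h1]
  exact top_ne_bot h2

theorem IsDimBound.finiteDimensional {p : ℕ} (hp : M.IsDimBound p) (μ : ℂ) (τ : ZMod 2) :
    FiniteDimensional ℂ (M.weightSpace μ ⊓ M.part τ : Submodule ℂ V) :=
  Module.rank_lt_aleph0_iff.1 ((hp.2 μ τ).trans_lt (Cardinal.natCast_lt_aleph0))

theorem IsDimBound.finrank_le {p : ℕ} (hp : M.IsDimBound p) (μ : ℂ) (τ : ZMod 2) :
    Module.finrank ℂ (M.weightSpace μ ⊓ M.part τ : Submodule ℂ V) ≤ p :=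
  Module.finrank_le_of_rank_le (hp.2 μ τ)

/-- The central element acts by zero on a simple cuspidal module. -/
theorem IsCuspidal.act_C_eq_zero (hs : M.IsSimple) (hM : M.IsCuspidal) (v : V) :
    M.act Ramond.C v = 0 := by
  obtain ⟨hw, p, hp⟩ := hM
  have := hs.1
  obtain ⟨μ, τ, hμ⟩ := hw.exists_weightSpace_ne_bot
  have hfin := hp.finiteDimensional
  have hCcomm : ∀ x v, M.act Ramond.C (M.act x v) = M.act x (M.act Ramond.C v) := fun x v => by
    induction x using Finsupp.induction_linear with
    | zero => simp
    | add x y hx hy => simp only [map_add, LinearMap.add_apply, hx, hy]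
    | single i t =>
      have h1 : Finsupp.single i t = t • Finsupp.single i (1 : ℂ) := by simp
      rw [h1]
      simp only [map_smul, LinearMap.smul_apply]
      congr 1
      have := M.act_even Ramond.C_mem (Ramond.single_mem_part i) v
      rwa [Ramond.bracket_C_left, map_zero, LinearMap.zero_apply, sub_eq_zero] at this
  have hmem : ∀ v ∈ M.weightSpace μ ⊓ M.part τ, M.act Ramond.C v ∈ M.weightSpace μ ⊓ M.part τ :=
    fun v hv => ⟨by
      rw [SetLike.mem_coe, weightSpace, Module.End.mem_eigenspace_iff, ← hCcomm,
        Module.End.mem_eigenspace_iff.1 hv.1, map_smul], act_even_mem Ramond.C_mem τ v hv.2⟩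
  have := Submodule.nontrivial_iff_ne_bot.2 hμ
  obtain ⟨κ, hκ⟩ := Module.End.exists_eigenvalue ((M.act Ramond.C).restrict hmem)
  obtain ⟨u, hu⟩ := hκ.exists_hasEigenvector
  have hu1 : M.act Ramond.C u = κ • (u : V) := congrArg Subtype.val hu.apply_eq_smul
  -- Schur's lemma: `C` is even and central, so its eigenspace is a graded submodule, and it is
  -- nonzero.
  have htop : Module.End.eigenspace (M.act Ramond.C) κ = ⊤ := by
    refine (hs.2 _ ⟨fun x v hv => ?_, eigenspace_graded (act_even_mem Ramond.C_mem) κ⟩).resolve_left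
      fun h => hu.2 (Subtype.ext ((Submodule.mem_bot ℂ).1
        (h.le (Module.End.mem_eigenspace_iff.2 hu1))))
    rw [Module.End.mem_eigenspace_iff] at hv ⊢
    rw [hCcomm, hv, map_smul]
  have hC : ∀ v, M.act Ramond.C v = κ • v := fun v =>
    Module.End.mem_eigenspace_iff.1 (htop.ge Submodule.mem_top)
  have hHH : ∀ m n v, M.act (Ramond.H m) (M.act (Ramond.H n) v) -
      M.act (Ramond.H n) (M.act (Ramond.H m) v) =
      (if m + n = 0 then (m : ℂ) / 3 else 0) • κ • v := fun m n v => by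
    rw [M.act_even (Ramond.H_mem m) (Ramond.H_mem n), Ramond.bracket_H_H, map_smul,
      LinearMap.smul_apply, hC]
  -- `[H_m, H_{-m}] = (m / 3) C`, so the level is `κ / 3`.
  have h0 : κ / 3 = 0 := by
    refine heisenberg_level_eq_zero (H := fun m => M.act (Ramond.H m))
      (E := fun μ => M.weightSpace μ ⊓ M.part τ) (fun m μ v hv => ⟨?_, ?_⟩) (fun m n h v => ?_)
      (fun m v => ?_) (fun μ => hfin μ τ) (fun μ => hp.finrank_le μ τ) hμ
    · rw [SetLike.mem_coe, weightSpace, Module.End.mem_eigenspace_iff]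
      have := M.act_even (Ramond.L_mem 0) (Ramond.H_mem m) v
      rw [Module.End.mem_eigenspace_iff.1 hv.1, Ramond.bracket_L_H, zero_add, map_smul, map_smul,
        LinearMap.smul_apply, sub_eq_iff_eq_add] at this
      rw [this, add_comm, add_smul]
    · exact act_even_mem (Ramond.H_mem m) τ v hv.2
    · have := hHH m n v
      rwa [if_neg h, zero_smul, sub_eq_zero] at this
    · have := hHH m (-m) v
      rw [if_pos (add_neg_cancel m), smul_smul] at this
      rw [this]
      congr 1
      ring
  rw [hC, (div_eq_zero_iff.1 h0).resolve_right (by norm_num), zero_smul]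

end SuperModule

/-! ### Simplicity and proper submodules of `R_{a,b,c}`. -/

namespace RSpace

theorem single_smul_eq (k : RModIndex) (t : ℂ) :
    (Finsupp.single k t : RSpace) = t • Finsupp.single k (1 : ℂ) := by simp

/-- The weight of a basis vector, up to the shift by `a`. -/
def degree : RModIndex → ℤ
  | .v i => i
  | .vp i => i
  | .vm i => i
  | .vpm i => i

theorem act_L_zero_single (a b c : ℂ) (k : RModIndex) :
    act a b c (Ramond.L 0) (Finsupp.single k 1) = (a + degree k) • Finsupp.single k (1 : ℂ) := by
  cases k with
  | v i => exact (act_L_v a b c 0 i).trans (by simp [degree, v])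
  | vp i => exact (act_L_vp a b c 0 i).trans (by simp [degree, vp])
  | vm i => exact (act_L_vm a b c 0 i).trans (by simp [degree, vm])
  | vpm i => exact (act_L_vpm a b c 0 i).trans (by simp [degree, vpm])

theorem act_L_zero_apply (a b c : ℂ) (w : RSpace) (k : RModIndex) :
    act a b c (Ramond.L 0) w k = (a + degree k) * w k := by
  induction w using Finsupp.induction_linear with
  | zero => simp
  | add x y hx hy => rw [map_add, Finsupp.add_apply, hx, hy, Finsupp.add_apply]; ring
  | single l t =>
    rw [single_smul_eq, map_smul, act_L_zero_single, Finsupp.smul_apply, Finsupp.smul_apply,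
      Finsupp.smul_apply, smul_eq_mul, smul_eq_mul, smul_eq_mul]
    by_cases h : l = k
    · subst h; ring
    · rw [Finsupp.single_eq_of_ne (Ne.symm h)]; ring

theorem iSup_eigenspace_eq_top (a b c : ℂ) :
    ⨆ μ, Module.End.eigenspace (act a b c (Ramond.L 0)) μ = ⊤ := by
  refine eq_top_iff.2 fun w _ => ?_
  induction w using Finsupp.induction_linear with
  | zero => exact Submodule.zero_mem _
  | add x y hx hy => exact Submodule.add_mem _ (hx trivial) (hy trivial)
  | single k t =>
    rw [single_smul_eq]
    exact Submodule.smul_mem _ _ (Submodule.mem_iSup_of_mem _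
      (Module.End.mem_eigenspace_iff.2 (act_L_zero_single a b c k)))

/-- Different integers `i` give different weights `a + i`, so a weight vector is supported in one
degree. -/
theorem eq_of_act_L_zero {a b c μ : ℂ} {w : RSpace} (hw0 : w ≠ 0)
    (hw : act a b c (Ramond.L 0) w = μ • w) :
    ∃ i, w = w (.v i) • v i + w (.vp i) • vp i + w (.vm i) • vm i + w (.vpm i) • vpm i := by
  obtain ⟨k, hk⟩ := Finsupp.ne_iff.1 hw0
  have h : ∀ l, w l ≠ 0 → a + degree l = μ := fun l hl => by
    have := act_L_zero_apply a b c w l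
    rw [hw, Finsupp.smul_apply, smul_eq_mul] at this
    exact (mul_right_cancel₀ hl this).symm
  have h0 : ∀ l, degree l ≠ degree k → w l = 0 := fun l hl => by
    by_contra hne
    exact hl (by exact_mod_cast add_left_cancel ((h l hne).trans (h k hk).symm))
  refine ⟨degree k, Finsupp.ext fun l => ?_⟩
  have h1 : ∀ j, j ≠ degree k → w (.v j) = 0 ∧ w (.vp j) = 0 ∧ w (.vm j) = 0 ∧ w (.vpm j) = 0 :=
    fun j hj => ⟨h0 _ hj, h0 _ hj, h0 _ hj, h0 _ hj⟩
  generalize degree k = i at h1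
  cases l with
  | _ j =>
    by_cases hj : j = i
    · subst hj; simp [v, vp, vm, vpm]
    · simp [v, vp, vm, vpm, h1 j hj, Ne.symm hj]

/-- Each of the two affine functions vanishes at most at one of `0, 1, 2`. -/
theorem exists_int_affine_ne_zero {s t : ℂ} (hs : s ≠ 0) (ht : t ≠ 0) (p q : ℂ) :
    ∃ j : ℤ, s * j + p ≠ 0 ∧ t * j + q ≠ 0 := by
  by_contra! h
  have h0 := h 0
  have h1 := h 1
  have h2 := h 2
  push_cast at h0 h1 h2
  have e1 : ∀ {x y : ℂ}, s * x + p = 0 → s * y + p = 0 → x = y := fun hx hy =>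
    mul_left_cancel₀ hs (by linear_combination hx - hy)
  have e2 : ∀ {x y : ℂ}, t * x + q = 0 → t * y + q = 0 → x = y := fun hx hy =>
    mul_left_cancel₀ ht (by linear_combination hx - hy)
  by_cases a0 : s * 0 + p = 0
  · have a1 : s * 1 + p ≠ 0 := fun a1 => zero_ne_one (e1 a0 a1)
    have a2 : s * 2 + p ≠ 0 := fun a2 => two_ne_zero (e1 a2 a0)
    exact absurd (e2 (h1 a1) (h2 a2)) (by norm_num)
  · by_cases a1 : s * 1 + p = 0
    · have a2 : s * 2 + p ≠ 0 := fun a2 => absurd (e1 a1 a2) (by norm_num)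
      exact absurd (e2 (h0 a0) (h2 a2)) (by norm_num)
    · exact absurd (e2 (h0 a0) (h1 a1)) (by norm_num)

instance : Nontrivial RSpace := ⟨⟨v 0, 0, by simp [v]⟩⟩

section Simple

variable {a b c : ℂ} {N : Submodule ℂ RSpace}
  (hN : ∀ x, ∀ w ∈ N, act a b c x w ∈ N)

include hN

theorem eq_top_of_v_mem (h : ∀ n, v n ∈ N) : N = ⊤ := by
  have hm : ∀ n, vm n ∈ N := fun n => by
    have := hN (Ramond.Gm 0) _ (h n)
    rwa [act_Gm_v, zero_add] at this
  refine eq_top_iff.2 fun w _ => ?_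
  induction w using Finsupp.induction_linear with
  | zero => exact N.zero_mem
  | add x y hx hy => exact N.add_mem (hx trivial) (hy trivial)
  | single k t =>
    rw [single_smul_eq]
    refine N.smul_mem _ ?_
    cases k with
    | v i => exact h i
    | vp i =>
      have := hN (Ramond.Gp 0) _ (h i)
      rwa [act_Gp_v, zero_add] at this
    | vm i => exact hm i
    | vpm i =>
      have := hN (Ramond.Gp 0) _ (hm i)
      rwa [act_Gp_vm, zero_add, Int.cast_zero, mul_zero, zero_smul, add_zero] at this

/-- An intermediate series family generates itself when `b ∉ {0, 1}`. -/
theorem family_mem {y : ℤ → RSpace} {s : ℂ} (hs : s ≠ 0) (hs' : 1 - s ≠ 0)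
    (hy : ∀ m i, act a b c (Ramond.L m) (y i) = (a + i + s * m) • y (m + i)) {i : ℤ}
    (h : y i ∈ N) (n : ℤ) : y n ∈ N := by
  -- A single `L_{n-i}` may have coefficient zero, so the route passes through an intermediate `j`.
  -- The coefficients of the two steps are affine in `j` with slopes `s` and `1 - s`.
  obtain ⟨j, h1, h2⟩ := exists_int_affine_ne_zero hs hs' (a + i - s * i) (a + s * n)
  have h3 : y j ∈ N := by
    have := hN (Ramond.L (j - i)) _ h
    rw [hy, sub_add_cancel] at this
    refine (N.smul_mem_iff fun h0 => h1 ?_).1 this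
    rw [← h0]; push_cast; ring
  have := hN (Ramond.L (n - j)) _ h3
  rw [hy, sub_add_cancel] at this
  refine (N.smul_mem_iff fun h0 => h2 ?_).1 this
  rw [← h0]; push_cast; ring

/-- One `v^+` yields all of them: through `H` if `c ≠ -1`, and through `L` if `c = -1`, where the
bad values `b = 1/2` and `b = 3/2` are exactly those excluded by `h2` and `h1`. Two ways of reaching
degree `n` with `G^-` then differ by `(2b + c - 2) v_n`. -/
theorem eq_top_of_vp_mem (h1 : 2 * b + c ≠ 2) (h2 : 2 * b - c ≠ 2) {i : ℤ} (hi : vp i ∈ N) :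
    N = ⊤ := by
  have hall : ∀ n, vp n ∈ N := by
    by_cases hc : c + 1 = 0
    · exact family_mem hN (s := b - 1 / 2) (fun h => h2 (by linear_combination 2 * h - hc))
        (fun h => h1 (by linear_combination -2 * h + hc)) (act_L_vp a b c) hi
    · intro n
      have := hN (Ramond.H (n - i)) _ hi
      rw [act_H_vp, sub_add_cancel] at this
      exact (N.smul_mem_iff hc).1 this
  refine eq_top_of_v_mem hN fun n => ?_
  have e0 := hN (Ramond.Gm 0) _ (hall n)
  have e1 := hN (Ramond.Gm 1) _ (hall (n - 1))
  rw [act_Gm_vp, zero_add] at e0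
  rw [act_Gm_vp, add_sub_cancel] at e1
  refine (N.smul_mem_iff (s := 2 * b + c - 2) (sub_ne_zero.2 h1)).1 ?_
  convert N.sub_mem e0 e1 using 1
  push_cast
  module

theorem eq_top_of_vm_mem (h1 : 2 * b + c ≠ 2) (h2 : 2 * b - c ≠ 2) {i : ℤ} (hi : vm i ∈ N) :
    N = ⊤ := by
  have hall : ∀ n, vm n ∈ N := by
    by_cases hc : c - 1 = 0
    · exact family_mem hN (s := b - 1 / 2) (fun h => h1 (by linear_combination 2 * h + hc))
        (fun h => h2 (by linear_combination -2 * h - hc)) (act_L_vm a b c) hi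
    · intro n
      have := hN (Ramond.H (n - i)) _ hi
      rw [act_H_vm, sub_add_cancel] at this
      exact (N.smul_mem_iff hc).1 this
  refine eq_top_of_v_mem hN fun n => ?_
  have e0 := hN (Ramond.Gp 0) _ (hall n)
  have e1 := hN (Ramond.Gp 1) _ (hall (n - 1))
  rw [act_Gp_vm, zero_add] at e0
  rw [act_Gp_vm, add_sub_cancel] at e1
  refine (N.smul_mem_iff (s := 2 * b - c - 2) (sub_ne_zero.2 h2)).1 ?_
  convert N.sub_mem e0 e1 using 1
  push_cast
  module

/-- `H_0 - c` annihilates the even basis vectors and acts by `1` on `v^+` and by `-1` on `v^-`, so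
it separates the components of a weight vector. No grading of `N` is required, so the result applies
directly to kernels. -/
theorem eq_bot_or_eq_top (h1 : 2 * b + c ≠ 2) (h2 : 2 * b - c ≠ 2) : N = ⊥ ∨ N = ⊤ := by
  refine or_iff_not_imp_left.2 fun hbot => ?_
  obtain ⟨μ, w, hw, hw0, hμ⟩ :=
    Submodule.exists_eigenvector_mem (iSup_eigenspace_eq_top a b c) (hN _) hbot
  obtain ⟨i, hi⟩ := eq_of_act_L_zero hw0 hμ
  generalize w (.v i) = α at hi
  generalize w (.vp i) = β at hi
  generalize w (.vm i) = γ at hi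
  generalize w (.vpm i) = δ at hi
  have e1 : β • vp i - γ • vm i ∈ N := by
    convert N.sub_mem (hN (Ramond.H 0) _ hw) (N.smul_mem c hw) using 1
    rw [hi]
    simp only [map_add, map_smul, act_H_v, act_H_vp, act_H_vm, act_H_vpm, zero_add, Int.cast_zero,
      zero_mul, zero_smul, sub_zero]
    module
  have e2 : β • vp i + γ • vm i ∈ N := by
    convert N.sub_mem (hN (Ramond.H 0) _ e1) (N.smul_mem c e1) using 1
    simp only [map_sub, map_smul, act_H_vp, act_H_vm, zero_add]
    module
  by_cases hβ : β = 0
  · by_cases hγ : γ = 0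
    · subst hβ hγ
      rw [zero_smul, zero_smul, add_zero, add_zero] at hi
      have e3 : ∀ r : ℤ, (α + δ * ((2 * b - c - 2) * r)) • vp (r + i) ∈ N := fun r => by
        convert hN (Ramond.Gp r) _ hw using 1
        rw [hi, map_add, map_smul, map_smul, act_Gp_v, act_Gp_vpm]
        module
      by_cases hα : α = 0
      · have hδ : δ ≠ 0 := fun hδ => hw0 (by rw [hi, hα, hδ]; simp)
        refine eq_top_of_vp_mem hN h1 h2 ((N.smul_mem_iff ?_).1 (e3 1))
        rw [hα, zero_add, Int.cast_one, mul_one]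
        exact mul_ne_zero hδ (sub_ne_zero.2 h2)
      · refine eq_top_of_vp_mem hN h1 h2 ((N.smul_mem_iff ?_).1 (e3 0))
        simpa using hα
    · refine eq_top_of_vm_mem hN h1 h2 (i := i) ((N.smul_mem_iff (s := 2 * γ) (by simpa using hγ)).1 ?_)
      convert N.sub_mem e2 e1 using 1
      module
  · refine eq_top_of_vp_mem hN h1 h2 (i := i) ((N.smul_mem_iff (s := 2 * β) (by simpa using hβ)).1 ?_)
    convert N.add_mem e2 e1 using 1
    module

end Simple

/-- The span of the `v_i^{+-}` and `v_i^-`. -/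
noncomputable def minusPart : Submodule ℂ RSpace := Submodule.span ℂ (Set.range vpm ∪ Set.range vm)

/-- The span of the `v_i^{+-} + 2 (a + i) v_i` and `v_i^+`. -/
noncomputable def plusPart (a : ℂ) : Submodule ℂ RSpace :=
  Submodule.span ℂ (Set.range (fun i : ℤ => vpm i + (2 * a + 2 * i) • v i) ∪ Set.range vp)

theorem vpm_mem_minusPart (i : ℤ) : vpm i ∈ minusPart := Submodule.subset_span (.inl ⟨i, rfl⟩)

theorem vm_mem_minusPart (i : ℤ) : vm i ∈ minusPart := Submodule.subset_span (.inr ⟨i, rfl⟩)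

theorem mem_plusPart (a : ℂ) (i : ℤ) : vpm i + (2 * a + 2 * i) • v i ∈ plusPart a :=
  Submodule.subset_span (.inl ⟨i, rfl⟩)

theorem vp_mem_plusPart (a : ℂ) (i : ℤ) : vp i ∈ plusPart a := Submodule.subset_span (.inr ⟨i, rfl⟩)

theorem act_mem_span {a b c : ℂ} {s : Set RSpace}
    (h : ∀ i, ∀ w ∈ s, act a b c (Finsupp.single i 1) w ∈ Submodule.span ℂ s) (x : Ramond)
    {w : RSpace} (hw : w ∈ Submodule.span ℂ s) : act a b c x w ∈ Submodule.span ℂ s := by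
  refine (SuperModule.act_mem_of_basis (M := RModule a b c) (fun i w hw => ?_) x hw)
  exact (Submodule.span_le (p := (Submodule.span ℂ s).comap (act a b c (Finsupp.single i 1)))).2
    (h i) hw

/-- Every coefficient leading from `v^{+-}` or `v^-` to `v` or `v^+` contains the factor `2b - c -
2`, up to sign. -/
theorem minusPart_stable {a b c : ℂ} (h : 2 * b - c = 2) (x : Ramond) {w : RSpace}
    (hw : w ∈ minusPart) : act a b c x w ∈ minusPart := by
  refine act_mem_span (fun i w hw => ?_) x hw
  change _ ∈ minusPart
  have hK : 2 * b - c - 2 = 0 := sub_eq_zero.2 h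
  have hK' : c + 2 - 2 * b = 0 := by linear_combination -hK
  obtain ⟨k, rfl⟩ | ⟨k, rfl⟩ := hw
  · rcases i with m | m | m | m | _
    · change act a b c (Ramond.L m) _ ∈ _
      rw [act_L_vpm, hK, mul_zero, zero_mul, zero_smul, add_zero]
      exact Submodule.smul_mem _ _ (vpm_mem_minusPart _)
    · change act a b c (Ramond.H m) _ ∈ _
      rw [act_H_vpm, hK, mul_zero, zero_smul, sub_zero]
      exact Submodule.smul_mem _ _ (vpm_mem_minusPart _)
    · change act a b c (Ramond.Gp m) _ ∈ _
      rw [act_Gp_vpm, hK, zero_mul, zero_smul]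
      exact Submodule.zero_mem _
    · change act a b c (Ramond.Gm m) _ ∈ _
      rw [act_Gm_vpm]
      exact Submodule.smul_mem _ _ (vm_mem_minusPart _)
    · change act a b c Ramond.C _ ∈ _
      rw [act_C]
      exact Submodule.zero_mem _
  · rcases i with m | m | m | m | _
    · change act a b c (Ramond.L m) _ ∈ _
      rw [act_L_vm]
      exact Submodule.smul_mem _ _ (vm_mem_minusPart _)
    · change act a b c (Ramond.H m) _ ∈ _
      rw [act_H_vm]
      exact Submodule.smul_mem _ _ (vm_mem_minusPart _)
    · change act a b c (Ramond.Gp m) _ ∈ _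
      rw [act_Gp_vm, hK', zero_mul, zero_smul, add_zero]
      exact vpm_mem_minusPart _
    · change act a b c (Ramond.Gm m) _ ∈ _
      rw [act_Gm_vm]
      exact Submodule.zero_mem _
    · change act a b c Ramond.C _ ∈ _
      rw [act_C]
      exact Submodule.zero_mem _

/-- The even generators are `-G_0^- v_i^+`. When `2b + c = 2`, `G_m^- v_k^+` depends only on `m +
k`, so the other modes of `G^-` produce no further vectors. -/
theorem plusPart_stable {a b c : ℂ} (h : 2 * b + c = 2) (x : Ramond) {w : RSpace}
    (hw : w ∈ plusPart a) : act a b c x w ∈ plusPart a := by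
  refine act_mem_span (fun i w hw => ?_) x hw
  change _ ∈ plusPart a
  obtain rfl : c = 2 - 2 * b := by linear_combination h
  obtain ⟨k, rfl⟩ | ⟨k, rfl⟩ := hw
  · rcases i with m | m | m | m | _
    · change act a b _ (Ramond.L m) _ ∈ _
      convert Submodule.smul_mem _ (a + k + (b - 1) * m) (mem_plusPart a (m + k)) using 1
      simp only [map_add, map_smul, act_L_vpm, act_L_v]
      push_cast
      module
    · change act a b _ (Ramond.H m) _ ∈ _
      convert Submodule.smul_mem _ (2 - 2 * b) (mem_plusPart a (m + k)) using 1
      simp only [map_add, map_smul, act_H_vpm, act_H_v]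
      push_cast
      module
    · change act a b _ (Ramond.Gp m) _ ∈ _
      simp only [map_add, map_smul, act_Gp_vpm, act_Gp_v]
      exact Submodule.add_mem _ (Submodule.smul_mem _ _ (vp_mem_plusPart _ _))
        (Submodule.smul_mem _ _ (vp_mem_plusPart _ _))
    · change act a b _ (Ramond.Gm m) _ ∈ _
      convert Submodule.zero_mem _ using 1
      simp only [map_add, map_smul, act_Gm_vpm, act_Gm_v]
      module
    · change act a b _ Ramond.C _ ∈ _
      rw [act_C]
      exact Submodule.zero_mem _
  · rcases i with m | m | m | m | _
    · change act a b _ (Ramond.L m) _ ∈ _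
      rw [act_L_vp]
      exact Submodule.smul_mem _ _ (vp_mem_plusPart _ _)
    · change act a b _ (Ramond.H m) _ ∈ _
      rw [act_H_vp]
      exact Submodule.smul_mem _ _ (vp_mem_plusPart _ _)
    · change act a b _ (Ramond.Gp m) _ ∈ _
      rw [act_Gp_vp]
      exact Submodule.zero_mem _
    · change act a b _ (Ramond.Gm m) _ ∈ _
      convert Submodule.neg_mem _ (mem_plusPart a (m + k)) using 1
      rw [act_Gm_vp]
      push_cast
      module
    · change act a b _ Ramond.C _ ∈ _
      rw [act_C]
      exact Submodule.zero_mem _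

theorem span_graded {s : Set RSpace} (hs : ∀ w ∈ s, ∃ σ, w ∈ part σ) :
    Submodule.span ℂ s = (Submodule.span ℂ s ⊓ part 0) ⊔ (Submodule.span ℂ s ⊓ part 1) :=
  -- Only the grading enters, and it is the same for all parameters.
  RamondRep.span_graded (A := (RModule 0 0 0).toRamondRep (act_C 0 0 0)) hs

theorem minusPart_graded : minusPart = (minusPart ⊓ part 0) ⊔ (minusPart ⊓ part 1) := by
  refine span_graded fun w hw => ?_
  obtain ⟨k, rfl⟩ | ⟨k, rfl⟩ := hw
  exacts [⟨0, vpm_mem k⟩, ⟨1, vm_mem k⟩]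

theorem plusPart_graded (a : ℂ) :
    plusPart a = (plusPart a ⊓ part 0) ⊔ (plusPart a ⊓ part 1) := by
  refine span_graded fun w hw => ?_
  obtain ⟨k, rfl⟩ | ⟨k, rfl⟩ := hw
  exacts [⟨0, Submodule.add_mem _ (vpm_mem k) (Submodule.smul_mem _ _ (v_mem k))⟩, ⟨1, vp_mem k⟩]

theorem minusPart_ne_bot : minusPart ≠ ⊥ := fun h => by
  have := h.le (vm_mem_minusPart 0)
  simp [vm] at this

theorem plusPart_ne_bot (a : ℂ) : plusPart a ≠ ⊥ := fun h => by
  have := h.le (vp_mem_plusPart a 0)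
  simp [vp] at this

theorem minusPart_ne_top : minusPart ≠ ⊤ := fun h => by
  have hle : minusPart ≤ LinearMap.ker (Finsupp.lapply (R := ℂ) (RModIndex.v 0)) := by
    refine Submodule.span_le.2 fun w hw => ?_
    obtain ⟨k, rfl⟩ | ⟨k, rfl⟩ := hw <;> simp [vpm, vm]
  have := hle (h.ge (Submodule.mem_top (x := v 0)))
  simp [v] at this

theorem plusPart_ne_top (a : ℂ) : plusPart a ≠ ⊤ := fun h => by
  -- The functional that compares the coefficient of `v_0` with `2a` times that of `v_0^{+-}` kills
  -- all generators but not `v_0`.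
  have hle : plusPart a ≤ LinearMap.ker (Finsupp.lapply (R := ℂ) (RModIndex.v 0) -
      (2 * a) • Finsupp.lapply (R := ℂ) (RModIndex.vpm 0)) := by
    refine Submodule.span_le.2 fun w hw => ?_
    obtain ⟨k, rfl⟩ | ⟨k, rfl⟩ := hw
    · by_cases hk : k = 0
      · subst hk; simp [vpm, v]
      · simp [vpm, v, hk]
    · simp [vp]
  have := hle (h.ge (Submodule.mem_top (x := v 0)))
  simp [v] at this

end RSpace

theorem RModule.isSimple_iff (a b c : ℂ) :
    (RModule a b c).IsSimple ↔ 2 * b + c ≠ 2 ∧ 2 * b - c ≠ 2 := by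
  refine ⟨fun h => ⟨fun h1 => ?_, fun h1 => ?_⟩, fun h =>
    ⟨inferInstance, fun N hN => RSpace.eq_bot_or_eq_top hN.1 h.1 h.2⟩⟩
  · exact (h.2 (RSpace.plusPart a) ⟨fun x w hw => RSpace.plusPart_stable h1 x hw,
      RSpace.plusPart_graded a⟩).elim (RSpace.plusPart_ne_bot a) (RSpace.plusPart_ne_top a)
  · exact (h.2 RSpace.minusPart ⟨fun x w hw => RSpace.minusPart_stable h1 x hw,
      RSpace.minusPart_graded⟩).elim RSpace.minusPart_ne_bot RSpace.minusPart_ne_top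

/-! ### The relations of `R_{a,b,c}` forced by flatness. -/

theorem eq_zero_of_add_self_eq_zero {V : Type*} [AddCommGroup V] [Module ℂ V] {v : V}
    (h : v + v = 0) : v = 0 :=
  (smul_eq_zero.1 ((two_smul ℂ v).trans h)).resolve_left two_ne_zero

theorem ZMod.ne_add_one_self (σ : ZMod 2) : σ ≠ σ + 1 := by revert σ; decide

theorem ZMod.eq_add_one_of_ne {σ ρ : ZMod 2} (h : ρ ≠ σ) : ρ = σ + 1 := by revert σ ρ; decide

namespace RamondRep.Flat

variable {V : Type*} [AddCommGroup V] [Module ℂ V] {A : RamondRep V} {τ : ZMod 2} {a b c : ℂ}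
  {x : ℤ → V} (h : A.Flat τ a b c x) (m k : ℤ)

include h

/-- Flatness allows `P_0 x_k` to be written as `P_m x_{k-m}`, and `P_m² = 0`. -/
theorem P_P : A.P m (A.P 0 (x k)) = 0 := by
  have h1 := h.P_apply m (k - m)
  rw [add_sub_cancel] at h1
  exact eq_zero_of_add_self_eq_zero (h1 ▸ A.anti_P m m (x (k - m)))

theorem Q_Q : A.Q m (A.Q 0 (x k)) = 0 := by
  have h1 := h.Q_apply m (k - m)
  rw [add_sub_cancel] at h1
  exact eq_zero_of_add_self_eq_zero (h1 ▸ A.anti_Q m m (x (k - m)))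

theorem L_P : A.L m (A.P 0 (x k)) = (a + k + (b - 1 / 2) * m) • A.P 0 (x (m + k)) := by
  rw [sub_eq_iff_eq_add.1 (A.lie_L_P m 0 (x k)), h.L_apply, map_smul, add_zero, h.P_apply]
  push_cast
  module

theorem L_Q : A.L m (A.Q 0 (x k)) = (a + k + (b - 1 / 2) * m) • A.Q 0 (x (m + k)) := by
  rw [sub_eq_iff_eq_add.1 (A.lie_L_Q m 0 (x k)), h.L_apply, map_smul, add_zero, h.Q_apply]
  push_cast
  module

theorem H_P : A.H m (A.P 0 (x k)) = (c + 1) • A.P 0 (x (m + k)) := by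
  rw [sub_eq_iff_eq_add.1 (A.lie_H_P m 0 (x k)), h.H_apply, map_smul, add_zero, h.P_apply]
  module

theorem H_Q : A.H m (A.Q 0 (x k)) = (c - 1) • A.Q 0 (x (m + k)) := by
  rw [sub_eq_iff_eq_add.1 (A.lie_H_Q m 0 (x k)), h.H_apply, map_smul, add_zero, h.Q_apply]
  module

theorem Q_P : A.Q m (A.P 0 (x k)) =
    -A.P 0 (A.Q 0 (x (m + k))) - (2 * a + 2 * k + (2 * b + c) * m) • x (m + k) := by
  have := A.anti_P_Q 0 m (x k)
  rw [← eq_sub_iff_add_eq'] at this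
  rw [this, h.Q_apply, zero_add, h.L_apply, h.H_apply]
  push_cast
  module

theorem P_Q : A.P m (A.Q 0 (x k)) =
    A.P 0 (A.Q 0 (x (m + k))) + ((c + 2 - 2 * b) * m) • x (m + k) := by
  have h1 := h.Q_P 0 (m + k)
  rw [zero_add] at h1
  rw [eq_sub_of_add_eq (A.anti_P_Q m 0 (x k)), h.P_apply, h1, add_zero, h.L_apply, h.H_apply]
  push_cast
  module

theorem L_P_Q : A.L m (A.P 0 (A.Q 0 (x k))) =
    (a + k + (b - 1) * m) • A.P 0 (A.Q 0 (x (m + k))) +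
      (1 / 2 * (2 * b - c - 2) * (m : ℂ) ^ 2) • x (m + k) := by
  rw [sub_eq_iff_eq_add.1 (A.lie_L_P m 0 _), h.L_Q, map_smul, add_zero, h.P_Q]
  push_cast
  module

theorem H_P_Q : A.H m (A.P 0 (A.Q 0 (x k))) =
    c • A.P 0 (A.Q 0 (x (m + k))) - ((m : ℂ) * (2 * b - c - 2)) • x (m + k) := by
  rw [sub_eq_iff_eq_add.1 (A.lie_H_P m 0 _), h.H_Q, map_smul, add_zero, h.P_Q]
  module

theorem P_P_Q : A.P m (A.P 0 (A.Q 0 (x k))) = ((2 * b - c - 2) * m) • A.P 0 (x (m + k)) := by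
  rw [eq_neg_of_add_eq_zero_left (A.anti_P m 0 _), h.P_Q, map_add, map_smul]
  have h1 : A.P 0 (A.P 0 (A.Q 0 (x (m + k)))) = 0 :=
    eq_zero_of_add_self_eq_zero (A.anti_P 0 0 _)
  rw [h1]
  module

theorem Q_P_Q : A.Q m (A.P 0 (A.Q 0 (x k))) =
    -(2 * a + 2 * k + (2 * b + c - 2) * m) • A.Q 0 (x (m + k)) := by
  have := A.anti_P_Q 0 m (A.Q 0 (x k))
  rw [← eq_sub_iff_add_eq'] at this
  rw [this, h.Q_Q, map_zero, zero_add, h.L_Q, h.H_Q]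
  push_cast
  module

end RamondRep.Flat

/-! ### Criteria for length one. -/

/-- If a space is spanned by homogeneous eigenvectors with distinct weights and parities, then
the homogeneous parts of the eigenspaces are at most one-dimensional. -/
theorem rank_eigenspace_inf_le_one {V : Type*} [AddCommGroup V] [Module ℂ V]
    {part : ZMod 2 → Submodule ℂ V} (hc : IsCompl (part 0) (part 1)) {f : Module.End ℂ V}
    {ι : Type*} {y : ι → V} {wt : ι → ℂ} {pr : ι → ZMod 2}
    (hinj : ∀ k l, wt k = wt l → pr k = pr l → k = l) (hy : ∀ k, y k ∈ part (pr k))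
    (hf : ∀ k, f (y k) = wt k • y k) (hspan : Submodule.span ℂ (Set.range y) = ⊤) (μ : ℂ)
    (σ : ZMod 2) : Module.rank ℂ (f.eigenspace μ ⊓ part σ : Submodule ℂ V) ≤ 1 := by
  -- `S` collects the spanning vectors of weight `μ` and parity `σ`, of which there is at most one;
  -- `T` and `U` absorb the other parity and the other weights. Independence of weights and parities
  -- leaves only `S`.
  set S := Submodule.span ℂ (y '' {k | wt k = μ ∧ pr k = σ}) with hS
  set T := f.eigenspace μ ⊓ part (σ + 1)
  set U := ⨆ ν, ⨆ (_ : ν ≠ μ), f.eigenspace ν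
  have hdisj : Disjoint (part σ) (part (σ + 1)) := by
    rcases RamondRep.part_cases σ with rfl | rfl
    exacts [hc.disjoint, hc.disjoint.symm]
  have hSle : S ≤ f.eigenspace μ ⊓ part σ := by
    refine Submodule.span_le.2 ?_
    rintro _ ⟨k, ⟨h1, h2⟩, rfl⟩
    exact ⟨Module.End.mem_eigenspace_iff.2 (h1 ▸ hf k), h2 ▸ hy k⟩
  have htop : S ⊔ T ⊔ U = ⊤ := by
    refine top_le_iff.1 (hspan ▸ Submodule.span_le.2 ?_)
    rintro _ ⟨k, rfl⟩
    by_cases h1 : wt k = μ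
    · refine Submodule.mem_sup_left ?_
      by_cases h2 : pr k = σ
      · exact Submodule.mem_sup_left (Submodule.subset_span ⟨k, ⟨h1, h2⟩, rfl⟩)
      · exact Submodule.mem_sup_right ⟨Module.End.mem_eigenspace_iff.2 (h1 ▸ hf k),
          ZMod.eq_add_one_of_ne h2 ▸ hy k⟩
    · exact Submodule.mem_sup_right (Submodule.mem_iSup_of_mem _ (Submodule.mem_iSup_of_mem h1
        (Module.End.mem_eigenspace_iff.2 (hf k))))
  have hle : f.eigenspace μ ⊓ part σ ≤ S := fun w hw => by
    obtain ⟨p, hp, u, hu, rfl⟩ := Submodule.mem_sup.1 (htop.ge (Submodule.mem_top (x := w)))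
    obtain ⟨s, hs, t, ht, rfl⟩ := Submodule.mem_sup.1 hp
    have hu0 : u = 0 := by
      refine Submodule.disjoint_def.1 (f.eigenspaces_iSupIndep μ) u ?_ hu
      have := Submodule.sub_mem _ hw.1 (Submodule.add_mem _ (hSle hs).1 ht.1)
      rwa [add_sub_cancel_left] at this
    subst hu0
    rw [add_zero] at hw ⊢
    have ht0 : t = 0 := by
      refine Submodule.disjoint_def.1 hdisj t ?_ ht.2
      have := Submodule.sub_mem _ hw.2 (hSle hs).2
      rwa [add_sub_cancel_left] at this
    rwa [ht0, add_zero]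
  refine (Submodule.rank_mono hle).trans ((rank_span_le _).trans ?_)
  rw [Cardinal.le_one_iff_subsingleton, Set.subsingleton_coe]
  refine Set.Subsingleton.image ?_ _
  exact fun k hk l hl => hinj k l (hk.1.trans hl.1.symm) (hk.2.trans hl.2.symm)

namespace SuperModule

variable {V : Type*} [AddCommGroup V] [Module ℂ V] {M : SuperModule Ramond V}

/-- A module spanned by one family of each parity, with one vector for each weight in
`a + ℤ`, has length at most one. -/
theorem isDimBound_one {a : ℂ} {τ : ZMod 2} {y z : ℤ → V} (hy : ∀ i, y i ∈ M.part τ)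
    (hz : ∀ i, z i ∈ M.part (τ + 1)) (hLy : ∀ i, M.act (Ramond.L 0) (y i) = (a + i) • y i)
    (hLz : ∀ i, M.act (Ramond.L 0) (z i) = (a + i) • z i)
    (hspan : Submodule.span ℂ (Set.range y ∪ Set.range z) = ⊤) : M.IsDimBound 1 := by
  refine ⟨one_pos, fun μ σ => ?_⟩
  rw [Nat.cast_one]
  refine rank_eigenspace_inf_le_one (y := Sum.elim y z)
    (wt := Sum.elim (fun i : ℤ => a + i) (fun i : ℤ => a + i))
    (pr := Sum.elim (fun _ => τ) (fun _ => τ + 1)) M.isCompl ?_ ?_ ?_ ?_ μ σ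
  · have hτ := ZMod.ne_add_one_self τ
    rintro (k | k) (l | l) h1 h2
    · simpa using h1
    · exact absurd h2 hτ
    · exact absurd h2.symm hτ
    · simpa using h1
  · rintro (k | k)
    exacts [hy k, hz k]
  · rintro (k | k)
    exacts [hLy k, hLz k]
  · rwa [Set.Sum.elim_range]

end SuperModule

/-! ### The map from `R_{a,b,c}` to a simple module with a flat family. -/

namespace RamondRep

variable {V : Type*} [AddCommGroup V] [Module ℂ V]

/-- The images of the basis vectors of `R_{a,b,c}` determined by a family `x`. -/
noncomputable def familyBasis (A : RamondRep V) (x : ℤ → V) : RModIndex → V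
  | .v i => x i
  | .vp i => A.P 0 (x i)
  | .vm i => A.Q 0 (x i)
  | .vpm i => A.P 0 (A.Q 0 (x i))

/-- The linear map from `R_{a,b,c}` determined by a family `x`. -/
noncomputable def familyMap (A : RamondRep V) (x : ℤ → V) : RSpace →ₗ[ℂ] V :=
  Finsupp.linearCombination ℂ (A.familyBasis x)

variable (A : RamondRep V) (x : ℤ → V)

theorem familyMap_single (k : RModIndex) :
    A.familyMap x (Finsupp.single k 1) = A.familyBasis x k := by
  simp [familyMap]

theorem familyMap_v (i : ℤ) : A.familyMap x (RSpace.v i) = x i := A.familyMap_single x (.v i)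

theorem familyMap_vp (i : ℤ) : A.familyMap x (RSpace.vp i) = A.P 0 (x i) :=
  A.familyMap_single x (.vp i)

theorem familyMap_vm (i : ℤ) : A.familyMap x (RSpace.vm i) = A.Q 0 (x i) :=
  A.familyMap_single x (.vm i)

theorem familyMap_vpm (i : ℤ) : A.familyMap x (RSpace.vpm i) = A.P 0 (A.Q 0 (x i)) :=
  A.familyMap_single x (.vpm i)

end RamondRep

namespace SuperModule

variable {V : Type*} [AddCommGroup V] [Module ℂ V] {M : SuperModule Ramond V}
  {hC : ∀ v, M.act Ramond.C v = 0} {τ : ZMod 2} {a b c : ℂ} {x : ℤ → V}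

theorem familyMap_act_single (h : (M.toRamondRep hC).Flat τ a b c x) (i : RamondIndex)
    (k : RModIndex) : M.act (Finsupp.single i 1) ((M.toRamondRep hC).familyMap x
      (Finsupp.single k 1)) = (M.toRamondRep hC).familyMap x
        (RSpace.act a b c (Finsupp.single i 1) (Finsupp.single k 1)) := by
  rw [RSpace.act_single]
  cases i with
  | C =>
    refine (hC _).trans ?_
    cases k <;> simp [RSpace.actBasis]
  | L m =>
    cases k <;> simp only [RamondRep.familyMap_single, RSpace.actBasis, map_add, map_smul,
      RamondRep.familyMap_v, RamondRep.familyMap_vp, RamondRep.familyMap_vm,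
      RamondRep.familyMap_vpm]
    exacts [h.L_apply .., h.L_P .., h.L_Q .., h.L_P_Q ..]
  | H m =>
    cases k <;> simp only [RamondRep.familyMap_single, RSpace.actBasis, map_sub, map_smul,
      RamondRep.familyMap_v, RamondRep.familyMap_vp, RamondRep.familyMap_vm,
      RamondRep.familyMap_vpm]
    exacts [h.H_apply .., h.H_P .., h.H_Q .., h.H_P_Q ..]
  | Gp m =>
    cases k <;> simp only [RamondRep.familyMap_single, RSpace.actBasis, map_add, map_smul,
      map_zero, RamondRep.familyMap_v, RamondRep.familyMap_vp,
      RamondRep.familyMap_vpm]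
    exacts [h.P_apply .., h.P_P .., h.P_Q .., h.P_P_Q ..]
  | Gm m =>
    cases k <;> simp only [RamondRep.familyMap_single, RSpace.actBasis, map_sub, map_neg, map_smul,
      map_zero, RamondRep.familyMap_v, RamondRep.familyMap_vm,
      RamondRep.familyMap_vpm]
    exacts [h.Q_apply .., h.Q_P .., h.Q_Q .., h.Q_P_Q ..]

theorem familyMap_act (h : (M.toRamondRep hC).Flat τ a b c x) (g : Ramond) (w : RSpace) :
    M.act g ((M.toRamondRep hC).familyMap x w) =
      (M.toRamondRep hC).familyMap x ((RModule a b c).act g w) := by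
  change _ = (M.toRamondRep hC).familyMap x (RSpace.act a b c g w)
  induction g using Finsupp.induction_linear with
  | zero => simp
  | add g g' hg hg' => simp only [map_add, LinearMap.add_apply, hg, hg']
  | single i t =>
    have hi : Finsupp.single i t = t • Finsupp.single i (1 : ℂ) := by simp
    rw [hi]
    simp only [map_smul, LinearMap.smul_apply]
    congr 1
    induction w using Finsupp.induction_linear with
    | zero => simp
    | add w w' hw hw' => simp only [map_add, hw, hw']
    | single k s =>
      rw [RSpace.single_smul_eq]
      simp only [map_smul, familyMap_act_single h]

theorem familyMap_mem (h : (M.toRamondRep hC).Flat τ a b c x) {σ : ZMod 2} {w : RSpace}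
    (hw : w ∈ RSpace.part σ) : (M.toRamondRep hC).familyMap x w ∈ M.part (σ + τ) := by
  refine RSpace.part_induction
    (p := fun w => (M.toRamondRep hC).familyMap x w ∈ M.part (σ + τ)) ?_ ?_ ?_ ?_ hw
  · rintro k rfl
    rw [RamondRep.familyMap_single]
    cases k with
    | v i => exact (zero_add τ).symm ▸ h.mem i
    | vp i => exact (add_comm τ 1) ▸ (M.toRamondRep hC).P_part 0 (h.mem i)
    | vm i => exact (add_comm τ 1) ▸ (M.toRamondRep hC).Q_part 0 (h.mem i)
    | vpm i =>
      have := (M.toRamondRep hC).P_part 0 ((M.toRamondRep hC).Q_part 0 (h.mem i))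
      rw [add_assoc, show (1 + 1 : ZMod 2) = 0 from rfl, add_comm] at this
      exact this
  · rw [map_zero]; exact Submodule.zero_mem _
  · intro y z hy hz; rw [map_add]; exact Submodule.add_mem _ hy hz
  · intro t y hy; rw [map_smul]; exact Submodule.smul_mem _ _ hy

/-- The image of a graded submodule of `R_{a,b,c}` in a simple module is trivial. -/
theorem IsSimple.map_familyMap (hM : M.IsSimple) (h : (M.toRamondRep hC).Flat τ a b c x)
    {N : Submodule ℂ RSpace} (hN : (RModule a b c).IsSubmodule N) :
    N.map ((M.toRamondRep hC).familyMap x) = ⊥ ∨ N.map ((M.toRamondRep hC).familyMap x) = ⊤ := by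
  refine hM.2 _ ⟨?_, le_antisymm ?_ (sup_le inf_le_left inf_le_left)⟩
  · rintro g _ ⟨w, hw, rfl⟩
    rw [familyMap_act h]
    exact Submodule.mem_map_of_mem (hN.1 g w hw)
  · rintro _ ⟨w, hw, rfl⟩
    obtain ⟨w₀, h₀, w₁, h₁, rfl⟩ := Submodule.mem_sup.1 (hN.2.le hw)
    rw [map_add]
    have e₀ := familyMap_mem h (σ := 0) h₀.2
    have e₁ := familyMap_mem h (σ := 1) h₁.2
    refine Submodule.add_mem _ ?_ ?_
    · rcases RamondRep.part_cases τ with rfl | rfl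
      · exact Submodule.mem_sup_left ⟨Submodule.mem_map_of_mem h₀.1, e₀⟩
      · exact Submodule.mem_sup_right ⟨Submodule.mem_map_of_mem h₀.1, e₀⟩
    · rcases RamondRep.part_cases τ with rfl | rfl
      · exact Submodule.mem_sup_right ⟨Submodule.mem_map_of_mem h₁.1, e₁⟩
      · exact Submodule.mem_sup_left ⟨Submodule.mem_map_of_mem h₁.1, e₁⟩

variable (hM : M.IsSimple) (h : (M.toRamondRep hC).Flat τ a b c x) {n : ℤ} (hn : x n ≠ 0)

include hM h hn

theorem range_familyMap : LinearMap.range ((M.toRamondRep hC).familyMap x) = ⊤ := by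
  rw [LinearMap.range_eq_map]
  refine (hM.map_familyMap h ⟨fun _ _ _ => Submodule.mem_top, ?_⟩).resolve_left fun hbot => hn ?_
  · rw [top_inf_eq, top_inf_eq]
    exact (RModule a b c).isCompl.sup_eq_top.symm
  · rw [← RamondRep.familyMap_v (M.toRamondRep hC) x n]
    exact (Submodule.mem_bot ℂ).1 (hbot.le (Submodule.mem_map_of_mem Submodule.mem_top))

theorem span_family : Submodule.span ℂ (Set.range ((M.toRamondRep hC).familyBasis x)) = ⊤ := by
  rw [← range_familyMap hM h hn, RamondRep.familyMap, Finsupp.range_linearCombination]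

/-- The image of `minusPart` is zero or everything. In the first case the `x_i` and `P_0 x_i` span,
in the second the images of `v_i^{+-}` and `v_i^-`: one family of each parity either way. -/
theorem isDimBound_one_of_minus (h2 : 2 * b - c = 2) : M.IsDimBound 1 := by
  have hN : (RModule a b c).IsSubmodule RSpace.minusPart :=
    ⟨fun g w hw => RSpace.minusPart_stable h2 g hw, RSpace.minusPart_graded⟩
  have hspan := span_family hM h hn
  have hL := h.L_apply 0
  have hLP := h.L_P 0
  have hLQ := h.L_Q 0
  have hLPQ := h.L_P_Q 0
  simp only [Int.cast_zero, mul_zero, add_zero, zero_add, ne_eq, OfNat.ofNat_ne_zero,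
    not_false_eq_true, zero_pow, zero_smul] at hL hLP hLQ hLPQ
  rcases hM.map_familyMap h hN with h0 | h0
  · have hQ : ∀ i, (M.toRamondRep hC).Q 0 (x i) = 0 := fun i => by
      rw [← RamondRep.familyMap_vm]
      exact (Submodule.mem_bot ℂ).1 (h0.le (Submodule.mem_map_of_mem (RSpace.vm_mem_minusPart i)))
    refine isDimBound_one (a := a) (τ := τ) (y := x) (z := fun i => (M.toRamondRep hC).P 0 (x i))
      h.mem (fun i => (M.toRamondRep hC).P_part 0 (h.mem i)) hL hLP
      (top_le_iff.1 (hspan ▸ Submodule.span_le.2 ?_))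
    rintro _ ⟨k, rfl⟩
    cases k with
    | v i => exact Submodule.subset_span (.inl ⟨i, rfl⟩)
    | vp i => exact Submodule.subset_span (.inr ⟨i, rfl⟩)
    | vm i => rw [RamondRep.familyBasis, hQ]; exact Submodule.zero_mem _
    | vpm i => rw [RamondRep.familyBasis, hQ, map_zero]; exact Submodule.zero_mem _
  · refine isDimBound_one (a := a) (τ := τ)
      (y := fun i => (M.toRamondRep hC).P 0 ((M.toRamondRep hC).Q 0 (x i)))
      (z := fun i => (M.toRamondRep hC).Q 0 (x i)) (fun i => ?_)
      (fun i => (M.toRamondRep hC).Q_part 0 (h.mem i)) hLPQ hLQ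
      (top_le_iff.1 (h0 ▸ Submodule.map_le_iff_le_comap.2 (Submodule.span_le.2 ?_)))
    · have := familyMap_mem h (RSpace.vpm_mem i)
      rwa [RamondRep.familyMap_vpm, zero_add] at this
    · rintro _ (⟨k, rfl⟩ | ⟨k, rfl⟩)
      · exact Submodule.subset_span (.inl ⟨k, (RamondRep.familyMap_vpm _ x k).symm⟩)
      · exact Submodule.subset_span (.inr ⟨k, (RamondRep.familyMap_vm _ x k).symm⟩)

/-- If the image of `plusPart` is zero, then `P_0 x_i = 0` and `P_0 Q_0 x_i` is a multiple of `x_i`,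
so the `x_i` and `Q_0 x_i` span. If it is everything, the images of its generators span. -/
theorem isDimBound_one_of_plus (h2 : 2 * b + c = 2) : M.IsDimBound 1 := by
  have hN : (RModule a b c).IsSubmodule (RSpace.plusPart a) :=
    ⟨fun g w hw => RSpace.plusPart_stable h2 g hw, RSpace.plusPart_graded a⟩
  have hspan := span_family hM h hn
  have hL := h.L_apply 0
  have hLP := h.L_P 0
  have hLQ := h.L_Q 0
  have hLPQ := h.L_P_Q 0
  simp only [Int.cast_zero, mul_zero, add_zero, zero_add, ne_eq, OfNat.ofNat_ne_zero,
    not_false_eq_true, zero_pow, zero_smul] at hL hLP hLQ hLPQ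
  have hPQ : ∀ i, (M.toRamondRep hC).familyMap x (RSpace.vpm i + (2 * a + 2 * i) • RSpace.v i) =
      (M.toRamondRep hC).P 0 ((M.toRamondRep hC).Q 0 (x i)) + (2 * a + 2 * i) • x i := fun i => by
    rw [map_add, map_smul, RamondRep.familyMap_vpm, RamondRep.familyMap_v]
  rcases hM.map_familyMap h hN with h0 | h0
  · have hP : ∀ i, (M.toRamondRep hC).P 0 (x i) = 0 := fun i => by
      rw [← RamondRep.familyMap_vp]
      exact (Submodule.mem_bot ℂ).1 (h0.le (Submodule.mem_map_of_mem (RSpace.vp_mem_plusPart a i)))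
    refine isDimBound_one (a := a) (τ := τ) (y := x) (z := fun i => (M.toRamondRep hC).Q 0 (x i))
      h.mem (fun i => (M.toRamondRep hC).Q_part 0 (h.mem i)) hL hLQ
      (top_le_iff.1 (hspan ▸ Submodule.span_le.2 ?_))
    rintro _ ⟨k, rfl⟩
    cases k with
    | v i => exact Submodule.subset_span (.inl ⟨i, rfl⟩)
    | vm i => exact Submodule.subset_span (.inr ⟨i, rfl⟩)
    | vp i => rw [RamondRep.familyBasis, hP]; exact Submodule.zero_mem _
    | vpm i =>
      have := (Submodule.mem_bot ℂ).1
        (h0.le (Submodule.mem_map_of_mem (RSpace.mem_plusPart a i)))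
      rw [hPQ] at this
      rw [RamondRep.familyBasis, eq_neg_of_add_eq_zero_left this]
      exact Submodule.neg_mem _ (Submodule.smul_mem _ _ (Submodule.subset_span (.inl ⟨i, rfl⟩)))
  · refine isDimBound_one (a := a) (τ := τ) (y := fun i => (M.toRamondRep hC).familyMap x
        (RSpace.vpm i + (2 * a + 2 * i) • RSpace.v i))
      (z := fun i => (M.toRamondRep hC).P 0 (x i)) (fun i => ?_)
      (fun i => (M.toRamondRep hC).P_part 0 (h.mem i)) (fun i => ?_) hLP
      (top_le_iff.1 (h0 ▸ Submodule.map_le_iff_le_comap.2 (Submodule.span_le.2 ?_)))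
    · have := familyMap_mem h (Submodule.add_mem _ (RSpace.vpm_mem i)
        (Submodule.smul_mem _ (2 * a + 2 * i) (RSpace.v_mem i)))
      rwa [zero_add] at this
    · rw [hPQ]
      change (M.toRamondRep hC).L 0 _ = _
      rw [map_add, map_smul, hL, hLPQ]
      module
    · rintro _ (⟨k, rfl⟩ | ⟨k, rfl⟩)
      · exact Submodule.subset_span (.inl ⟨k, rfl⟩)
      · exact Submodule.subset_span (.inr ⟨k, (RamondRep.familyMap_vp _ x k).symm⟩)

theorem bijective_familyMap (h1 : 2 * b + c ≠ 2) (h2 : 2 * b - c ≠ 2) :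
    Function.Bijective ((M.toRamondRep hC).familyMap x) := by
  refine ⟨LinearMap.ker_eq_bot.1 ?_, LinearMap.range_eq_top.1 (range_familyMap hM h hn)⟩
  refine (RSpace.eq_bot_or_eq_top (a := a) (b := b) (c := c) (fun g w hw => ?_) h1
    h2).resolve_right fun htop => hn ?_
  · rw [LinearMap.mem_ker] at hw ⊢
    have := familyMap_act h g w
    rw [hw, map_zero] at this
    exact this.symm
  · rw [← RamondRep.familyMap_v (M.toRamondRep hC) x n]
    exact LinearMap.mem_ker.1 (htop.ge Submodule.mem_top)

/-- The map shifts parity by the parity `τ` of the flat family, which decides between the module and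
its parity change. -/
theorem isomorphic_of_flat (h1 : 2 * b + c ≠ 2) (h2 : 2 * b - c ≠ 2) :
    M.Isomorphic (RModule a b c) ∨ M.Isomorphic (RModule a b c).parityChange := by
  let e := LinearEquiv.ofBijective _ (bijective_familyMap hM h hn h1 h2)
  have hact : ∀ g v, e.symm (M.act g v) = (RModule a b c).act g (e.symm v) := fun g v => by
    rw [LinearEquiv.symm_apply_eq]
    exact (congrArg (M.act g) (e.apply_symm_apply v).symm).trans (familyMap_act h g (e.symm v))
  -- The map preserves parity up to `τ`, so the component of `e.symm v` of the wrong parity is sent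
  -- to zero, and injectivity makes it vanish.
  have hpart : ∀ σ v, v ∈ M.part σ → e.symm v ∈ RSpace.part (σ + τ) := fun σ v hv => by
    have hττ : ∀ ρ : ZMod 2, ρ + τ + τ = ρ := fun ρ => by
      rw [add_assoc, CharTwo.add_self_eq_zero, add_zero]
    obtain ⟨w₀, h₀, w₁, h₁, hw⟩ := (RModule a b c).exists_homogeneous_add (e.symm v)
    have hsum : ∃ w ∈ RSpace.part (σ + τ), ∃ w' ∈ RSpace.part (σ + τ + 1), w + w' = e.symm v := by
      rcases RamondRep.part_cases (σ + τ) with h | h <;> rw [h]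
      · exact ⟨w₀, h₀, w₁, h₁, hw⟩
      · exact ⟨w₁, h₁, w₀, h₀, (add_comm _ _).trans hw⟩
    obtain ⟨w, hw, w', hw', hww⟩ := hsum
    have e1 : (M.toRamondRep hC).familyMap x w ∈ M.part σ := hττ σ ▸ familyMap_mem h hw
    have e2 : (M.toRamondRep hC).familyMap x w' ∈ M.part (σ + 1) := by
      have := familyMap_mem h hw'
      rwa [add_right_comm σ τ 1, hττ] at this
    have e3 : (M.toRamondRep hC).familyMap x w + (M.toRamondRep hC).familyMap x w' = v := by
      rw [← map_add, hww]
      exact e.apply_symm_apply v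
    have hdisj : Disjoint (M.part σ) (M.part (σ + 1)) := by
      rcases RamondRep.part_cases σ with rfl | rfl
      exacts [M.isCompl.disjoint, M.isCompl.disjoint.symm]
    have e4 : (M.toRamondRep hC).familyMap x w' = 0 := by
      refine Submodule.disjoint_def.1 hdisj _ ?_ e2
      rw [eq_sub_of_add_eq' e3]
      exact Submodule.sub_mem _ hv e1
    have e5 : w' = 0 := e.map_eq_zero_iff.1 e4
    rwa [← hww, e5, add_zero]
  rcases RamondRep.part_cases τ with rfl | rfl
  · exact .inl ⟨e.symm, fun σ v hv => (congrArg RSpace.part (add_zero σ)).le (hpart σ v hv), hact⟩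
  · exact .inr ⟨e.symm, hpart, hact⟩

end SuperModule

/-! ### The classification and the final statement. -/

namespace SuperModule

variable {V : Type*} [AddCommGroup V] [Module ℂ V] {M : SuperModule Ramond V}

/-- Simple cuspidal modules of length two are, up to parity change, of the form `R_{a,b,c}`. -/
theorem IsSimple.exists_isomorphic (hM : M.IsSimple) (hc : M.IsCuspidal) (h2 : M.HasLength 2) :
    ∃ a b c : ℂ, 2 * b + c ≠ 2 ∧ 2 * b - c ≠ 2 ∧
      (M.Isomorphic (RModule a b c) ∨ M.Isomorphic (RModule a b c).parityChange) := by
  have hC := hc.act_C_eq_zero hM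
  have hb : M.IsDimBound 2 := h2.1
  have hone : ¬ M.IsDimBound 1 := fun h => absurd (h2.2 h) (by norm_num)
  -- Minimality of the bound two provides a homogeneous weight space of dimension at least two.
  obtain ⟨μ, σ, hμ⟩ : ∃ μ σ, 2 ≤ Module.finrank ℂ (M.weightSpace μ ⊓ M.part σ : Submodule ℂ V) := by
    by_contra! h
    refine hone ⟨one_pos, fun μ σ => ?_⟩
    have := hb.finiteDimensional μ σ
    rw [← Module.finrank_eq_rank]
    exact_mod_cast Nat.le_of_lt_succ (h μ σ)
  obtain ⟨τ, a, b, c, x, h, n, hn⟩ := (toRamondRep_simple hM hC).exists_flat hc.1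
    (fun μ τ => ⟨hb.finiteDimensional μ τ, hb.finrank_le μ τ⟩) hμ
  -- The excluded parameters would make one a dimension bound, against length two.
  have h1 : 2 * b + c ≠ 2 := fun h1 => hone (isDimBound_one_of_plus hM h hn h1)
  have h2 : 2 * b - c ≠ 2 := fun h2 => hone (isDimBound_one_of_minus hM h hn h2)
  exact ⟨a, b, c, h1, h2, isomorphic_of_flat hM h hn h1 h2⟩

end SuperModule

/-- The middle clause records the action formulas, so that `RModule` is visibly the module
described. -/
theorem proposition4p6 :
    (∀ (V : Type*) [AddCommGroup V] [Module ℂ V] (M : SuperModule Ramond V),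
      M.IsSimple → M.IsCuspidal → M.HasLength 2 →
        ∃ a b c : ℂ, 2 * b + c ≠ 2 ∧ 2 * b - c ≠ 2 ∧
          (M.Isomorphic (RModule a b c) ∨ M.Isomorphic (RModule a b c).parityChange)) ∧
    (∀ (a b c : ℂ) (m r i k : ℤ),
      (RModule a b c).act (Ramond.L m) (RSpace.v i) = (a + i + b * m) • RSpace.v (m + i) ∧
      (RModule a b c).act (Ramond.L m) (RSpace.vp k) = (a + k + (b - 1 / 2) * m) • RSpace.vp (m + k) ∧
      (RModule a b c).act (Ramond.L m) (RSpace.vm k) = (a + k + (b - 1 / 2) * m) • RSpace.vm (m + k) ∧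
      (RModule a b c).act (Ramond.H m) (RSpace.v i) = c • RSpace.v (m + i) ∧
      (RModule a b c).act (Ramond.H m) (RSpace.vp k) = (c + 1) • RSpace.vp (m + k) ∧
      (RModule a b c).act (Ramond.H m) (RSpace.vm k) = (c - 1) • RSpace.vm (m + k) ∧
      (RModule a b c).act (Ramond.Gp r) (RSpace.v i) = RSpace.vp (r + i) ∧
      (RModule a b c).act (Ramond.Gm r) (RSpace.v i) = RSpace.vm (r + i) ∧
      (RModule a b c).act (Ramond.Gp r) (RSpace.vp i) = 0 ∧
      (RModule a b c).act (Ramond.Gm r) (RSpace.vm i) = 0 ∧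
      (RModule a b c).act (Ramond.L m) (RSpace.vpm i) = (a + i + (b - 1) * m) • RSpace.vpm (m + i) +
        (1 / 2 * (2 * b - c - 2) * (m : ℂ) ^ 2) • RSpace.v (i + m) ∧
      (RModule a b c).act (Ramond.H m) (RSpace.vpm i) =
        c • RSpace.vpm (m + i) - ((m : ℂ) * (2 * b - c - 2)) • RSpace.v (m + i) ∧
      (RModule a b c).act (Ramond.Gp r) (RSpace.vm k) = RSpace.vpm (k + r) + ((c + 2 - 2 * b) * r) • RSpace.v (k + r) ∧
      (RModule a b c).act (Ramond.Gm r) (RSpace.vp k) =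
        -RSpace.vpm (r + k) - (2 * a + 2 * k + (2 * b + c) * r) • RSpace.v (k + r) ∧
      (RModule a b c).act (Ramond.Gm r) (RSpace.vpm i) =
        -(2 * a + 2 * i + (2 * b + c - 2) * r) • RSpace.vm (r + i) ∧
      (RModule a b c).act (Ramond.Gp r) (RSpace.vpm i) = ((2 * b - c - 2) * r) • RSpace.vp (r + i) ∧
      (RModule a b c).act Ramond.C (RSpace.v i) = 0 ∧ (RModule a b c).act Ramond.C (RSpace.vp i) = 0 ∧
      (RModule a b c).act Ramond.C (RSpace.vm i) = 0 ∧ (RModule a b c).act Ramond.C (RSpace.vpm i) = 0) ∧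
    (∀ a b c : ℂ, (RModule a b c).IsSimple ↔ 2 * b + c ≠ 2 ∧ 2 * b - c ≠ 2) := by
  refine ⟨fun V _ _ M hM hc h2 => hM.exists_isomorphic hc h2, fun a b c m r i k => ?_,
    RModule.isSimple_iff⟩
  refine ⟨RSpace.act_L_v .., RSpace.act_L_vp .., RSpace.act_L_vm .., RSpace.act_H_v ..,
    RSpace.act_H_vp .., RSpace.act_H_vm .., RSpace.act_Gp_v .., RSpace.act_Gm_v ..,
    RSpace.act_Gp_vp .., RSpace.act_Gm_vm .., ?_, RSpace.act_H_vpm .., ?_, ?_,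
    RSpace.act_Gm_vpm .., RSpace.act_Gp_vpm .., RSpace.act_C .., RSpace.act_C ..,
    RSpace.act_C .., RSpace.act_C ..⟩
  · rw [add_comm i m]; exact RSpace.act_L_vpm ..
  · rw [add_comm k r]; exact RSpace.act_Gp_vm ..
  · rw [add_comm k r]; exact RSpace.act_Gm_vp ..
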